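/- Let $k\ge 1$ and let $N\ge 2k+1$. Write $\rho_2\colon H^*(-;\mathbb Z)\to H^*(-;\mathbb Z/2)$ for reduction mod $2$, $\beta\colon H^*(-;\mathbb Z/2)\to H^{*+1}(-;\mathbb Z)$ for the Bockstein of $0\to\mathbb Z\xrightarrow{2}\mathbb Z\to\mathbb Z/2\to 0$, and, for smooth manifolds, $\widehat H^{*}(-;\mathbb Z)$ for ordinary differential cohomology, with its natural map $I\colon\widehat H^{*}(-;\mathbb Z)\to H^{*}(-;\mathbb Z)$ to integral cohomology. Then: 1. For every topological space $X$ and every class $x\in H^p(X;\mathbb Z/2)$, $p\ge 0$, one has $\rho_2\beta Sq^{2k}x=Sq^{2k+1}x$. 2. There are a smooth manifold $X$ and a class $x\in H^N(X;\mathbb Z)$ such that $Sq^{2k+1}\rho_2x\neq 0$ and hence $\beta Sq^{2k}\rho_2 x\neq 0$. 3. $Sq^{2k}$ has no integral lift in degree $N$: there is no natural transformation $\theta\colon H^N(-;\mathbb Z)\to H^{N+2k}(-;\mathbb Z)$ of functors on topological spaces such that $\rho_2\theta=Sq^{2k}\rho_2$. 4. $Sq^{2k}$ has no differential refinement in degree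 $N$: there is no natural transformation $\widehat\theta\colon\widehat H^{N}(-;\mathbb Z)\to\widehat H^{N+2k}(-;\mathbb Z)$ of (set-valued) functors on smooth manifolds such that $\rho_2 I\widehat\theta=Sq^{2k}\rho_2 I$. -/

import Mathlib

open CategoryTheory Opposite
open scoped Manifold ContDiff

noncomputable section

namespace DiffSteenrod

universe u

/-! Cohomology of simplicial sets -/

/-- The set of `n`-simplices of a simplicial set. -/
abbrev Simplex (S : SSet.{u}) (n : ℕ) : Type u := S.obj (op (SimplexCategory.mk n))

section Cohomology

variable (S : SSet.{u}) (A : Type) [AddCommGroup A]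

/-- The `n`-cochains of a simplicial set with coefficients in `A`. -/
abbrev Cochain (n : ℕ) : Type u := Simplex S n → A

/-- The coboundary `(δ a)(σ) = ∑ i, (-1) ^ i a(d_i σ)`. -/
def coboundary (n : ℕ) : Cochain S A n →+ Cochain S A (n + 1) where
  toFun a := fun σ => ∑ i : Fin (n + 2), (-1 : ℤ) ^ (i : ℕ) • a (S.δ i σ)
  map_zero' := by ext; simp
  map_add' a b := by ext; simp [Finset.sum_add_distrib]

theorem coboundary_apply {n : ℕ} (a : Cochain S A n) (σ : Simplex S (n + 1)) :
    coboundary S A n a σ = ∑ i : Fin (n + 2), (-1 : ℤ) ^ (i : ℕ) • a (S.δ i σ) := rfl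

theorem coboundary_coboundary {n : ℕ} (a : Cochain S A n) :
    coboundary S A (n + 1) (coboundary S A n a) = 0 := by
  ext σ
  simp only [coboundary_apply, Pi.zero_apply, Finset.smul_sum, smul_smul]
  rw [← Finset.sum_product']
  let P := Fin (n + 3) × Fin (n + 2)
  let T : Finset P := {ij : P | (ij.1 : ℕ) ≤ (ij.2 : ℕ)}
  rw [Finset.univ_product_univ, ← Finset.sum_add_sum_compl T, ← eq_neg_iff_add_eq_zero,
    ← Finset.sum_neg_distrib]
  let φ : ∀ ij : P, ij ∈ T → P := fun ij hij =>
    (ij.2.succ, Fin.castLT ij.1 (lt_of_le_of_lt (Finset.mem_filter.mp hij).right (Fin.is_lt ij.2)))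
  apply Finset.sum_bij φ
  · intro ij hij
    simp_rw [T, φ, Finset.compl_filter, Finset.mem_filter_univ, Fin.val_succ,
      Fin.val_castLT] at hij ⊢
    lia
  · rintro ⟨i, j⟩ hij ⟨i', j'⟩ hij' h
    rw [Prod.mk_inj]
    exact ⟨by simpa [φ, Fin.castSucc_castLT] using! congr_arg Fin.castSucc (congr_arg Prod.snd h),
      by simpa [φ] using! congr_arg Prod.fst h⟩
  · rintro ⟨i', j'⟩ hij'
    simp_rw [T, Finset.compl_filter, Finset.mem_filter_univ, not_le] at hij'
    refine ⟨(Fin.castSucc j', i'.pred <| ?_), ?_, ?_⟩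
    · rintro rfl
      simp only [Fin.val_zero, not_lt_zero] at hij'
    · simpa [T] using! Nat.le_sub_one_of_lt hij'
    · simp only [φ, Fin.castLT_castSucc, Fin.succ_pred]
  · rintro ⟨i, j⟩ hij
    have hij' : i ≤ Fin.castSucc j := by simpa [T] using! hij
    dsimp only [φ]
    rw [← neg_smul]
    congr 1
    · simp only [Fin.val_succ, Fin.val_castLT, pow_add, pow_one]
      ring
    · have := S.δ_comp_δ'' hij'
      exact congrArg a (ConcreteCategory.congr_hom this σ).symm

/-- The `n`-cocycles. -/
def cocycles (n : ℕ) : AddSubgroup (Cochain S A n) := (coboundary S A n).ker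

/-- The `n`-coboundaries; there are no nonzero ones in degree `0`. -/
def boundaries : ∀ n : ℕ, AddSubgroup (Cochain S A n)
  | 0 => ⊥
  | n + 1 => (coboundary S A n).range

/-- The cohomology group `Hⁿ(S; A)`: cocycles modulo coboundaries. -/
abbrev Cohomology (n : ℕ) : Type u :=
  cocycles S A n ⧸ (boundaries S A n).addSubgroupOf (cocycles S A n)

variable {S A}

/-- The class of a cocycle. -/
def Cohomology.mk {n : ℕ} (a : Cochain S A n) (ha : coboundary S A n a = 0) :
    Cohomology S A n :=
  QuotientAddGroup.mk ⟨a, ha⟩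

theorem Cohomology.mk_eq_mk {n : ℕ} {a b : Cochain S A n} {ha : coboundary S A n a = 0}
    {hb : coboundary S A n b = 0} :
    Cohomology.mk a ha = Cohomology.mk b hb ↔ b - a ∈ boundaries S A n := by
  unfold Cohomology.mk
  rw [QuotientAddGroup.eq, AddSubgroup.mem_addSubgroupOf]
  simp [neg_add_eq_sub]

/-- A map on cocycle representatives which respects cohomology induces a map on cohomology. -/
def Cohomology.lift {T : SSet.{u}} {B : Type} [AddCommGroup B] {n m : ℕ}
    (F : Cochain S A n → Cochain T B m)
    (hF : ∀ a, coboundary S A n a = 0 → coboundary T B m (F a) = 0)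
    (hF' : ∀ a b, coboundary S A n a = 0 → coboundary S A n b = 0 →
      b - a ∈ boundaries S A n → F b - F a ∈ boundaries T B m) :
    Cohomology S A n → Cohomology T B m :=
  Quotient.lift (fun a : cocycles S A n => Cohomology.mk (F a.1) (hF a.1 a.2)) (by
    intro a b hab
    rw [Cohomology.mk_eq_mk]
    refine hF' _ _ a.2 b.2 ?_
    have := QuotientAddGroup.leftRel_apply.mp hab
    rw [AddSubgroup.mem_addSubgroupOf] at this
    simpa [neg_add_eq_sub] using this)

theorem Cohomology.lift_mk {T : SSet.{u}} {B : Type} [AddCommGroup B] {n m : ℕ}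
    (F : Cochain S A n → Cochain T B m) (hF) (hF') (a : Cochain S A n)
    (ha : coboundary S A n a = 0) :
    Cohomology.lift F hF hF' (Cohomology.mk a ha) = Cohomology.mk (F a) (hF a ha) := rfl

/-- Pullback of cochains along a map of simplicial sets. -/
def pullCochain {S T : SSet.{u}} (f : S ⟶ T) (A : Type) (n : ℕ) (a : Cochain T A n) :
    Cochain S A n :=
  fun σ => a (f.app (op (SimplexCategory.mk n)) σ)

theorem coboundary_pullCochain {S T : SSet.{u}} (f : S ⟶ T) {n : ℕ} (a : Cochain T A n) :
    coboundary S A n (pullCochain f A n a) = pullCochain f A (n + 1) (coboundary T A n a) := by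
  ext σ
  simp only [coboundary_apply, pullCochain]
  refine Finset.sum_congr rfl fun i _ => ?_
  congr 2
  exact ConcreteCategory.congr_hom (SimplicialObject.δ_naturality f i) σ

theorem pullCochain_mem_boundaries {S T : SSet.{u}} (f : S ⟶ T) {n : ℕ} {a : Cochain T A n}
    (ha : a ∈ boundaries T A n) : pullCochain f A n a ∈ boundaries S A n := by
  cases n with
  | zero =>
    have : a = 0 := ha
    subst this
    exact (boundaries S A 0).zero_mem
  | succ n =>
    obtain ⟨b, rfl⟩ := ha
    exact ⟨pullCochain f A n b, coboundary_pullCochain f b⟩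

/-- The pullback `f^* : Hⁿ(T; A) → Hⁿ(S; A)`. -/
def Cohomology.pull {S T : SSet.{u}} (f : S ⟶ T) {n : ℕ} :
    Cohomology T A n → Cohomology S A n :=
  Cohomology.lift (pullCochain f A n)
    (fun a ha => by rw [coboundary_pullCochain, ha]; rfl)
    (fun _ _ _ _ h => pullCochain_mem_boundaries f h)

/-- Change of coefficients of a cochain. -/
def coeffCochain {A B : Type} [AddCommGroup A] [AddCommGroup B] (φ : A →+ B) {n : ℕ}
    (a : Cochain S A n) : Cochain S B n :=
  fun σ => φ (a σ)

theorem coboundary_coeffCochain {A B : Type} [AddCommGroup A] [AddCommGroup B] (φ : A →+ B)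
    {n : ℕ} (a : Cochain S A n) :
    coboundary S B n (coeffCochain φ a) = coeffCochain φ (coboundary S A n a) := by
  ext σ
  simp [coboundary_apply, coeffCochain, map_sum, map_zsmul]

/-- The map `Hⁿ(S; A) → Hⁿ(S; B)` induced by a homomorphism of coefficients. -/
def Cohomology.coeff {A B : Type} [AddCommGroup A] [AddCommGroup B] (φ : A →+ B) {n : ℕ} :
    Cohomology S A n → Cohomology S B n :=
  Cohomology.lift (coeffCochain φ)
    (fun a ha => by rw [coboundary_coeffCochain, ha]; ext; simp [coeffCochain])
    (fun a b _ _ h => by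
      have hsub : coeffCochain φ b - coeffCochain φ a = coeffCochain φ (b - a) := by
        ext; simp [coeffCochain]
      rw [hsub]
      cases n with
      | zero =>
        have : b - a = 0 := h
        rw [this]
        have h0 : coeffCochain (S := S) (n := 0) φ 0 = 0 := by ext; simp [coeffCochain]
        rw [h0]
        exact (boundaries S B 0).zero_mem
      | succ n =>
        obtain ⟨c, hc⟩ := h
        exact ⟨coeffCochain φ c, by rw [coboundary_coeffCochain, hc]⟩)

end Cohomology

/-! Reduction mod 2 and the Bockstein -/

section Bockstein

variable {S : SSet.{u}}

/-- Reduction mod 2, `ρ₂ : Hⁿ(S; ℤ) → Hⁿ(S; ℤ/2)`. -/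
def rho {n : ℕ} : Cohomology S ℤ n → Cohomology S (ZMod 2) n :=
  Cohomology.coeff (Int.castAddHom (ZMod 2))

/-- The integral lift, with values in `{0, 1}`, of a mod 2 cochain. -/
def liftCochain {n : ℕ} (a : Cochain S (ZMod 2) n) : Cochain S ℤ n :=
  fun σ => ((a σ).val : ℤ)

theorem coeff_liftCochain {n : ℕ} (a : Cochain S (ZMod 2) n) :
    coeffCochain (Int.castAddHom (ZMod 2)) (liftCochain a) = a := by
  ext σ
  simp [coeffCochain, liftCochain]

theorem exists_two_mul {n : ℕ} (a : Cochain S ℤ n)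
    (ha : coeffCochain (Int.castAddHom (ZMod 2)) a = 0) :
    ∃ e : Cochain S ℤ n, a = (2 : ℤ) • e := by
  have h : ∀ σ, ∃ e : ℤ, a σ = 2 * e := fun σ => by
    have h1 := congrFun ha σ
    simp only [coeffCochain, Int.coe_castAddHom, Pi.zero_apply] at h1
    exact (ZMod.intCast_zmod_eq_zero_iff_dvd (a σ) 2).mp h1
  choose e he using h
  exact ⟨e, by ext σ; simp [he]⟩

/-- On cochains the Bockstein sends `a` to `δ ã / 2`, where `ã` is an integral lift of `a`. -/
def bocksteinCochain {n : ℕ} (a : Cochain S (ZMod 2) n) : Cochain S ℤ (n + 1) :=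
  fun σ => coboundary S ℤ n (liftCochain a) σ / 2

theorem two_smul_bocksteinCochain {n : ℕ} (a : Cochain S (ZMod 2) n)
    (ha : coboundary S (ZMod 2) n a = 0) :
    (2 : ℤ) • bocksteinCochain a = coboundary S ℤ n (liftCochain a) := by
  obtain ⟨e, he⟩ := exists_two_mul (coboundary S ℤ n (liftCochain a)) (by
    rw [← coboundary_coeffCochain, coeff_liftCochain, ha])
  ext σ
  simp only [bocksteinCochain, he, Pi.smul_apply, smul_eq_mul]
  rw [Int.mul_ediv_cancel_left _ two_ne_zero]

theorem two_smul_cancel {n : ℕ} {a b : Cochain S ℤ n} (h : (2 : ℤ) • a = (2 : ℤ) • b) :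
    a = b := by
  ext σ
  have := congrFun h σ
  simp only [Pi.smul_apply, smul_eq_mul] at this
  linarith

/-- The Bockstein `β : Hⁿ(S; ℤ/2) → Hⁿ⁺¹(S; ℤ)`, the connecting map of
`0 → ℤ → ℤ → ℤ/2 → 0`. -/
def bockstein {n : ℕ} : Cohomology S (ZMod 2) n → Cohomology S ℤ (n + 1) :=
  Cohomology.lift bocksteinCochain
    (fun a ha => by
      apply two_smul_cancel
      rw [← map_zsmul, two_smul_bocksteinCochain a ha, coboundary_coboundary, smul_zero])
    (fun a b ha hb h => by
      obtain ⟨c, hc⟩ : ∃ c : Cochain S ℤ n, coboundary S ℤ n c = 0 ∧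
          b - a = coeffCochain (Int.castAddHom (ZMod 2)) c := by
        cases n with
        | zero =>
          have : b - a = 0 := h
          exact ⟨0, map_zero _, by rw [this]; ext; simp [coeffCochain]⟩
        | succ n =>
          obtain ⟨c, hc⟩ := h
          refine ⟨coboundary S ℤ n (liftCochain c), coboundary_coboundary S ℤ _, ?_⟩
          rw [← coboundary_coeffCochain, coeff_liftCochain, hc]
      obtain ⟨e, he⟩ := exists_two_mul (liftCochain b - liftCochain a - c) (by
        ext σ
        have h1 := congrFun hc.2 σ
        have h2 := congrFun (coeff_liftCochain b) σ
        have h3 := congrFun (coeff_liftCochain a) σ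
        simp only [coeffCochain, Int.coe_castAddHom, Pi.sub_apply, Pi.zero_apply, Int.cast_sub]
          at h1 h2 h3 ⊢
        rw [h2, h3, h1, sub_self])
      refine ⟨e, ?_⟩
      apply two_smul_cancel
      rw [smul_sub, two_smul_bocksteinCochain a ha, two_smul_bocksteinCochain b hb, ← map_zsmul,
        ← he, map_sub, map_sub, hc.1, sub_zero])

end Bockstein

/-! Steenrod's cup-`i` products mod 2 and the Steenrod squares -/

section CutSets

variable {N : ℕ}

/-- The number of elements of `C` which are smaller than `v`. -/
def below (C : Finset (Fin N)) (v : Fin N) : ℕ := (C.filter (· < v)).card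

/-- For `C = {c₀ < c₁ < ⋯ < cᵢ}`: the vertices in `[0, c₀] ∪ [c₁, c₂] ∪ [c₃, c₄] ∪ ⋯`. -/
def leftPart (C : Finset (Fin N)) : Finset (Fin N) :=
  Finset.univ.filter fun v => v ∈ C ∨ Even (below C v)

/-- For `C = {c₀ < c₁ < ⋯ < cᵢ}`: the vertices in `[c₀, c₁] ∪ [c₂, c₃] ∪ ⋯`. -/
def rightPart (C : Finset (Fin N)) : Finset (Fin N) :=
  Finset.univ.filter fun v => v ∈ C ∨ ¬ Even (below C v)

/-- Auxiliary to the coboundary formula: the two parts are exchanged from position `t` on. -/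
def leftTwist (t : ℕ) (C : Finset (Fin N)) : Finset (Fin N) :=
  Finset.univ.filter fun v => v ∈ C ∨ (Even (below C v) ↔ v.1 < t)

/-- Auxiliary to the coboundary formula: the two parts are exchanged from position `t` on. -/
def rightTwist (t : ℕ) (C : Finset (Fin N)) : Finset (Fin N) :=
  Finset.univ.filter fun v => v ∈ C ∨ ¬ (Even (below C v) ↔ v.1 < t)

theorem leftTwist_zero (C : Finset (Fin N)) : leftTwist 0 C = rightPart C := by
  ext v; simp [leftTwist, rightPart]

theorem rightTwist_zero (C : Finset (Fin N)) : rightTwist 0 C = leftPart C := by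
  ext v; simp [rightTwist, leftPart]

theorem leftTwist_top (C : Finset (Fin N)) : leftTwist N C = leftPart C := by
  ext v; simp [leftTwist, leftPart]

theorem rightTwist_top (C : Finset (Fin N)) : rightTwist N C = rightPart C := by
  ext v; simp [rightTwist, rightPart]

theorem below_insert {C : Finset (Fin N)} {v : Fin N} (hv : v ∉ C) (w : Fin N) :
    below (insert v C) w = below C w + if v < w then 1 else 0 := by
  unfold below
  rw [Finset.filter_insert]
  split_ifs with h
  · rw [Finset.card_insert_of_notMem (by simp [hv])]
  · rfl

theorem twist_of_even {C : Finset (Fin N)} {v : Fin N} (hv : v ∉ C) (h : Even (below C v)) :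
    leftTwist v.1 C = (leftPart (insert v C)).erase v ∧
    rightTwist v.1 C = rightPart (insert v C) ∧
    leftTwist (v.1 + 1) C = leftPart (insert v C) ∧
    rightTwist (v.1 + 1) C = (rightPart (insert v C)).erase v := by
  refine ⟨?_, ?_, ?_, ?_⟩ <;> ext w <;>
    simp only [leftTwist, rightTwist, leftPart, rightPart, Finset.mem_filter, Finset.mem_univ,
      true_and, Finset.mem_erase, Finset.mem_insert, below_insert hv] <;>
    rcases lt_trichotomy v w with hw | rfl | hw
  all_goals
    first
    | (have h1 : v.1 < w.1 := hw
       have h2 : ¬ w.1 < v.1 + 1 := by omega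
       have h3 : ¬ w.1 < v.1 := by omega
       simp [hw, hw.ne', h2, h3, Nat.even_add_one])
    | (simp [hv, h]; done)
    | (have h1 : w.1 < v.1 := hw
       have h2 : w.1 < v.1 + 1 := by omega
       simp [h1, hw.ne, h2, not_lt.mpr hw.le])

theorem twist_of_odd {C : Finset (Fin N)} {v : Fin N} (hv : v ∉ C) (h : ¬ Even (below C v)) :
    leftTwist v.1 C = leftPart (insert v C) ∧
    rightTwist v.1 C = (rightPart (insert v C)).erase v ∧
    leftTwist (v.1 + 1) C = (leftPart (insert v C)).erase v ∧
    rightTwist (v.1 + 1) C = rightPart (insert v C) := by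
  refine ⟨?_, ?_, ?_, ?_⟩ <;> ext w <;>
    simp only [leftTwist, rightTwist, leftPart, rightPart, Finset.mem_filter, Finset.mem_univ,
      true_and, Finset.mem_erase, Finset.mem_insert, below_insert hv] <;>
    rcases lt_trichotomy v w with hw | rfl | hw
  all_goals
    first
    | (have h1 : v.1 < w.1 := hw
       have h2 : ¬ w.1 < v.1 + 1 := by omega
       have h3 : ¬ w.1 < v.1 := by omega
       simp [hw, hw.ne', h2, h3, Nat.even_add_one])
    | (simp [hv, h]; done)
    | (have h1 : w.1 < v.1 := hw
       have h2 : w.1 < v.1 + 1 := by omega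
       simp [h1, hw.ne, h2, not_lt.mpr hw.le])

theorem twist_of_mem {C : Finset (Fin N)} {v : Fin N} (hv : v ∈ C) :
    leftTwist (v.1 + 1) C = leftTwist v.1 C ∧ rightTwist (v.1 + 1) C = rightTwist v.1 C := by
  constructor <;> ext w <;>
    simp only [leftTwist, rightTwist, Finset.mem_filter, Finset.mem_univ, true_and] <;>
    by_cases hw : w = v
  · simp [hw, hv]
  · have : w.1 < v.1 + 1 ↔ w.1 < v.1 := by
      have : w.1 ≠ v.1 := fun h => hw (Fin.ext h)
      omega
    rw [this]
  · simp [hw, hv]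
  · have : w.1 < v.1 + 1 ↔ w.1 < v.1 := by
      have : w.1 ≠ v.1 := fun h => hw (Fin.ext h)
      omega
    rw [this]

/-- Sums over pairs `v ∈ C` are sums over pairs `v ∉ C`. -/
theorem sum_mem_eq_sum_notMem (F : Fin N → Finset (Fin N) → ZMod 2) :
    ∑ C : Finset (Fin N), ∑ v ∈ C, F v C =
      ∑ C : Finset (Fin N), ∑ v ∈ Cᶜ, F v (insert v C) := by
  rw [Finset.sum_sigma', Finset.sum_sigma']
  refine Finset.sum_bij' (fun x _ => ⟨x.1.erase x.2, x.2⟩) (fun x _ => ⟨insert x.2 x.1, x.2⟩)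
    ?_ ?_ ?_ ?_ ?_
  · rintro ⟨C, v⟩ h; simp
  · rintro ⟨C, v⟩ h; simp
  · rintro ⟨C, v⟩ h
    have : v ∈ C := by simpa using h
    simp [Finset.insert_erase this]
  · rintro ⟨C, v⟩ h
    have : v ∉ C := by simpa using h
    simp [Finset.erase_insert this]
  · rintro ⟨C, v⟩ h
    have : v ∈ C := by simpa using h
    simp [Finset.insert_erase this]

/-- The terms in which a vertex of `C` is removed cancel against the exchanged products. -/
theorem sum_cut_terms (f g : Finset (Fin N) → ZMod 2) :
    ∑ C : Finset (Fin N), ((∑ v ∈ C, (f ((leftPart C).erase v) * g (rightPart C) +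
        f (leftPart C) * g ((rightPart C).erase v))) +
      f (leftPart C) * g (rightPart C) + f (rightPart C) * g (leftPart C)) = 0 := by
  simp only [Finset.sum_add_distrib (f := fun C => (∑ v ∈ C, _) + _),
    Finset.sum_add_distrib (f := fun C => ∑ v ∈ C, _)]
  rw [sum_mem_eq_sum_notMem (fun v C => f ((leftPart C).erase v) * g (rightPart C) +
        f (leftPart C) * g ((rightPart C).erase v)), ← Finset.sum_add_distrib,
    ← Finset.sum_add_distrib]
  refine Finset.sum_eq_zero fun C _ => ?_
  set P : ℕ → ZMod 2 := fun t => f (leftTwist t C) * g (rightTwist t C) with hP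
  have h1 : ∀ v ∈ Cᶜ, f ((leftPart (insert v C)).erase v) * g (rightPart (insert v C)) +
        f (leftPart (insert v C)) * g ((rightPart (insert v C)).erase v) =
        P (v.1 + 1) - P v.1 := by
    intro v hv
    have hv' : v ∉ C := by simpa using hv
    rw [CharTwo.sub_eq_add]
    by_cases h : Even (below C v)
    · obtain ⟨e1, e2, e3, e4⟩ := twist_of_even hv' h
      simp only [hP, e1, e2, e3, e4]
      ring
    · obtain ⟨e1, e2, e3, e4⟩ := twist_of_odd hv' h
      simp only [hP, e1, e2, e3, e4]
  have h2 : ∑ v ∈ Cᶜ, (P (v.1 + 1) - P v.1) = ∑ v : Fin N, (P (v.1 + 1) - P v.1) := by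
    refine Finset.sum_subset (Finset.subset_univ _) fun v _ hv => ?_
    have hv' : v ∈ C := by simpa using hv
    simp [hP, twist_of_mem hv']
  rw [Finset.sum_congr rfl h1, h2, Fin.sum_univ_eq_sum_range (fun t => P (t + 1) - P t),
    Finset.sum_range_sub]
  simp only [hP, leftTwist_zero, rightTwist_zero, leftTwist_top, rightTwist_top]
  have h3 : ∀ x y : ZMod 2, x - y + x + y = 0 := by decide
  rw [mul_comm (f (rightPart C))]
  simpa [mul_comm] using h3 _ _

/-- Passing to the face opposite to `v`. -/
theorem below_map (v : Fin (N + 1)) (C : Finset (Fin N)) (w : Fin N) :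
    below (C.map v.succAboveEmb) (v.succAbove w) = below C w := by
  unfold below
  rw [Finset.filter_map, Finset.card_map]
  congr 1
  ext x
  rw [Finset.mem_filter, Finset.mem_filter]
  exact and_congr_right fun _ => Fin.succAbove_lt_succAbove_iff

theorem leftPart_map (v : Fin (N + 1)) (C : Finset (Fin N)) :
    (leftPart C).map v.succAboveEmb = (leftPart (C.map v.succAboveEmb)).erase v := by
  ext w
  rcases Fin.eq_self_or_eq_succAbove v w with rfl | ⟨w, rfl⟩
  · simp
  · simp [leftPart, below_map]

theorem rightPart_map (v : Fin (N + 1)) (C : Finset (Fin N)) :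
    (rightPart C).map v.succAboveEmb = (rightPart (C.map v.succAboveEmb)).erase v := by
  ext w
  rcases Fin.eq_self_or_eq_succAbove v w with rfl | ⟨w, rfl⟩
  · simp
  · simp [rightPart, below_map]

theorem sum_face (v : Fin (N + 1)) (F : Finset (Fin (N + 1)) → ZMod 2) :
    ∑ C : Finset (Fin N), F (C.map v.succAboveEmb) =
      ∑ C : Finset (Fin (N + 1)), if v ∉ C then F C else 0 := by
  rw [← Finset.sum_filter]
  refine Finset.sum_bij (fun C _ => C.map v.succAboveEmb) ?_ ?_ ?_ ?_
  · intro C _; simp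
  · intro C _ C' _ h; exact Finset.map_injective _ h
  · intro C hC
    have hv : v ∉ C := by simpa using hC
    refine ⟨Finset.univ.filter fun w => v.succAbove w ∈ C, Finset.mem_univ _, ?_⟩
    ext w
    rcases Fin.eq_self_or_eq_succAbove v w with rfl | ⟨w, rfl⟩
    · simp [hv]
    · simp
  · intro C _; rfl

/-- The combinatorial form of the coboundary formula for the cup-`i` products. -/
theorem sum_faces (f g : Finset (Fin (N + 1)) → ZMod 2) :
    ∑ v : Fin (N + 1), ∑ C : Finset (Fin N),
        f ((leftPart C).map v.succAboveEmb) * g ((rightPart C).map v.succAboveEmb) =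
      ∑ C : Finset (Fin (N + 1)),
        ((∑ v ∈ leftPart C, f ((leftPart C).erase v)) * g (rightPart C) +
          f (leftPart C) * (∑ v ∈ rightPart C, g ((rightPart C).erase v)) +
          f (leftPart C) * g (rightPart C) + f (rightPart C) * g (leftPart C)) := by
  have hsplitL : ∀ C : Finset (Fin (N + 1)), ∑ v ∈ leftPart C, f ((leftPart C).erase v) =
      ∑ v ∈ C, f ((leftPart C).erase v) + ∑ v ∈ Cᶜ, if Even (below C v) then
        f ((leftPart C).erase v) else 0 := by
    intro C
    rw [← Finset.sum_filter, ← Finset.sum_union]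
    · congr 1
      ext v; by_cases h : v ∈ C <;> simp [leftPart, h]
    · rw [Finset.disjoint_left]; intro v hv hv'; simp at hv'; exact hv'.1 hv
  have hsplitR : ∀ C : Finset (Fin (N + 1)), ∑ v ∈ rightPart C, g ((rightPart C).erase v) =
      ∑ v ∈ C, g ((rightPart C).erase v) + ∑ v ∈ Cᶜ, if Even (below C v) then
        0 else g ((rightPart C).erase v) := by
    intro C
    have : ∀ v, (if Even (below C v) then 0 else g ((rightPart C).erase v)) =
      if ¬ Even (below C v) then g ((rightPart C).erase v) else 0 := fun v => by
        split_ifs <;> rfl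
    simp only [this]
    rw [← Finset.sum_filter, ← Finset.sum_union]
    · congr 1
      ext v; by_cases h : v ∈ C <;> simp [rightPart, h]
    · rw [Finset.disjoint_left]; intro v hv hv'; simp at hv'; exact hv'.1 hv
  have key := sum_cut_terms f g
  rw [← add_zero (∑ v : Fin (N + 1), _), ← key]
  simp only [leftPart_map, rightPart_map]
  rw [Finset.sum_congr rfl fun v _ => sum_face v fun C =>
    f ((leftPart C).erase v) * g ((rightPart C).erase v), Finset.sum_comm,
    ← Finset.sum_add_distrib]
  refine Finset.sum_congr rfl fun C _ => ?_
  have hL : ∑ v : Fin (N + 1), (if v ∉ C then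
      f ((leftPart C).erase v) * g ((rightPart C).erase v) else 0) =
      (∑ v ∈ Cᶜ, if Even (below C v) then f ((leftPart C).erase v) else 0) * g (rightPart C) +
      f (leftPart C) * ∑ v ∈ Cᶜ, if Even (below C v) then 0 else g ((rightPart C).erase v) := by
    rw [← Finset.sum_filter, Finset.sum_mul, Finset.mul_sum, ← Finset.sum_add_distrib]
    have : (Finset.univ.filter fun v => v ∉ C) = Cᶜ := by ext; simp
    rw [this]
    refine Finset.sum_congr rfl fun v hv => ?_
    have hv' : v ∉ C := by simpa using hv
    by_cases h : Even (below C v)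
    · have : v ∉ rightPart C := by simp [rightPart, hv', h]
      simp [h, Finset.erase_eq_of_notMem this]
    · have : v ∉ leftPart C := by simp [leftPart, hv', h]
      simp [h, Finset.erase_eq_of_notMem this]
  rw [hL, hsplitL, hsplitR, Finset.sum_add_distrib, ← Finset.sum_mul, ← Finset.mul_sum]
  ring

end CutSets

section CupI

variable {S : SSet.{u}}

/-- The value of a cochain on the face of `σ` spanned by the vertices in `B`, and `0` if this face
does not have the dimension of the cochain. -/
def evalFace {p m : ℕ} (a : Cochain S (ZMod 2) p) (σ : Simplex S m) (B : Finset (Fin (m + 1))) :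
    ZMod 2 :=
  if h : B.card = p + 1 then
    a (S.map (SimplexCategory.mkHom (B.orderEmbOfFin h).toOrderHom).op σ) else 0

/-- Steenrod's product `a ∪ᵢ b` of mod 2 cochains, `i = p + q - m`:
`(a ∪ᵢ b)(σ) = ∑ a(σ|[0, c₀] ∪ [c₁, c₂] ∪ ⋯) b(σ|[c₀, c₁] ∪ [c₂, c₃] ∪ ⋯)`, the sum being over
all `C = {c₀ < ⋯ < cᵢ}` for which the two faces have dimensions `p` and `q`.
(These dimensions force `C` to have `i + 1` elements. The product is zero for `i < 0`.) -/
def cupI {p q : ℕ} (m : ℕ) (a : Cochain S (ZMod 2) p) (b : Cochain S (ZMod 2) q) :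
    Cochain S (ZMod 2) m :=
  fun σ => ∑ C : Finset (Fin (m + 1)), evalFace a σ (leftPart C) * evalFace b σ (rightPart C)

theorem evalFace_face {p m : ℕ} (a : Cochain S (ZMod 2) p) (σ : Simplex S (m + 1))
    (v : Fin (m + 2)) (B : Finset (Fin (m + 1))) :
    evalFace a (S.δ v σ) B = evalFace a σ (B.map v.succAboveEmb) := by
  unfold evalFace
  by_cases h : B.card = p + 1
  · have h' : (B.map v.succAboveEmb).card = p + 1 := by rw [Finset.card_map, h]
    rw [dif_pos h, dif_pos h']
    congr 1
    have e : SimplexCategory.mkHom (B.orderEmbOfFin h).toOrderHom ≫ SimplexCategory.δ v =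
        SimplexCategory.mkHom ((B.map v.succAboveEmb).orderEmbOfFin h').toOrderHom := by
      ext1
      apply OrderHom.ext
      refine Finset.orderEmbOfFin_unique h' (f := fun x => v.succAbove (B.orderEmbOfFin h x))
        (fun x => ?_) ?_
      · simp
      · exact (Fin.strictMono_succAbove v).comp (B.orderEmbOfFin h).strictMono
    rw [← e, op_comp, S.map_comp]
    rfl
  · have h' : ¬ (B.map v.succAboveEmb).card = p + 1 := by rwa [Finset.card_map]
    rw [dif_neg h, dif_neg h']

theorem evalFace_coboundary {p m : ℕ} (a : Cochain S (ZMod 2) p) (σ : Simplex S m)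
    (B : Finset (Fin (m + 1))) :
    evalFace (coboundary S (ZMod 2) p a) σ B = ∑ v ∈ B, evalFace a σ (B.erase v) := by
  by_cases h : B.card = p + 2
  · have hsum : ∑ v ∈ B, evalFace a σ (B.erase v) =
        ∑ i : Fin (p + 2), evalFace a σ (B.erase (B.orderEmbOfFin h i)) := by
      conv_lhs => rw [← Finset.image_orderEmbOfFin_univ B h]
      rw [Finset.sum_image (fun x _ y _ e => (B.orderEmbOfFin h).injective e)]
      rw [Finset.image_orderEmbOfFin_univ B h]
    rw [hsum]
    unfold evalFace
    rw [dif_pos h, coboundary_apply]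
    refine Finset.sum_congr rfl fun i _ => ?_
    have h' : (B.erase (B.orderEmbOfFin h i)).card = p + 1 := by
      rw [Finset.card_erase_of_mem (Finset.orderEmbOfFin_mem B h i), h]; rfl
    rw [dif_pos h']
    have hs : ∀ x : ZMod 2, (-1 : ℤ) ^ (i : ℕ) • x = x := by
      intro x
      rcases neg_one_pow_eq_or ℤ (i : ℕ) with e | e <;> rw [e] <;> revert x <;> decide
    rw [hs]
    congr 1
    have e : SimplexCategory.δ i ≫ SimplexCategory.mkHom (B.orderEmbOfFin h).toOrderHom =
        SimplexCategory.mkHom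
          ((B.erase (B.orderEmbOfFin h i)).orderEmbOfFin h').toOrderHom := by
      ext1
      apply OrderHom.ext
      refine Finset.orderEmbOfFin_unique h' (f := fun x => B.orderEmbOfFin h (i.succAbove x))
        (fun x => ?_) ?_
      · simp [Finset.orderEmbOfFin_mem, Fin.succAbove_ne]
      · exact (B.orderEmbOfFin h).strictMono.comp (Fin.strictMono_succAbove i)
    rw [← e, op_comp, S.map_comp]
    rfl
  · unfold evalFace
    rw [dif_neg h, Finset.sum_eq_zero]
    intro v hv
    rw [dif_neg]
    rw [Finset.card_erase_of_mem hv]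
    have := Finset.card_pos.mpr ⟨v, hv⟩
    omega

/-- The coboundary formula `δ(a ∪ᵢ b) = δa ∪ᵢ b + a ∪ᵢ δb + a ∪ᵢ₋₁ b + b ∪ᵢ₋₁ a`. -/
theorem coboundary_cupI {p q m : ℕ} (a : Cochain S (ZMod 2) p) (b : Cochain S (ZMod 2) q) :
    coboundary S (ZMod 2) m (cupI m a b) =
      cupI (m + 1) (coboundary S (ZMod 2) p a) b + cupI (m + 1) a (coboundary S (ZMod 2) q b) +
        cupI (m + 1) a b + cupI (m + 1) b a := by
  ext σ
  have hs : ∀ (i : ℕ) (x : ZMod 2), (-1 : ℤ) ^ i • x = x := by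
    intro i x
    rcases neg_one_pow_eq_or ℤ i with e | e <;> rw [e] <;> revert x <;> decide
  rw [coboundary_apply]
  simp only [hs, cupI, Pi.add_apply, evalFace_face, evalFace_coboundary]
  rw [sum_faces (evalFace a σ) (evalFace b σ), ← Finset.sum_add_distrib,
    ← Finset.sum_add_distrib, ← Finset.sum_add_distrib]
  refine Finset.sum_congr rfl fun C _ => ?_
  rw [mul_comm (evalFace a σ (rightPart C))]

theorem evalFace_add {p m : ℕ} (a b : Cochain S (ZMod 2) p) (σ : Simplex S m)
    (B : Finset (Fin (m + 1))) :
    evalFace (a + b) σ B = evalFace a σ B + evalFace b σ B := by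
  unfold evalFace
  split_ifs <;> simp

theorem evalFace_zero {p m : ℕ} (σ : Simplex S m) (B : Finset (Fin (m + 1))) :
    evalFace (0 : Cochain S (ZMod 2) p) σ B = 0 := by
  unfold evalFace
  split_ifs <;> rfl

theorem cupI_add_left {p q m : ℕ} (a a' : Cochain S (ZMod 2) p) (b : Cochain S (ZMod 2) q) :
    cupI m (a + a') b = cupI m a b + cupI m a' b := by
  ext σ
  simp [cupI, evalFace_add, add_mul, Finset.sum_add_distrib]

theorem cupI_add_right {p q m : ℕ} (a : Cochain S (ZMod 2) p) (b b' : Cochain S (ZMod 2) q) :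
    cupI m a (b + b') = cupI m a b + cupI m a b' := by
  ext σ
  simp [cupI, evalFace_add, mul_add, Finset.sum_add_distrib]

theorem cupI_zero_left {p q m : ℕ} (b : Cochain S (ZMod 2) q) :
    cupI m (0 : Cochain S (ZMod 2) p) b = 0 := by
  ext σ
  simp [cupI, evalFace_zero]

theorem cupI_zero_right {p q m : ℕ} (a : Cochain S (ZMod 2) p) :
    cupI m a (0 : Cochain S (ZMod 2) q) = 0 := by
  ext σ
  simp [cupI, evalFace_zero]

theorem cochain_add_self {n : ℕ} (a : Cochain S (ZMod 2) n) : a + a = 0 := by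
  ext σ
  exact CharTwo.add_self_eq_zero (a σ)

theorem coboundary_cupI_self {n m : ℕ} (a : Cochain S (ZMod 2) n)
    (ha : coboundary S (ZMod 2) n a = 0) :
    coboundary S (ZMod 2) m (cupI m a a) = 0 := by
  rw [coboundary_cupI, ha, cupI_zero_left, cupI_zero_right, zero_add, zero_add,
    cochain_add_self]

theorem cupI_self_congr {n m : ℕ} (hnm : n ≤ m) (a b : Cochain S (ZMod 2) n)
    (ha : coboundary S (ZMod 2) n a = 0) (h : b - a ∈ boundaries S (ZMod 2) n) :
    cupI m b b - cupI m a a ∈ boundaries S (ZMod 2) m := by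
  cases n with
  | zero =>
    have h0 : b = a := sub_eq_zero.mp h
    rw [h0, sub_self]
    exact (boundaries S (ZMod 2) m).zero_mem
  | succ n =>
    obtain ⟨m, rfl⟩ : ∃ r, m = r + 1 := ⟨m - 1, by omega⟩
    obtain ⟨c, hc⟩ := h
    have hb : b = a + coboundary S (ZMod 2) n c := by rw [hc]; abel
    refine ⟨cupI m a (coboundary S (ZMod 2) n c) + cupI m c (coboundary S (ZMod 2) n c) +
      cupI m c c, ?_⟩
    rw [map_add, map_add, coboundary_cupI, coboundary_cupI, coboundary_cupI,
      coboundary_coboundary, ha, hb]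
    simp only [cupI_add_left, cupI_add_right, cupI_zero_left, cupI_zero_right]
    ext σ
    simp only [Pi.add_apply, Pi.sub_apply, Pi.zero_apply]
    generalize cupI (m + 1) a (coboundary S (ZMod 2) n c) σ = x1
    generalize cupI (m + 1) (coboundary S (ZMod 2) n c) a σ = x2
    generalize cupI (m + 1) (coboundary S (ZMod 2) n c) (coboundary S (ZMod 2) n c) σ = x3
    generalize cupI (m + 1) c (coboundary S (ZMod 2) n c) σ = x4
    generalize cupI (m + 1) (coboundary S (ZMod 2) n c) c σ = x5
    generalize cupI (m + 1) c c σ = x6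
    generalize cupI (m + 1) a a σ = x7
    revert x1 x2 x3 x4 x5 x6 x7
    decide

/-- The Steenrod square `Sqᵏ : Hⁿ(S; ℤ/2) → Hᵐ(S; ℤ/2)`, `m = n + k`, which sends the class of a
cocycle `a` to the class of `a ∪ᵢ a` with `i = n - k` (so to zero for `k > n`). -/
def Sq (k : ℕ) {n m : ℕ} (h : n + k = m) : Cohomology S (ZMod 2) n → Cohomology S (ZMod 2) m :=
  Cohomology.lift (fun a => cupI m a a) (fun a ha => coboundary_cupI_self a ha)
    (fun a b ha _ hab => cupI_self_congr (h ▸ Nat.le_add_right n k) a b ha hab)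

end CupI

/-! Smooth manifolds, closed forms and smooth singular simplices -/

section Manifolds

/-- The model space `ℝᵈ`. -/
abbrev E (d : ℕ) : Type := EuclideanSpace ℝ (Fin d)

/-- A finite-dimensional smooth manifold (Hausdorff, second countable, without boundary). -/
structure SmoothManifold where
  dim : ℕ
  carrier : Type
  [top : TopologicalSpace carrier]
  [charted : ChartedSpace (E dim) carrier]
  [smooth : IsManifold (𝓡 dim) ∞ carrier]
  [t2 : T2Space carrier]
  [secondCountable : SecondCountableTopology carrier]

attribute [instance] SmoothManifold.top SmoothManifold.charted SmoothManifold.smooth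
  SmoothManifold.t2 SmoothManifold.secondCountable

/-- Smooth maps between manifolds. -/
structure SmoothMap (X Y : SmoothManifold) where
  toFun : X.carrier → Y.carrier
  smooth : ContMDiff (𝓡 X.dim) (𝓡 Y.dim) ∞ toFun

variable {X Y : SmoothManifold}

/-- The pullback `φ^* w` of a family `w` of alternating forms on the tangent spaces of `X` along a
map `φ : ℝᵉ → X`, at the point `u`. -/
def pullForm {n e : ℕ}
    (w : ∀ x : X.carrier, TangentSpace (𝓡 X.dim) x [⋀^Fin n]→L[ℝ] ℝ) (φ : E e → X.carrier)
    (u : E e) : E e [⋀^Fin n]→L[ℝ] ℝ :=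
  (w (φ u)).compContinuousLinearMap (mfderiv (𝓡 e) (𝓡 X.dim) φ u)

/-- A closed differential `n`-form on `X`: a family of alternating forms on the tangent spaces,
smooth and closed. As usual this is checked on the pullbacks of the form along smooth maps from open
subsets of Euclidean spaces, among them the inverses of the charts of `X`. -/
structure ClosedForm (X : SmoothManifold) (n : ℕ) where
  toFun : ∀ x : X.carrier, TangentSpace (𝓡 X.dim) x [⋀^Fin n]→L[ℝ] ℝ
  smooth : ∀ (e : ℕ) (U : Set (E e)) (φ : E e → X.carrier), IsOpen U →
    ContMDiffOn (𝓡 e) (𝓡 X.dim) ∞ φ U → ContDiffOn ℝ ∞ (pullForm toFun φ) U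
  closed : ∀ (e : ℕ) (U : Set (E e)) (φ : E e → X.carrier), IsOpen U →
    ContMDiffOn (𝓡 e) (𝓡 X.dim) ∞ φ U → ∀ u ∈ U, extDeriv (pullForm toFun φ) u = 0

theorem ClosedForm.ext {n : ℕ} {w η : ClosedForm X n} (h : w.toFun = η.toFun) : w = η := by
  cases w; cases η; cases h; rfl

/-- The pullback `f^* w`, as a family of alternating forms. -/
def pullFormMap {n : ℕ} (f : SmoothMap X Y)
    (w : ∀ y : Y.carrier, TangentSpace (𝓡 Y.dim) y [⋀^Fin n]→L[ℝ] ℝ) (x : X.carrier) :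
    TangentSpace (𝓡 X.dim) x [⋀^Fin n]→L[ℝ] ℝ :=
  (w (f.toFun x)).compContinuousLinearMap (mfderiv (𝓡 X.dim) (𝓡 Y.dim) f.toFun x)

theorem pullForm_pullFormMap {n e : ℕ} (f : SmoothMap X Y)
    (w : ∀ y : Y.carrier, TangentSpace (𝓡 Y.dim) y [⋀^Fin n]→L[ℝ] ℝ) (φ : E e → X.carrier)
    (u : E e) (hφ : MDifferentiableAt (𝓡 e) (𝓡 X.dim) φ u) :
    pullForm (pullFormMap f w) φ u = pullForm w (f.toFun ∘ φ) u := by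
  have hf : MDifferentiableAt (𝓡 X.dim) (𝓡 Y.dim) f.toFun (φ u) :=
    f.smooth.mdifferentiable (by simp) _
  unfold pullForm pullFormMap
  rw [mfderiv_comp u hf hφ]
  rfl

theorem ContMDiffOn.mdifferentiableAt_of_isOpen {e : ℕ} {U : Set (E e)} {φ : E e → X.carrier}
    (hU : IsOpen U) (hφ : ContMDiffOn (𝓡 e) (𝓡 X.dim) ∞ φ U) {u : E e} (hu : u ∈ U) :
    MDifferentiableAt (𝓡 e) (𝓡 X.dim) φ u :=
  (hφ.contMDiffAt (hU.mem_nhds hu)).mdifferentiableAt (by simp)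

/-- The pullback of closed forms along smooth maps. -/
def ClosedForm.pull {n : ℕ} (f : SmoothMap X Y) (w : ClosedForm Y n) : ClosedForm X n where
  toFun := pullFormMap f w.toFun
  smooth e U φ hU hφ :=
    (w.smooth e U (f.toFun ∘ φ) hU (f.smooth.comp_contMDiffOn hφ)).congr fun u hu =>
      pullForm_pullFormMap f w.toFun φ u (ContMDiffOn.mdifferentiableAt_of_isOpen hU hφ hu)
  closed e U φ hU hφ u hu := by
    rw [← w.closed e U (f.toFun ∘ φ) hU (f.smooth.comp_contMDiffOn hφ) u hu]
    have h : pullForm (pullFormMap f w.toFun) φ =ᶠ[nhds u] pullForm w.toFun (f.toFun ∘ φ) :=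
      Filter.eventually_of_mem (hU.mem_nhds hu) fun v hv =>
        pullForm_pullFormMap f w.toFun φ v (ContMDiffOn.mdifferentiableAt_of_isOpen hU hφ hv)
    unfold extDeriv
    rw [h.fderiv_eq]

/-- The singular simplicial set of a manifold. -/
abbrev Sing (X : SmoothManifold) : SSet.{0} := TopCat.toSSet.obj (TopCat.of X.carrier)

/-- A singular simplex as a continuous map on the standard simplex. -/
def simplexMap {n : SimplexCategoryᵒᵖ} (σ : (Sing X).obj n) :
    C(stdSimplex ℝ (Fin (n.unop.len + 1)), X.carrier) :=
  TopCat.toSSetObjEquiv (TopCat.of X.carrier) n σ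

/-- A simplex `σ : Δˡ → X` is smooth if it extends to a smooth map on a neighbourhood of `Δˡ`. -/
def IsSmoothSimplex {l : ℕ} (σ : C(stdSimplex ℝ (Fin (l + 1)), X.carrier)) : Prop :=
  ∃ (V : Set (Fin (l + 1) → ℝ)) (F : (Fin (l + 1) → ℝ) → X.carrier), IsOpen V ∧
    stdSimplex ℝ (Fin (l + 1)) ⊆ V ∧
    ContMDiffOn 𝓘(ℝ, Fin (l + 1) → ℝ) (𝓡 X.dim) ∞ F V ∧
    ∀ p : stdSimplex ℝ (Fin (l + 1)), F p.1 = σ p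

theorem simplexMap_map {n m : SimplexCategoryᵒᵖ} (i : n ⟶ m) (σ : (Sing X).obj n)
    (p : stdSimplex ℝ (Fin (m.unop.len + 1))) :
    simplexMap ((Sing X).map i σ) p = simplexMap σ (stdSimplex.map i.unop.toOrderHom p) := rfl

/-- The simplicial set of smooth singular simplices of a manifold. -/
def smoothSing (X : SmoothManifold) : (Sing X).Subcomplex where
  obj n := {σ | IsSmoothSimplex (simplexMap σ)}
  map {n m} i := by
    rintro σ ⟨V, F, hV, hΔ, hF, hσ⟩
    let L : (Fin (m.unop.len + 1) → ℝ) →L[ℝ] (Fin (n.unop.len + 1) → ℝ) :=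
      LinearMap.toContinuousLinearMap (FunOnFinite.linearMap ℝ ℝ i.unop.toOrderHom)
    refine ⟨L ⁻¹' V, F ∘ L, hV.preimage L.continuous, ?_, ?_, ?_⟩
    · intro p hp
      exact hΔ (stdSimplex.map i.unop.toOrderHom ⟨p, hp⟩).2
    · exact hF.comp L.contMDiff.contMDiffOn (fun _ h => h)
    · intro p
      rw [simplexMap_map, ← hσ]
      rfl

/-- The smooth singular simplicial set. -/
abbrev SmSing (X : SmoothManifold) : SSet.{0} := (smoothSing X).toSSet

/-- The map of singular simplicial sets induced by a smooth map. -/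
def SmoothMap.sing (f : SmoothMap X Y) : Sing X ⟶ Sing Y :=
  TopCat.toSSet.map (TopCat.ofHom ⟨f.toFun, f.smooth.continuous⟩)

theorem SmoothMap.simplexMap_sing (f : SmoothMap X Y) {n : SimplexCategoryᵒᵖ}
    (σ : (Sing X).obj n) (p : stdSimplex ℝ (Fin (n.unop.len + 1))) :
    simplexMap (f.sing.app n σ) p = f.toFun (simplexMap σ p) := rfl

/-- The map of smooth singular simplicial sets induced by a smooth map. -/
def SmoothMap.smSing (f : SmoothMap X Y) : SmSing X ⟶ SmSing Y :=
  SSet.Subcomplex.lift ((smoothSing X).ι ≫ f.sing) (by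
    rintro n _ ⟨⟨σ, V, F, hV, hΔ, hF, hσ⟩, rfl⟩
    exact ⟨V, f.toFun ∘ F, hV, hΔ, f.smooth.comp_contMDiffOn hF, fun p => by
      rw [Function.comp_apply, hσ]; rfl⟩)

end Manifolds

/-! Integration of forms over simplices -/

section Integration

variable {X Y : SmoothManifold}

/-- The interior of the simplex `{t ∈ ℝⁿ : tᵢ ≥ 0, ∑ tᵢ ≤ 1}`. -/
def openCorner (n : ℕ) : Set (E n) := {t | (∀ i, 0 < t i) ∧ ∑ i, t i < 1}

/-- The parametrization `t ↦ (1 - ∑ tᵢ, t₁, …, tₙ)` of the standard simplex. -/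
def barycentric {n : ℕ} (t : E n) : Fin (n + 1) → ℝ := Fin.cons (1 - ∑ i, t i) (fun i => t i)

open Classical in
/-- The simplex `σ` in the coordinates `t₁, …, tₙ` (with a constant value off the simplex). -/
def inCoords {n : ℕ} (σ : C(stdSimplex ℝ (Fin (n + 1)), X.carrier)) (t : E n) : X.carrier :=
  if h : barycentric t ∈ stdSimplex ℝ (Fin (n + 1)) then σ ⟨barycentric t, h⟩
  else σ (stdSimplex.vertex 0)

/-- The integral `∫_σ w` of an `n`-form over an `n`-simplex,
`∫ w(∂σ/∂t₁, …, ∂σ/∂tₙ) dt₁ ⋯ dtₙ`. -/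
def integrate {n : ℕ} (w : ClosedForm X n) (σ : C(stdSimplex ℝ (Fin (n + 1)), X.carrier)) : ℝ :=
  ∫ t in openCorner n, pullForm w.toFun (inCoords σ) t (fun i => EuclideanSpace.single i (1 : ℝ))

/-- The smooth singular cochain `σ ↦ ∫_σ w`. -/
def integralCochain {n : ℕ} (w : ClosedForm X n) : Cochain (SmSing X) ℝ n :=
  fun σ => integrate w (simplexMap σ.1)

theorem isOpen_openCorner (n : ℕ) : IsOpen (openCorner n) := by
  have h : openCorner n = (⋂ i, {t : E n | 0 < t i}) ∩ {t | ∑ i, t i < 1} := by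
    ext t; simp [openCorner]
  rw [h]
  refine IsOpen.inter (isOpen_iInter_of_finite fun i => ?_) ?_
  · exact isOpen_lt continuous_const (by fun_prop)
  · exact isOpen_lt (by fun_prop) continuous_const

theorem barycentric_mem {n : ℕ} {t : E n} (ht : t ∈ openCorner n) :
    barycentric t ∈ stdSimplex ℝ (Fin (n + 1)) := by
  refine ⟨fun i => ?_, ?_⟩
  · refine Fin.cases ?_ (fun i => ?_) i
    · simpa [barycentric] using ht.2.le
    · simpa [barycentric] using (ht.1 i).le
  · simp [barycentric, Fin.sum_univ_succ]

theorem mdifferentiableAt_inCoords {n : ℕ} {σ : C(stdSimplex ℝ (Fin (n + 1)), X.carrier)}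
    (hσ : IsSmoothSimplex σ) {t : E n} (ht : t ∈ openCorner n) :
    MDifferentiableAt (𝓡 n) (𝓡 X.dim) (inCoords σ) t := by
  obtain ⟨V, F, hV, hΔ, hF, hFσ⟩ := hσ
  have hb : ContDiff ℝ ∞ (barycentric (n := n)) := by
    rw [contDiff_pi]
    intro i
    refine Fin.cases ?_ (fun i => ?_) i
    · simp only [barycentric, Fin.cons_zero]
      fun_prop
    · simp only [barycentric, Fin.cons_succ]
      fun_prop
  have h1 : MDifferentiableAt (𝓡 n) (𝓡 X.dim) (F ∘ barycentric) t := by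
    have h2 : ContMDiffAt 𝓘(ℝ, Fin (n + 1) → ℝ) (𝓡 X.dim) ∞ F (barycentric t) :=
      hF.contMDiffAt (hV.mem_nhds (hΔ (barycentric_mem ht)))
    exact (h2.comp t hb.contMDiff.contMDiffAt).mdifferentiableAt (by simp)
  refine h1.congr_of_eventuallyEq ?_
  refine Filter.eventually_of_mem ((isOpen_openCorner n).mem_nhds ht) fun s hs => ?_
  unfold inCoords
  rw [dif_pos (barycentric_mem hs), ← hFσ]
  rfl

theorem integralCochain_pull {n : ℕ} (f : SmoothMap X Y) (w : ClosedForm Y n) :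
    integralCochain (w.pull f) = pullCochain f.smSing ℝ n (integralCochain w) := by
  ext σ
  unfold integralCochain pullCochain integrate
  refine MeasureTheory.setIntegral_congr_fun (isOpen_openCorner n).measurableSet fun t ht => ?_
  have h := pullForm_pullFormMap f w.toFun (inCoords (simplexMap σ.1)) t
    (mdifferentiableAt_inCoords σ.2 ht)
  have h2 : inCoords (simplexMap (f.smSing.app _ σ).1) =
      f.toFun ∘ inCoords (simplexMap σ.1) := by
    ext s
    unfold inCoords
    rw [Function.comp_apply]
    split_ifs <;> rfl
  dsimp only
  rw [h2, ← h]
  rfl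

end Integration

/-! Ordinary differential cohomology -/

section DifferentialCohomology

variable {X Y : SmoothManifold}

/-- The real smooth singular cochain underlying an integral singular cochain. -/
def toSmoothReal {n : ℕ} (c : Cochain (Sing X) ℤ n) : Cochain (SmSing X) ℝ n :=
  coeffCochain (Int.castAddHom ℝ) (pullCochain (smoothSing X).ι ℤ n c)

/-- A differential cocycle of degree `n + 1` on `X`: an integral singular cocycle `c`, a closed
form `curv`, both of degree `n + 1`, and a real cochain `h` with `δ h = ∫ curv - c`. Differential
cocycles are the points of the homotopy pullback of closed forms and integral cochains over real
cochains. -/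
structure DiffCocycle (X : SmoothManifold) (n : ℕ) where
  c : Cochain (Sing X) ℤ (n + 1)
  h : Cochain (SmSing X) ℝ n
  curv : ClosedForm X (n + 1)
  coboundary_c : coboundary (Sing X) ℤ (n + 1) c = 0
  coboundary_h : coboundary (SmSing X) ℝ n h = integralCochain curv - toSmoothReal c

/-- Two differential cocycles are equivalent if they have the same curvature and their other
components are `(c, h)` and `(c + δ b, h - b + z)`, with `b` an integral cochain and `z` a real
coboundary. -/
def DiffCocycle.Equivalent {n : ℕ} (x y : DiffCocycle X n) : Prop :=
  x.curv = y.curv ∧ ∃ b : Cochain (Sing X) ℤ n,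
    y.c = x.c + coboundary (Sing X) ℤ n b ∧
    y.h - x.h + toSmoothReal b ∈ boundaries (SmSing X) ℝ n

theorem toSmoothReal_add {n : ℕ} (a b : Cochain (Sing X) ℤ n) :
    toSmoothReal (a + b) = toSmoothReal a + toSmoothReal b := by
  ext σ; simp [toSmoothReal, coeffCochain, pullCochain]

theorem toSmoothReal_neg {n : ℕ} (a : Cochain (Sing X) ℤ n) :
    toSmoothReal (-a) = -toSmoothReal a := by
  ext σ; simp [toSmoothReal, coeffCochain, pullCochain]

theorem toSmoothReal_zero {n : ℕ} : toSmoothReal (0 : Cochain (Sing X) ℤ n) = 0 := by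
  ext σ; simp [toSmoothReal, coeffCochain, pullCochain]

instance diffCocycleSetoid (X : SmoothManifold) (n : ℕ) : Setoid (DiffCocycle X n) where
  r := DiffCocycle.Equivalent
  iseqv :=
    { refl := fun x => ⟨rfl, 0, by simp, by
        rw [sub_self, toSmoothReal_zero, add_zero]; exact AddSubgroup.zero_mem _⟩
      symm := by
        rintro x y ⟨hw, b, hc, hh⟩
        refine ⟨hw.symm, -b, by rw [hc, map_neg]; abel, ?_⟩
        have := (boundaries (SmSing X) ℝ n).neg_mem hh
        rw [toSmoothReal_neg]
        convert this using 1
        abel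
      trans := by
        rintro x y z ⟨hw, b, hc, hh⟩ ⟨hw', b', hc', hh'⟩
        refine ⟨hw.trans hw', b + b', by rw [hc', hc, map_add]; abel, ?_⟩
        have := (boundaries (SmSing X) ℝ n).add_mem hh hh'
        rw [toSmoothReal_add]
        convert this using 1
        abel }

/-- The differential cohomology `Ĥⁿ⁺¹(X; ℤ)`, i.e. the isomorphism classes of `U(1)`-bundles of
degree `n` with connection on `X` (line bundles with connection for `n = 1`). -/
def DiffCohomology (X : SmoothManifold) (n : ℕ) : Type := Quotient (diffCocycleSetoid X n)

/-- The map `I : Ĥⁿ⁺¹(X; ℤ) → Hⁿ⁺¹(X; ℤ)` to the underlying integral class. -/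
def DiffCohomology.I {n : ℕ} : DiffCohomology X n → Cohomology (Sing X) ℤ (n + 1) :=
  Quotient.lift (fun x : DiffCocycle X n => Cohomology.mk x.c x.coboundary_c) (by
    rintro x y ⟨-, b, hc, -⟩
    rw [Cohomology.mk_eq_mk, hc, add_sub_cancel_left]
    exact ⟨b, rfl⟩)

theorem toSmoothReal_pull {n : ℕ} (f : SmoothMap X Y) (c : Cochain (Sing Y) ℤ n) :
    toSmoothReal (pullCochain f.sing ℤ n c) = pullCochain f.smSing ℝ n (toSmoothReal c) := rfl

/-- The pullback of differential cocycles along smooth maps. -/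
def DiffCocycle.pull {n : ℕ} (f : SmoothMap X Y) (x : DiffCocycle Y n) : DiffCocycle X n where
  c := pullCochain f.sing ℤ (n + 1) x.c
  h := pullCochain f.smSing ℝ n x.h
  curv := x.curv.pull f
  coboundary_c := by rw [coboundary_pullCochain, x.coboundary_c]; rfl
  coboundary_h := by
    rw [coboundary_pullCochain, x.coboundary_h, integralCochain_pull, toSmoothReal_pull]; rfl

/-- The pullback `f^* : Ĥⁿ⁺¹(Y; ℤ) → Ĥⁿ⁺¹(X; ℤ)`. -/
def DiffCohomology.pull {n : ℕ} (f : SmoothMap X Y) : DiffCohomology Y n → DiffCohomology X n :=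
  Quotient.map' (DiffCocycle.pull f) (by
    rintro x y ⟨hw, b, hc, hh⟩
    refine ⟨congrArg (ClosedForm.pull f) hw, pullCochain f.sing ℤ n b, ?_, ?_⟩
    · rw [coboundary_pullCochain]
      exact congrArg (pullCochain f.sing ℤ (n + 1)) hc
    · exact pullCochain_mem_boundaries f.smSing hh)

end DifferentialCohomology

/-! Cohomology operations -/

/-- An integral cohomology operation: a natural transformation
`Hᵖ(-; ℤ) → H^q(-; ℤ)` of functors on topological spaces. -/
structure IntegralOperation (p q : ℕ) where
  app : ∀ X : TopCat.{0}, Cohomology (TopCat.toSSet.obj X) ℤ p →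
    Cohomology (TopCat.toSSet.obj X) ℤ q
  naturality : ∀ {X Y : TopCat.{0}} (f : X ⟶ Y) (x : Cohomology (TopCat.toSSet.obj Y) ℤ p),
    app X (Cohomology.pull (TopCat.toSSet.map f) x) =
      Cohomology.pull (TopCat.toSSet.map f) (app Y x)

/-- A differential cohomology operation: a natural transformation
`Ĥⁿ⁺¹(-; ℤ) → Ĥᵐ⁺¹(-; ℤ)` of functors on smooth manifolds. -/
structure DifferentialOperation (n m : ℕ) where
  app : ∀ X : SmoothManifold, DiffCohomology X n → DiffCohomology X m
  naturality : ∀ {X Y : SmoothManifold} (f : SmoothMap X Y) (x : DiffCohomology Y n),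
    app X (x.pull f) = (app Y x).pull f

/-- `θ` is an integral lift of `Sqᵏ` on integral classes of degree `p`: `ρ₂ θ = Sqᵏ ρ₂`. -/
def IntegralOperation.Lifts {p q : ℕ} (θ : IntegralOperation p q) (k : ℕ) (h : p + k = q) :
    Prop :=
  ∀ (X : TopCat.{0}) (x : Cohomology (TopCat.toSSet.obj X) ℤ p),
    rho (θ.app X x) = Sq k h (rho x)

/-- `θ` is a differential refinement of `Sqᵏ` on classes of degree `n + 1`: `ρ₂ I θ = Sqᵏ ρ₂ I`. -/
def DifferentialOperation.Refines {n m : ℕ} (θ : DifferentialOperation n m) (k : ℕ)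
    (h : n + 1 + k = m + 1) : Prop :=
  ∀ (X : SmoothManifold) (x : DiffCohomology X n),
    rho (θ.app X x).I = Sq k h (rho x.I)

end DiffSteenrod

end

/-! Everything rests on one class: a mod 2 class y of degree n on a manifold with Sq²ᵏ⁺¹(ρ₂βy) ≠ 0.
Put x = βy. Since βρ₂ = 0, a class z with ρ₂z = Sq²ᵏρ₂x would force βSq²ᵏρ₂x = 0, while ρ₂βSq²ᵏρ₂x =
Sq²ᵏ⁺¹ρ₂x ≠ 0. This excludes an integral lift. It also excludes a differential refinement, because x
lies in the image of `I`: a Bockstein underlies the flat differential cocycle with components (βy,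
-ỹ/2, 0), where ỹ is the {0, 1}-valued lift of y (`flatCocycle`).

The relation ρ₂βSq²ᵏ = Sq²ᵏ⁺¹ is proved on cochains (`sq1_cupI_self`). The cup-i products are lifted
to ℤ by inserting shuffle signs, with the coboundary formula `coboundary_cupInt`. For an integral
lift ã of a cocycle a, the two ∪ᵢ₋₁ terms of δ(ã ∪ᵢ ã) have equal signs exactly in the parity at
hand. Half of this coboundary therefore reduces mod 2 to a ∪ᵢ₋₁ a, up to the coboundary of Sq¹a ∪ᵢ₊₁
a.

For n = 2k the operation Sq²ᵏ⁺¹ on degree 2k + 1 is the cup square. Take y = t₁²ᵏ⁻¹t₂ as on ℝP^∞ ×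
ℝP^∞; then Sq¹y = t₁²ᵏ⁻¹t₂(t₁ + t₂) has nonzero square. The role of ℝP^∞ is played by `signSpace`,
an open subset of a vector space with a tautological double cover, so that products of copies are
manifolds with one chart. The classes t₁, t₂ come from the holonomy of the covers, which maps
singular simplices to the nerve of (ℤ/2)². Nonvanishing is detected by an explicit cycle with
coefficients in (ℤ/2)[X], on which evaluation is multiplicative with t₁ ↦ X and t₂ ↦ 1
(`evalSteps_cup`, `sum_coboundary_eq_zero`).

For larger n, y is multiplied by the class of the double cover of another `signSpace`, which is
nontrivial along a loop. Pulled back to the cylinder along this loop, the product is the suspension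
of y. Suspension commutes with Sq¹ and with the cup-i squares on cochains (`sq1_susp`, `cupI_susp`),
and integration over the loop undoes it (`mem_boundaries_of_susp`). -/

noncomputable section

namespace DiffSteenrod

universe u

/-! ### Combinatorics of cuts with shuffle signs. -/

section SignedCuts

variable {N : ℕ}

/-- The number of elements of `A \ B` below `v`. -/
def belowDiff (A B : Finset (Fin N)) (v : Fin N) : ℕ := ((A \ B).filter (· < v)).card

/-- The number of elements of `A \ B` above `v`. -/
def aboveDiff (A B : Finset (Fin N)) (v : Fin N) : ℕ := ((A \ B).filter (v < ·)).card

/-- The sign of the shuffle which moves `A \ B` in front of `B \ A`. -/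
def shuffleSign (A B : Finset (Fin N)) : ℤ :=
  ∏ l ∈ A \ B, (-1) ^ belowDiff B A l

theorem shuffleSign_eq_prod (A B : Finset (Fin N)) :
    shuffleSign A B = ∏ l ∈ A \ B, ∏ r ∈ B \ A, if r < l then -1 else 1 := by
  refine Finset.prod_congr rfl fun l _ => ?_
  rw [Finset.prod_ite, Finset.prod_const, Finset.prod_const_one, mul_one]
  rfl

/-- The same inversions, counted from their other member. -/
theorem shuffleSign_eq_prod' (A B : Finset (Fin N)) :
    shuffleSign A B = ∏ r ∈ B \ A, (-1) ^ aboveDiff A B r := by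
  rw [shuffleSign_eq_prod, Finset.prod_comm]
  refine Finset.prod_congr rfl fun l _ => ?_
  rw [Finset.prod_ite, Finset.prod_const, Finset.prod_const_one, mul_one]
  rfl

/-- Each pair in (A \ B) × (B \ A) is an inversion for exactly one of the two orders. -/
theorem shuffleSign_swap (A B : Finset (Fin N)) :
    shuffleSign B A = (-1) ^ ((A \ B).card * (B \ A).card) * shuffleSign A B := by
  have h : (-1 : ℤ) ^ ((A \ B).card * (B \ A).card) = ∏ _l ∈ A \ B, ∏ _r ∈ B \ A, (-1) := by
    simp only [Finset.prod_const]
    rw [← pow_mul, mul_comm]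
  rw [shuffleSign_eq_prod, shuffleSign_eq_prod, Finset.prod_comm, h, ← Finset.prod_mul_distrib]
  refine Finset.prod_congr rfl fun l hl => ?_
  rw [← Finset.prod_mul_distrib]
  refine Finset.prod_congr rfl fun r hr => ?_
  rcases lt_trichotomy l r with h | h | h
  · simp [h, h.not_gt]
  · subst h
    simp only [Finset.mem_sdiff] at hl hr
    exact absurd hr.1 hl.2
  · simp [h, h.not_gt]

theorem shuffleSign_erase_both {A B : Finset (Fin N)} {v : Fin N} (hA : v ∈ A) (hB : v ∈ B) :
    shuffleSign (A.erase v) (B.erase v) = shuffleSign A B := by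
  have h1 : A.erase v \ B.erase v = A \ B := by
    ext w; by_cases h : w = v <;> simp [h, hB]
  have h2 : B.erase v \ A.erase v = B \ A := by
    ext w; by_cases h : w = v <;> simp [h, hA]
  unfold shuffleSign belowDiff
  rw [h1, h2]

theorem shuffleSign_erase_left {A B : Finset (Fin N)} {v : Fin N} (hA : v ∈ A) (hB : v ∉ B) :
    shuffleSign A B = (-1) ^ belowDiff B A v * shuffleSign (A.erase v) B := by
  have h1 : A.erase v \ B = (A \ B).erase v := by
    ext w; by_cases h : w = v <;> simp [h]
  have h2 : B \ A.erase v = B \ A := by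
    ext w; by_cases h : w = v <;> simp [h, hA, hB]
  unfold shuffleSign belowDiff
  rw [h1, h2]
  exact (Finset.mul_prod_erase (A \ B)
    (fun l => (-1 : ℤ) ^ ((B \ A).filter (· < l)).card) (by simp [hA, hB])).symm

theorem shuffleSign_erase_right {A B : Finset (Fin N)} {v : Fin N} (hA : v ∉ A) (hB : v ∈ B) :
    shuffleSign A B = (-1) ^ aboveDiff A B v * shuffleSign A (B.erase v) := by
  have h1 : B.erase v \ A = (B \ A).erase v := by
    ext w; by_cases h : w = v <;> simp [h]
  have h2 : A \ B.erase v = A \ B := by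
    ext w; by_cases h : w = v <;> simp [h, hA, hB]
  rw [shuffleSign_eq_prod', shuffleSign_eq_prod']
  unfold aboveDiff
  rw [h1, h2]
  exact (Finset.mul_prod_erase (B \ A)
    (fun l => (-1 : ℤ) ^ ((A \ B).filter (l < ·)).card) (by simp [hA, hB])).symm

theorem card_sdiff_eq (A B : Finset (Fin N)) {v : Fin N} (hv : v ∉ A \ B) :
    (A \ B).card = belowDiff A B v + aboveDiff A B v := by
  unfold belowDiff aboveDiff
  rw [← Finset.card_union_of_disjoint, ← Finset.filter_or]
  · congr 1
    ext w
    simp only [Finset.mem_filter, iff_self_and]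
    intro hw
    have : w ≠ v := fun h => hv (h ▸ hw)
    exact lt_or_gt_of_ne this
  · rw [Finset.disjoint_filter]
    intro w _ h; exact h.not_gt

theorem below_eq_add {A B : Finset (Fin N)} (v : Fin N) :
    below A v = below (A ∩ B) v + belowDiff A B v := by
  unfold below belowDiff
  rw [← Finset.card_union_of_disjoint, ← Finset.filter_union]
  · congr 2
    ext w; by_cases h : w ∈ B <;> simp [h]
  · rw [Finset.disjoint_left]
    intro w hw hw'
    simp only [Finset.mem_filter, Finset.mem_inter, Finset.mem_sdiff] at hw hw'
    exact hw'.1.2 hw.1.2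

theorem leftPart_inter_rightPart (C : Finset (Fin N)) : leftPart C ∩ rightPart C = C := by
  ext v
  simp only [leftPart, rightPart, Finset.mem_inter, Finset.mem_filter, Finset.mem_univ, true_and]
  tauto

theorem leftPart_union_rightPart (C : Finset (Fin N)) :
    leftPart C ∪ rightPart C = Finset.univ := by
  ext v
  simp only [leftPart, rightPart, Finset.mem_union, Finset.mem_filter, Finset.mem_univ, true_and,
    iff_true]
  tauto

theorem mem_leftPart_of_mem {C : Finset (Fin N)} {v : Fin N} (h : v ∈ C) : v ∈ leftPart C := by
  simp [leftPart, h]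

theorem mem_rightPart_of_mem {C : Finset (Fin N)} {v : Fin N} (h : v ∈ C) :
    v ∈ rightPart C := by
  simp [rightPart, h]

theorem belowDiff_erase_left {A B : Finset (Fin N)} (v : Fin N) :
    belowDiff (A.erase v) B v = belowDiff A B v := by
  unfold belowDiff
  congr 1
  ext w
  simp only [Finset.mem_filter, Finset.mem_sdiff, Finset.mem_erase]
  constructor
  · tauto
  · rintro ⟨⟨h1, h2⟩, h3⟩; exact ⟨⟨⟨h3.ne, h1⟩, h2⟩, h3⟩

theorem aboveDiff_erase_left {A B : Finset (Fin N)} (v : Fin N) :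
    aboveDiff (A.erase v) B v = aboveDiff A B v := by
  unfold aboveDiff
  congr 1
  ext w
  simp only [Finset.mem_filter, Finset.mem_sdiff, Finset.mem_erase]
  constructor
  · tauto
  · rintro ⟨⟨h1, h2⟩, h3⟩; exact ⟨⟨⟨h3.ne', h1⟩, h2⟩, h3⟩

theorem card_erase_sdiff_of_mem {A B : Finset (Fin N)} {v : Fin N} (hB : v ∈ B) :
    (A.erase v \ B).card = (A \ B).card := by
  congr 1
  ext w
  simp only [Finset.mem_sdiff, Finset.mem_erase]
  constructor
  · tauto
  · rintro ⟨h1, h2⟩; exact ⟨⟨fun h => h2 (h ▸ hB), h1⟩, h2⟩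

theorem card_sdiff_erase_of_mem {A B : Finset (Fin N)} {v : Fin N} (hA : v ∈ A) (hB : v ∈ B) :
    (A \ B.erase v).card = (A \ B).card + 1 := by
  have : A \ B.erase v = insert v (A \ B) := by
    ext w
    by_cases h : w = v <;> simp [h, hA]
  rw [this, Finset.card_insert_of_notMem (by simp [hB])]

/-- The signed product of two functions on the parts `A`, `B`. -/
def signedProd (f g : Finset (Fin N) → ℤ) (A B : Finset (Fin N)) : ℤ :=
  shuffleSign A B * (f A * g B)

/-- The terms in which the common vertex `v` is removed from one of the two parts. -/
theorem signedProd_erase {A B : Finset (Fin N)} {v : Fin N} (hA : v ∈ A) (hB : v ∈ B)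
    (f g : Finset (Fin N) → ℤ) :
    shuffleSign A B * ((-1) ^ below A v * f (A.erase v) * g B +
      (-1) ^ (A \ B).card * ((-1) ^ below B v * f A * g (B.erase v))) =
    (-1) ^ below (A ∩ B) v * ((-1) ^ (A.erase v \ B).card * signedProd f g (A.erase v) B -
      (-1) ^ (A \ B.erase v).card * signedProd f g A (B.erase v)) := by
  -- Erased from one part, the common vertex becomes a private vertex of the other part. It then
  -- takes part in the shuffle and creates inversions there.
  have e1 : shuffleSign (A.erase v) B = (-1) ^ aboveDiff A B v * shuffleSign A B := by
    rw [shuffleSign_erase_right (by simp) hB, aboveDiff_erase_left, shuffleSign_erase_both hA hB]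
  have e2 : shuffleSign A (B.erase v) = (-1) ^ belowDiff B A v * shuffleSign A B := by
    rw [shuffleSign_erase_left hA (by simp), belowDiff_erase_left, shuffleSign_erase_both hA hB]
  unfold signedProd
  rw [e1, e2, card_erase_sdiff_of_mem hB, card_sdiff_erase_of_mem hA hB,
    below_eq_add (A := A) (B := B) v, below_eq_add (A := B) (B := A) v, Finset.inter_comm B A,
    card_sdiff_eq A B (v := v) (by simp [hB])]
  have h : ((-1 : ℤ) ^ aboveDiff A B v) * (-1) ^ aboveDiff A B v = 1 := by
    rw [← mul_pow]; simp
  simp only [pow_add, pow_one]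
  linear_combination (-shuffleSign A B * (-1) ^ below (A ∩ B) v * (-1) ^ belowDiff A B v *
    f (A.erase v) * g B) * h

/-- Sums over pairs `v ∈ C` are sums over pairs `v ∉ C`. -/
theorem sum_mem_eq_sum_notMem_int (F : Fin N → Finset (Fin N) → ℤ) :
    ∑ C : Finset (Fin N), ∑ v ∈ C, F v C =
      ∑ C : Finset (Fin N), ∑ v ∈ Cᶜ, F v (insert v C) := by
  rw [Finset.sum_sigma', Finset.sum_sigma']
  refine Finset.sum_bij' (fun x _ => ⟨x.1.erase x.2, x.2⟩) (fun x _ => ⟨insert x.2 x.1, x.2⟩)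
    ?_ ?_ ?_ ?_ ?_
  · rintro ⟨C, v⟩ h; simp
  · rintro ⟨C, v⟩ h; simp
  · rintro ⟨C, v⟩ h
    have : v ∈ C := by simpa using h
    simp [Finset.insert_erase this]
  · rintro ⟨C, v⟩ h
    have : v ∉ C := by simpa using h
    simp [Finset.erase_insert this]
  · rintro ⟨C, v⟩ h
    have : v ∈ C := by simpa using h
    simp [Finset.insert_erase this]

/-- The signed version of `sum_cut_terms`. -/
theorem signed_sum_cut_terms (f g : Finset (Fin N) → ℤ) :
    ∑ C : Finset (Fin N), ∑ v ∈ C, shuffleSign (leftPart C) (rightPart C) *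
        ((-1) ^ below (leftPart C) v * f ((leftPart C).erase v) * g (rightPart C) +
          (-1) ^ (leftPart C \ rightPart C).card *
            ((-1) ^ below (rightPart C) v * f (leftPart C) * g ((rightPart C).erase v))) =
      ∑ C : Finset (Fin N),
        ((-1) ^ (rightPart C \ leftPart C).card * signedProd f g (rightPart C) (leftPart C) -
          (-1) ^ (leftPart C \ rightPart C).card * signedProd f g (leftPart C) (rightPart C)) := by
  rw [sum_mem_eq_sum_notMem_int (fun v C => shuffleSign (leftPart C) (rightPart C) *
        ((-1) ^ below (leftPart C) v * f ((leftPart C).erase v) * g (rightPart C) +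
          (-1) ^ (leftPart C \ rightPart C).card *
            ((-1) ^ below (rightPart C) v * f (leftPart C) * g ((rightPart C).erase v))))]
  refine Finset.sum_congr rfl fun C _ => ?_
  -- Interpolation between the cut with its parts exchanged (`t = 0`) and the cut itself (`t = N`).
  -- The terms for the vertices outside `C` are its successive differences.
  set Q : ℕ → ℤ := fun t => (-1) ^ (leftTwist t C \ rightTwist t C).card *
    signedProd f g (leftTwist t C) (rightTwist t C) with hQ
  have h1 : ∀ v ∈ Cᶜ, shuffleSign (leftPart (insert v C)) (rightPart (insert v C)) *
        ((-1) ^ below (leftPart (insert v C)) v * f ((leftPart (insert v C)).erase v) *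
            g (rightPart (insert v C)) +
          (-1) ^ (leftPart (insert v C) \ rightPart (insert v C)).card *
            ((-1) ^ below (rightPart (insert v C)) v * f (leftPart (insert v C)) *
              g ((rightPart (insert v C)).erase v))) =
        Q v.1 - Q (v.1 + 1) := by
    intro v hv
    have hv' : v ∉ C := by simpa using hv
    rw [signedProd_erase (mem_leftPart_of_mem (by simp)) (mem_rightPart_of_mem (by simp)),
      leftPart_inter_rightPart, below_insert hv', if_neg (lt_irrefl v), add_zero]
    -- The parity decides which of the two twists at `v` and `v + 1` has lost `v` from its left
    -- part. The sign `(-1) ^ below C v` from `signedProd_erase` makes the difference come out in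
    -- the same order in both cases.
    by_cases h : Even (below C v)
    · obtain ⟨e1, e2, e3, e4⟩ := twist_of_even hv' h
      simp only [hQ, e1, e2, e3, e4, h.neg_one_pow]
      ring
    · obtain ⟨e1, e2, e3, e4⟩ := twist_of_odd hv' h
      simp only [hQ, e1, e2, e3, e4, (Nat.not_even_iff_odd.mp h).neg_one_pow]
      ring
  have h2 : ∑ v ∈ Cᶜ, (Q v.1 - Q (v.1 + 1)) = ∑ v : Fin N, (Q v.1 - Q (v.1 + 1)) := by
    refine Finset.sum_subset (Finset.subset_univ _) fun v _ hv => ?_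
    have hv' : v ∈ C := by simpa using hv
    simp [hQ, twist_of_mem hv']
  rw [Finset.sum_congr rfl h1, h2, Fin.sum_univ_eq_sum_range (fun t => Q t - Q (t + 1)),
    Finset.sum_range_sub']
  simp only [hQ, leftTwist_zero, rightTwist_zero, leftTwist_top, rightTwist_top]

theorem shuffleSign_map (v : Fin (N + 1)) (A B : Finset (Fin N)) :
    shuffleSign (A.map v.succAboveEmb) (B.map v.succAboveEmb) = shuffleSign A B := by
  rw [shuffleSign_eq_prod, shuffleSign_eq_prod]
  simp only [← Finset.map_sdiff, Finset.prod_map]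
  refine Finset.prod_congr rfl fun l _ => Finset.prod_congr rfl fun r _ => ?_
  have : v.succAbove r < v.succAbove l ↔ r < l := Fin.succAbove_lt_succAbove_iff
  simp [this]

theorem sum_face_int (v : Fin (N + 1)) (F : Finset (Fin (N + 1)) → ℤ) :
    ∑ C : Finset (Fin N), F (C.map v.succAboveEmb) =
      ∑ C : Finset (Fin (N + 1)), if v ∉ C then F C else 0 := by
  rw [← Finset.sum_filter]
  refine Finset.sum_bij (fun C _ => C.map v.succAboveEmb) ?_ ?_ ?_ ?_
  · intro C _; simp
  · intro C _ C' _ h; exact Finset.map_injective _ h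
  · intro C hC
    have hv : v ∉ C := by simpa using hC
    refine ⟨Finset.univ.filter fun w => v.succAbove w ∈ C, Finset.mem_univ _, ?_⟩
    ext w
    rcases Fin.eq_self_or_eq_succAbove v w with rfl | ⟨w, rfl⟩
    · simp [hv]
    · simp
  · intro C _; rfl

theorem card_below_univ (v : Fin N) : (Finset.univ.filter (· < v)).card = v.1 := by
  rw [show Finset.univ.filter (· < v) = Finset.Iio v by ext; simp, Fin.card_Iio]

theorem val_eq_below_add {A B : Finset (Fin N)} (h : A ∪ B = Finset.univ) (v : Fin N) :
    v.1 = below A v + belowDiff B A v := by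
  rw [← card_below_univ v, ← h]
  unfold below belowDiff
  rw [← Finset.card_union_of_disjoint, ← Finset.filter_union, Finset.union_sdiff_self_eq_union]
  rw [Finset.disjoint_left]
  intro w hw hw'
  simp only [Finset.mem_filter, Finset.mem_sdiff] at hw hw'
  exact hw'.1.2 hw.1

/-- The boundary of a function on sets of vertices. -/
def faceSum (f : Finset (Fin N) → ℤ) (B : Finset (Fin N)) : ℤ :=
  ∑ v ∈ B, (-1) ^ below B v * f (B.erase v)

/-- The signed version of `sum_faces`. -/
theorem signed_sum_faces (f g : Finset (Fin (N + 1)) → ℤ) :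
    ∑ v : Fin (N + 1), (-1) ^ v.1 * ∑ C : Finset (Fin N), shuffleSign (leftPart C) (rightPart C) *
        (f ((leftPart C).map v.succAboveEmb) * g ((rightPart C).map v.succAboveEmb)) =
      ∑ C : Finset (Fin (N + 1)),
        (shuffleSign (leftPart C) (rightPart C) * (faceSum f (leftPart C) * g (rightPart C) +
          (-1) ^ (leftPart C \ rightPart C).card * (f (leftPart C) * faceSum g (rightPart C))) +
        (-1) ^ (leftPart C \ rightPart C).card * signedProd f g (leftPart C) (rightPart C) -
        (-1) ^ (rightPart C \ leftPart C).card * signedProd f g (rightPart C) (leftPart C)) := by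
  have key := signed_sum_cut_terms f g
  rw [Finset.sum_sub_distrib] at key
  rw [Finset.sum_sub_distrib, Finset.sum_add_distrib]
  have hL : ∀ v : Fin (N + 1), ∑ C : Finset (Fin N), shuffleSign (leftPart C) (rightPart C) *
        (f ((leftPart C).map v.succAboveEmb) * g ((rightPart C).map v.succAboveEmb)) =
      ∑ C : Finset (Fin (N + 1)), if v ∉ C then
        shuffleSign ((leftPart C).erase v) ((rightPart C).erase v) *
          (f ((leftPart C).erase v) * g ((rightPart C).erase v)) else 0 := by
    intro v
    rw [← sum_face_int v fun C => shuffleSign ((leftPart C).erase v) ((rightPart C).erase v) *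
          (f ((leftPart C).erase v) * g ((rightPart C).erase v))]
    refine Finset.sum_congr rfl fun C _ => ?_
    rw [← leftPart_map, ← rightPart_map, shuffleSign_map]
  simp only [hL, Finset.mul_sum]
  rw [Finset.sum_comm]
  -- For a fixed cut, a vertex of exactly one part gives a term on the face opposite to it, where
  -- the other part is unchanged. A vertex of `C` gives the terms that `key` rewrites. Together
  -- these are all terms of the two boundaries.
  have hmain : ∀ C : Finset (Fin (N + 1)),
      ∑ v : Fin (N + 1), (-1) ^ v.1 * (if v ∉ C then
        shuffleSign ((leftPart C).erase v) ((rightPart C).erase v) *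
          (f ((leftPart C).erase v) * g ((rightPart C).erase v)) else 0) +
      ∑ v ∈ C, shuffleSign (leftPart C) (rightPart C) *
        ((-1) ^ below (leftPart C) v * f ((leftPart C).erase v) * g (rightPart C) +
          (-1) ^ (leftPart C \ rightPart C).card *
            ((-1) ^ below (rightPart C) v * f (leftPart C) * g ((rightPart C).erase v))) =
      shuffleSign (leftPart C) (rightPart C) * (faceSum f (leftPart C) * g (rightPart C) +
          (-1) ^ (leftPart C \ rightPart C).card * (f (leftPart C) * faceSum g (rightPart C))) := by
    intro C
    have hU := leftPart_union_rightPart C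
    have hI := leftPart_inter_rightPart C
    have hCL : ∀ v, v ∈ C → v ∈ leftPart C := fun v => mem_leftPart_of_mem
    have hCR : ∀ v, v ∈ C → v ∈ rightPart C := fun v => mem_rightPart_of_mem
    have hor : ∀ v, v ∈ leftPart C ∨ v ∈ rightPart C := fun v => by
      rw [← Finset.mem_union, hU]; exact Finset.mem_univ v
    have hand : ∀ v, v ∈ leftPart C → v ∈ rightPart C → v ∈ C := fun v h1 h2 => by
      rw [← hI]; exact Finset.mem_inter.mpr ⟨h1, h2⟩
    unfold faceSum
    -- From here on it matters only that the parts cover all vertices and meet in `C`.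
    generalize leftPart C = L at *
    generalize rightPart C = R at *
    have e1 : ∀ F : Fin (N + 1) → ℤ, ∑ v ∈ L, F v = ∑ v, if v ∈ L then F v else 0 := fun F => by
      simp
    have e2 : ∀ F : Fin (N + 1) → ℤ, ∑ v ∈ R, F v = ∑ v, if v ∈ R then F v else 0 := fun F => by
      simp
    have e3 : ∀ F : Fin (N + 1) → ℤ, ∑ v ∈ C, F v = ∑ v, if v ∈ C then F v else 0 := fun F => by
      simp
    rw [e1, e2, e3, Finset.sum_mul, Finset.mul_sum, Finset.mul_sum, ← Finset.sum_add_distrib,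
      ← Finset.sum_add_distrib, Finset.mul_sum]
    refine Finset.sum_congr rfl fun v _ => ?_
    by_cases hC : v ∈ C
    · simp only [hC, hCL v hC, hCR v hC, not_true, if_true, if_false]
      ring
    · by_cases hv : v ∈ L
      · have hv' : v ∉ R := fun h => hC (hand v hv h)
        simp only [hC, hv, hv', not_false_eq_true, if_true, if_false]
        rw [shuffleSign_erase_left hv hv', Finset.erase_eq_of_notMem hv']
        rw [val_eq_below_add hU v, pow_add]
        ring
      · have hv' : v ∈ R := (hor v).resolve_left hv
        simp only [hC, hv, hv', not_false_eq_true, if_true, if_false]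
        rw [shuffleSign_erase_right hv hv', Finset.erase_eq_of_notMem hv]
        rw [val_eq_below_add (Finset.union_comm L R ▸ hU) v, pow_add,
          card_sdiff_eq L R (v := v) (by simp [hv]), pow_add]
        have h : ((-1 : ℤ) ^ aboveDiff L R v) * (-1) ^ aboveDiff L R v = 1 := by
          rw [← mul_pow]; simp
        linear_combination (-(-1) ^ below R v * (-1) ^ belowDiff L R v *
          shuffleSign L (R.erase v) * f L * g (R.erase v)) * h
  rw [← Finset.sum_congr rfl fun C _ => hmain C, Finset.sum_add_distrib, key]
  ring

/-- The private vertices of the left part are the complement of the right part. This converts signs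
depending on the cut into signs depending only on degrees. -/
theorem card_leftPart_sdiff {C : Finset (Fin N)} :
    (leftPart C \ rightPart C).card + (rightPart C).card = N := by
  rw [Finset.card_sdiff_add_card, leftPart_union_rightPart, Finset.card_univ, Fintype.card_fin]

theorem card_rightPart_sdiff {C : Finset (Fin N)} :
    (rightPart C \ leftPart C).card + (leftPart C).card = N := by
  rw [Finset.card_sdiff_add_card, Finset.union_comm, leftPart_union_rightPart, Finset.card_univ,
    Fintype.card_fin]

end SignedCuts

/-! ### Integral cup-i products and the relation ρ₂βSq²ᵏ = Sq²ᵏ⁺¹. -/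

section SignedCup

variable {S : SSet.{u}}

/-- The integral version of `evalFace`. -/
def evalFaceInt {p m : ℕ} (a : Cochain S ℤ p) (σ : Simplex S m) (B : Finset (Fin (m + 1))) : ℤ :=
  if h : B.card = p + 1 then
    a (S.map (SimplexCategory.mkHom (B.orderEmbOfFin h).toOrderHom).op σ) else 0

/-- The signed product `a ∪ᵢ b` of integral cochains, `i = p + q - m`. -/
def cupInt {p q : ℕ} (m : ℕ) (a : Cochain S ℤ p) (b : Cochain S ℤ q) : Cochain S ℤ m :=
  fun σ => ∑ C : Finset (Fin (m + 1)),
    signedProd (evalFaceInt a σ) (evalFaceInt b σ) (leftPart C) (rightPart C)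

theorem evalFaceInt_face {p m : ℕ} (a : Cochain S ℤ p) (σ : Simplex S (m + 1))
    (v : Fin (m + 2)) (B : Finset (Fin (m + 1))) :
    evalFaceInt a (S.δ v σ) B = evalFaceInt a σ (B.map v.succAboveEmb) := by
  unfold evalFaceInt
  by_cases h : B.card = p + 1
  · have h' : (B.map v.succAboveEmb).card = p + 1 := by rw [Finset.card_map, h]
    rw [dif_pos h, dif_pos h']
    congr 1
    have e : SimplexCategory.mkHom (B.orderEmbOfFin h).toOrderHom ≫ SimplexCategory.δ v =
        SimplexCategory.mkHom ((B.map v.succAboveEmb).orderEmbOfFin h').toOrderHom := by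
      ext1
      apply OrderHom.ext
      refine Finset.orderEmbOfFin_unique h' (f := fun x => v.succAbove (B.orderEmbOfFin h x))
        (fun x => ?_) ?_
      · simp
      · exact (Fin.strictMono_succAbove v).comp (B.orderEmbOfFin h).strictMono
    rw [← e, op_comp, S.map_comp]
    rfl
  · have h' : ¬ (B.map v.succAboveEmb).card = p + 1 := by rwa [Finset.card_map]
    rw [dif_neg h, dif_neg h']

theorem below_orderEmbOfFin {N k : ℕ} (B : Finset (Fin N)) (h : B.card = k) (i : Fin k) :
    below B (B.orderEmbOfFin h i) = i := by
  unfold below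
  have : B.filter (· < B.orderEmbOfFin h i) =
      (Finset.univ.filter (· < i)).map (B.orderEmbOfFin h).toEmbedding := by
    ext w
    simp only [Finset.mem_filter, Finset.mem_map, Finset.mem_univ, true_and]
    constructor
    · rintro ⟨hw, hlt⟩
      rw [← Finset.mem_coe, ← Finset.range_orderEmbOfFin B h] at hw
      obtain ⟨j, rfl⟩ := hw
      exact ⟨j, (B.orderEmbOfFin h).lt_iff_lt.mp hlt, rfl⟩
    · rintro ⟨j, hj, rfl⟩
      exact ⟨Finset.orderEmbOfFin_mem B h j, (B.orderEmbOfFin h).lt_iff_lt.mpr hj⟩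
  rw [this, Finset.card_map, card_below_univ]

theorem evalFaceInt_coboundary {p m : ℕ} (a : Cochain S ℤ p) (σ : Simplex S m)
    (B : Finset (Fin (m + 1))) :
    evalFaceInt (coboundary S ℤ p a) σ B = faceSum (evalFaceInt a σ) B := by
  unfold faceSum
  by_cases h : B.card = p + 2
  · have hsum : ∑ v ∈ B, (-1) ^ below B v * evalFaceInt a σ (B.erase v) =
        ∑ i : Fin (p + 2), (-1) ^ (i : ℕ) * evalFaceInt a σ (B.erase (B.orderEmbOfFin h i)) := by
      conv_lhs =>
        enter [1]
        rw [← Finset.image_orderEmbOfFin_univ B h]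
      rw [Finset.sum_image (fun x _ y _ e => (B.orderEmbOfFin h).injective e)]
      exact Finset.sum_congr rfl fun i _ => by rw [below_orderEmbOfFin]
    rw [hsum]
    unfold evalFaceInt
    rw [dif_pos h, coboundary_apply]
    refine Finset.sum_congr rfl fun i _ => ?_
    have h' : (B.erase (B.orderEmbOfFin h i)).card = p + 1 := by
      rw [Finset.card_erase_of_mem (Finset.orderEmbOfFin_mem B h i), h]; rfl
    rw [dif_pos h', smul_eq_mul]
    congr 2
    have e : SimplexCategory.δ i ≫ SimplexCategory.mkHom (B.orderEmbOfFin h).toOrderHom =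
        SimplexCategory.mkHom
          ((B.erase (B.orderEmbOfFin h i)).orderEmbOfFin h').toOrderHom := by
      ext1
      apply OrderHom.ext
      refine Finset.orderEmbOfFin_unique h' (f := fun x => B.orderEmbOfFin h (i.succAbove x))
        (fun x => ?_) ?_
      · simp [Finset.orderEmbOfFin_mem, Fin.succAbove_ne]
      · exact (B.orderEmbOfFin h).strictMono.comp (Fin.strictMono_succAbove i)
    rw [← e, op_comp, S.map_comp]
    rfl
  · unfold evalFaceInt
    rw [dif_neg h, Finset.sum_eq_zero]
    intro v hv
    rw [dif_neg, mul_zero]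
    rw [Finset.card_erase_of_mem hv]
    have := Finset.card_pos.mpr ⟨v, hv⟩
    omega

theorem evalFaceInt_eq_zero {p m : ℕ} (a : Cochain S ℤ p) (σ : Simplex S m)
    {B : Finset (Fin (m + 1))} (h : B.card ≠ p + 1) : evalFaceInt a σ B = 0 := dif_neg h

/-- The coboundary formula for the signed cup-`i` products. -/
theorem coboundary_cupInt {p q m : ℕ} (a : Cochain S ℤ p) (b : Cochain S ℤ q) :
    coboundary S ℤ m (cupInt m a b) =
      cupInt (m + 1) (coboundary S ℤ p a) b +
        (-1 : ℤ) ^ (m + q) • cupInt (m + 1) a (coboundary S ℤ q b) +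
        (-1 : ℤ) ^ (m + q + 1) • cupInt (m + 1) a b -
        (-1 : ℤ) ^ ((m + q + 1) * (m + p)) • cupInt (m + 1) b a := by
  ext σ
  have key := signed_sum_faces (evalFaceInt a σ) (evalFaceInt b σ)
  rw [coboundary_apply]
  simp only [cupInt, smul_eq_mul, evalFaceInt_face, signedProd]
  refine key.trans ?_
  simp only [Pi.add_apply, Pi.sub_apply, Pi.smul_apply, cupInt, smul_eq_mul, Finset.mul_sum,
    ← Finset.sum_add_distrib, ← Finset.sum_sub_distrib]
  refine Finset.sum_congr rfl fun C _ => ?_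
  have hL := card_leftPart_sdiff (C := C)
  have hR := card_rightPart_sdiff (C := C)
  have h1 : (-1 : ℤ) ^ (leftPart C \ rightPart C).card *
      (evalFaceInt a σ (leftPart C) * faceSum (evalFaceInt b σ) (rightPart C)) =
      (-1 : ℤ) ^ (m + q) *
      (evalFaceInt a σ (leftPart C) * faceSum (evalFaceInt b σ) (rightPart C)) := by
    rw [← evalFaceInt_coboundary]
    -- Cuts with a part of the wrong size contribute zero. Otherwise there are `m + 2` vertices, `q
    -- + 2` of them in the right part, and the exponent is `m - q`, which is congruent to `m + q`.
    by_cases h : (rightPart C).card = q + 1 + 1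
    · rw [neg_one_pow_congr]
      rw [show m + q = (leftPart C \ rightPart C).card + 2 * q by omega]
      simp [Nat.even_add]
    · rw [evalFaceInt_eq_zero _ _ h]; ring
  have h2 : (-1 : ℤ) ^ (leftPart C \ rightPart C).card *
      signedProd (evalFaceInt a σ) (evalFaceInt b σ) (leftPart C) (rightPart C) =
      (-1 : ℤ) ^ (m + q + 1) *
      signedProd (evalFaceInt a σ) (evalFaceInt b σ) (leftPart C) (rightPart C) := by
    by_cases h : (rightPart C).card = q + 1
    · rw [neg_one_pow_congr]
      rw [show m + q + 1 = (leftPart C \ rightPart C).card + 2 * q by omega]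
      simp [Nat.even_add]
    · unfold signedProd
      rw [evalFaceInt_eq_zero _ _ h]; ring
  have h3 : (-1 : ℤ) ^ (rightPart C \ leftPart C).card *
      signedProd (evalFaceInt a σ) (evalFaceInt b σ) (rightPart C) (leftPart C) =
      (-1 : ℤ) ^ ((m + q + 1) * (m + p)) *
      signedProd (evalFaceInt b σ) (evalFaceInt a σ) (leftPart C) (rightPart C) := by
    unfold signedProd
    by_cases h : (rightPart C).card = p + 1
    · by_cases h' : (leftPart C).card = q + 1
      -- The exponents add up to |R \ L|(1 + |L \ R|), with |R \ L| = m + 1 - q and |L \ R| = m + 1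
      -- - p. Mod 2 this is (m + q + 1)(m + p).
      · rw [shuffleSign_swap (leftPart C) (rightPart C)]
        have : (-1 : ℤ) ^ ((m + q + 1) * (m + p)) = (-1 : ℤ) ^ (rightPart C \ leftPart C).card *
            (-1) ^ ((leftPart C \ rightPart C).card * (rightPart C \ leftPart C).card) := by
          rw [← pow_add]
          apply neg_one_pow_congr
          have e1 : Even (m + q + 1) ↔ Even (rightPart C \ leftPart C).card := by
            rw [show m + q + 1 = (rightPart C \ leftPart C).card + 2 * q by omega]
            simp [Nat.even_add]
          have e2 : Even (m + p + 1) ↔ Even (leftPart C \ rightPart C).card := by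
            rw [show m + p + 1 = (leftPart C \ rightPart C).card + 2 * p by omega]
            simp [Nat.even_add]
          rw [Nat.even_add_one] at e2
          rw [Nat.even_mul, e1, Nat.even_add (m := (rightPart C \ leftPart C).card), Nat.even_mul]
          tauto
        rw [this]; ring
      · rw [evalFaceInt_eq_zero _ _ h']; ring
    · rw [evalFaceInt_eq_zero _ _ h]; ring
  rw [← evalFaceInt_coboundary] at h1
  rw [h3, h2, ← evalFaceInt_coboundary, ← evalFaceInt_coboundary, h1]
  unfold signedProd
  ring

theorem signedProd_cast {p q m : ℕ} (a : Cochain S ℤ p) (b : Cochain S ℤ q) (σ : Simplex S m)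
    (A B : Finset (Fin (m + 1))) :
    ((signedProd (evalFaceInt a σ) (evalFaceInt b σ) A B : ℤ) : ZMod 2) =
      evalFace (coeffCochain (Int.castAddHom (ZMod 2)) a) σ A *
        evalFace (coeffCochain (Int.castAddHom (ZMod 2)) b) σ B := by
  have h1 : ((shuffleSign A B : ℤ) : ZMod 2) = 1 := by
    unfold shuffleSign
    push_cast
    have : (-1 : ZMod 2) = 1 := by decide
    simp [this]
  have h2 : ∀ {r : ℕ} (c : Cochain S ℤ r) (D : Finset (Fin (m + 1))),
      ((evalFaceInt c σ D : ℤ) : ZMod 2) =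
        evalFace (coeffCochain (Int.castAddHom (ZMod 2)) c) σ D := by
    intro r c D
    unfold evalFaceInt evalFace
    split_ifs
    · rfl
    · simp
  unfold signedProd
  push_cast
  rw [h1, h2, h2, one_mul]

/-- Reduction mod 2 of integral cochains. -/
abbrev red {n : ℕ} (a : Cochain S ℤ n) : Cochain S (ZMod 2) n :=
  coeffCochain (Int.castAddHom (ZMod 2)) a

theorem red_cupInt {p q m : ℕ} (a : Cochain S ℤ p) (b : Cochain S ℤ q) :
    red (cupInt m a b) = cupI m (red a) (red b) := by
  ext σ
  simp only [coeffCochain, cupInt, cupI, Int.coe_castAddHom]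
  push_cast
  exact Finset.sum_congr rfl fun C _ => signedProd_cast a b σ _ _

theorem red_liftCochain {n : ℕ} (a : Cochain S (ZMod 2) n) : red (liftCochain a) = a :=
  coeff_liftCochain a

theorem red_add {n : ℕ} (a b : Cochain S ℤ n) : red (a + b) = red a + red b := by
  ext σ; simp [coeffCochain]

theorem red_sub {n : ℕ} (a b : Cochain S ℤ n) : red (a - b) = red a - red b := by
  ext σ; simp [coeffCochain]

theorem red_neg_one_pow_smul {n : ℕ} (j : ℕ) (a : Cochain S ℤ n) :
    red ((-1 : ℤ) ^ j • a) = red a := by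
  ext σ
  rcases neg_one_pow_eq_or ℤ j with h | h
  · simp [h, coeffCochain]
  · simp [h, coeffCochain, CharTwo.neg_eq]

theorem evalFaceInt_smul {p m : ℕ} (r : ℤ) (a : Cochain S ℤ p) (σ : Simplex S m)
    (B : Finset (Fin (m + 1))) : evalFaceInt (r • a) σ B = r * evalFaceInt a σ B := by
  unfold evalFaceInt
  split_ifs <;> simp

theorem cupInt_smul_left {p q m : ℕ} (r : ℤ) (a : Cochain S ℤ p) (b : Cochain S ℤ q) :
    cupInt m (r • a) b = r • cupInt m a b := by
  ext σ
  simp only [cupInt, signedProd, evalFaceInt_smul, Pi.smul_apply, smul_eq_mul, Finset.mul_sum]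
  exact Finset.sum_congr rfl fun C _ => by ring

theorem cupInt_smul_right {p q m : ℕ} (r : ℤ) (a : Cochain S ℤ p) (b : Cochain S ℤ q) :
    cupInt m a (r • b) = r • cupInt m a b := by
  ext σ
  simp only [cupInt, signedProd, evalFaceInt_smul, Pi.smul_apply, smul_eq_mul, Finset.mul_sum]
  exact Finset.sum_congr rfl fun C _ => by ring

/-- The mod 2 Bockstein of a cochain. -/
abbrev sq1 {n : ℕ} (a : Cochain S (ZMod 2) n) : Cochain S (ZMod 2) (n + 1) :=
  red (bocksteinCochain a)

theorem coboundary_bocksteinCochain {n : ℕ} {a : Cochain S (ZMod 2) n}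
    (ha : coboundary S (ZMod 2) n a = 0) : coboundary S ℤ (n + 1) (bocksteinCochain a) = 0 := by
  apply two_smul_cancel
  rw [← map_zsmul, two_smul_bocksteinCochain a ha, coboundary_coboundary, smul_zero]

theorem coboundary_sq1 {n : ℕ} {a : Cochain S (ZMod 2) n}
    (ha : coboundary S (ZMod 2) n a = 0) : coboundary S (ZMod 2) (n + 1) (sq1 a) = 0 := by
  rw [coboundary_coeffCochain, coboundary_bocksteinCochain ha]
  ext; simp [coeffCochain]

/-- If `e` is any integral lift of `c`, then `δ e / 2` represents the mod 2 Bockstein of `c`. -/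
theorem sq1_eq_of_lift {n : ℕ} {c : Cochain S (ZMod 2) n} (hc : coboundary S (ZMod 2) n c = 0)
    {e : Cochain S ℤ n} {d : Cochain S ℤ (n + 1)} (he : red e = c)
    (hd : coboundary S ℤ n e = (2 : ℤ) • d) :
    sq1 c - red d ∈ boundaries S (ZMod 2) (n + 1) := by
  -- Two integral lifts differ by 2f, so their halved coboundaries differ by δf.
  obtain ⟨f, hf⟩ := exists_two_mul (liftCochain c - e) (by
    rw [show coeffCochain (Int.castAddHom (ZMod 2)) (liftCochain c - e) =
      red (liftCochain c) - red e from red_sub _ _, he, red_liftCochain, sub_self])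
  refine ⟨red f, ?_⟩
  rw [coboundary_coeffCochain, ← red_sub]
  congr 1
  apply two_smul_cancel
  rw [smul_sub, two_smul_bocksteinCochain c hc, ← map_zsmul, ← hf, ← hd, map_sub]

/-- The product ã ∪ᵢ ã is an integral lift of a ∪ᵢ a, so half of its coboundary represents the mod 2
Bockstein of Sq²ᵏ[a]. As δã is even and the two ∪ᵢ₋₁ terms add up, this half can be written down
explicitly. -/
theorem sq1_cupI_self {k p : ℕ} {a : Cochain S (ZMod 2) p}
    (ha : coboundary S (ZMod 2) p a = 0) :
    sq1 (cupI (p + 2 * k) a a) - cupI (p + 2 * k + 1) a a ∈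
      boundaries S (ZMod 2) (p + 2 * k + 1) := by
  set m := p + 2 * k with hm
  set b := bocksteinCochain a with hb
  have h2b : coboundary S ℤ p (liftCochain a) = (2 : ℤ) • b :=
    (two_smul_bocksteinCochain a ha).symm
  have hd : coboundary S ℤ m (cupInt m (liftCochain a) (liftCochain a)) =
      (2 : ℤ) • (cupInt (m + 1) b (liftCochain a) +
        (-1 : ℤ) ^ (m + p) • cupInt (m + 1) (liftCochain a) b -
        cupInt (m + 1) (liftCochain a) (liftCochain a)) := by
    rw [coboundary_cupInt, h2b, cupInt_smul_left, cupInt_smul_right]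
    -- Here the evenness of `2 * k` enters: `m + p` is even, so the two terms `ã ∪ᵢ₋₁ ã` of the
    -- coboundary formula both occur with sign -1. For odd `m + p` they would cancel.
    have e1 : (-1 : ℤ) ^ (m + p + 1) = -1 := by
      apply Odd.neg_one_pow
      rw [hm]; exact ⟨p + k, by ring⟩
    have e2 : (-1 : ℤ) ^ ((m + p + 1) * (m + p)) = 1 := by
      apply Even.neg_one_pow
      rw [mul_comm]
      exact Nat.even_mul_succ_self _
    rw [e1, e2]
    module
  have h1 := sq1_eq_of_lift (coboundary_cupI_self (m := m) a ha)
    (by rw [red_cupInt, red_liftCochain]) hd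
  -- Mod 2 the terms Sq¹a ∪ᵢ a + a ∪ᵢ Sq¹a are the coboundary of Sq¹a ∪ᵢ₊₁ a, since both factors are
  -- cocycles. What remains is a ∪ᵢ₋₁ a.
  have h2 : red (cupInt (m + 1) b (liftCochain a) +
        (-1 : ℤ) ^ (m + p) • cupInt (m + 1) (liftCochain a) b -
        cupInt (m + 1) (liftCochain a) (liftCochain a)) =
      coboundary S (ZMod 2) m (cupI m (red b) a) - cupI (m + 1) a a := by
    rw [red_sub, red_add, red_neg_one_pow_smul, red_cupInt, red_cupInt, red_cupInt,
      red_liftCochain, coboundary_cupI, ha,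
      coboundary_sq1 ha, cupI_zero_left, cupI_zero_right, zero_add, zero_add]
  rw [h2] at h1
  have h3 : coboundary S (ZMod 2) m (cupI m (red b) a) ∈ boundaries S (ZMod 2) (m + 1) := ⟨_, rfl⟩
  have h4 := AddSubgroup.add_mem _ h1 h3
  convert h4 using 1
  have : ∀ x : Cochain S (ZMod 2) (m + 1), -x = x := fun x =>
    neg_eq_of_add_eq_zero_left (cochain_add_self x)
  rw [sub_eq_add_neg, this]
  abel

/-- The Adem relation `Sq¹ Sq²ᵏ = Sq²ᵏ⁺¹`, in the form `ρ₂ β Sq²ᵏ = Sq²ᵏ⁺¹`. -/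
theorem rho_bockstein_Sq (k p : ℕ) (x : Cohomology S (ZMod 2) p) :
    rho (bockstein (Sq (2 * k) rfl x)) = Sq (2 * k + 1) rfl x := by
  obtain ⟨⟨a, ha⟩, rfl⟩ := QuotientAddGroup.mk_surjective x
  refine Eq.symm (Cohomology.mk_eq_mk.mpr ?_)
  exact sq1_cupI_self ha

end SignedCup

/-! ### The cup product as the case i = 0; Leibniz rule for Sq¹. -/

section CupZero

variable {S : SSet.{u}}

theorem evalFace_of_strictMono {p m : ℕ} (a : Cochain S (ZMod 2) p) (σ : Simplex S m)
    (ψ : Fin (p + 1) →o Fin (m + 1)) (hψ : StrictMono ψ) {B : Finset (Fin (m + 1))}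
    (hB : ∀ i, ψ i ∈ B) (hc : B.card = p + 1) :
    evalFace a σ B = a (S.map (SimplexCategory.mkHom ψ).op σ) := by
  unfold evalFace
  rw [dif_pos hc]
  have e : (B.orderEmbOfFin hc).toOrderHom = ψ :=
    OrderHom.ext _ _ (Finset.orderEmbOfFin_unique hc hB hψ).symm
  rw [e]

theorem evalFaceInt_of_strictMono {p m : ℕ} (a : Cochain S ℤ p) (σ : Simplex S m)
    (ψ : Fin (p + 1) →o Fin (m + 1)) (hψ : StrictMono ψ) {B : Finset (Fin (m + 1))}
    (hB : ∀ i, ψ i ∈ B) (hc : B.card = p + 1) :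
    evalFaceInt a σ B = a (S.map (SimplexCategory.mkHom ψ).op σ) := by
  unfold evalFaceInt
  rw [dif_pos hc]
  have e : (B.orderEmbOfFin hc).toOrderHom = ψ :=
    OrderHom.ext _ _ (Finset.orderEmbOfFin_unique hc hB hψ).symm
  rw [e]

/-- The inclusion of the first `p + 1` vertices. -/
def frontMap {p m : ℕ} (h : p ≤ m) : Fin (p + 1) →o Fin (m + 1) where
  toFun i := ⟨i.1, by omega⟩
  monotone' _ _ hij := hij

/-- The inclusion of the last `q + 1` vertices. -/
def backMap {p q m : ℕ} (h : m = p + q) : Fin (q + 1) →o Fin (m + 1) where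
  toFun i := ⟨p + i.1, by omega⟩
  monotone' i j hij := by
    have : i.1 ≤ j.1 := hij
    change p + i.1 ≤ p + j.1
    omega

theorem strictMono_frontMap {p m : ℕ} (h : p ≤ m) : StrictMono (frontMap h) := fun _ _ hij => hij

theorem strictMono_backMap {p q m : ℕ} (h : m = p + q) : StrictMono (backMap h) := fun i j hij => by
  have : i.1 < j.1 := hij
  change p + i.1 < p + j.1
  omega

/-- The front face of a simplex. -/
abbrev front {p m : ℕ} (h : p ≤ m) (σ : Simplex S m) : Simplex S p :=
  S.map (SimplexCategory.mkHom (frontMap h)).op σ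

/-- The back face of a simplex. -/
abbrev back {p q m : ℕ} (h : m = p + q) (σ : Simplex S m) : Simplex S q :=
  S.map (SimplexCategory.mkHom (backMap h)).op σ

theorem below_singleton {N : ℕ} (c v : Fin N) : below {c} v = if c < v then 1 else 0 := by
  unfold below
  rw [Finset.filter_singleton]
  split_ifs <;> rfl

theorem leftPart_singleton {N : ℕ} (c : Fin N) : leftPart {c} = Finset.Iic c := by
  ext v
  simp only [leftPart, below_singleton, Finset.mem_filter, Finset.mem_univ, true_and,
    Finset.mem_singleton, Finset.mem_Iic]
  split_ifs with h
  · simp [h.ne', h]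
  · simpa using h

theorem rightPart_singleton {N : ℕ} (c : Fin N) : rightPart {c} = Finset.Ici c := by
  ext v
  simp only [rightPart, below_singleton, Finset.mem_filter, Finset.mem_univ, true_and,
    Finset.mem_singleton, Finset.mem_Ici]
  split_ifs with h
  · simp [h.le]
  · simp only [Even.zero, not_true, or_false]
    exact ⟨fun h => h.ge, fun h' => le_antisymm (not_lt.mp h) h'⟩

theorem card_add_card_parts {N : ℕ} (C : Finset (Fin N)) :
    (leftPart C).card + (rightPart C).card = N + C.card := by
  rw [← Finset.card_union_add_card_inter, leftPart_union_rightPart, leftPart_inter_rightPart,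
    Finset.card_univ, Fintype.card_fin]

theorem eq_singleton_of_card {p q m : ℕ} (h : m = p + q) {C : Finset (Fin (m + 1))}
    (hL : (leftPart C).card = p + 1) (hR : (rightPart C).card = q + 1) :
    C = {⟨p, by omega⟩} := by
  have h1 := card_add_card_parts C
  obtain ⟨c, rfl⟩ := Finset.card_eq_one.mp (show C.card = 1 by omega)
  rw [leftPart_singleton, Fin.card_Iic] at hL
  congr 1
  ext
  simp only
  omega

/-- Parts of sizes p + 1 and q + 1 that cover p + q + 1 vertices overlap in exactly one vertex.
Hence only the cut at the vertex p contributes. -/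
theorem cupI_eq_front_mul_back {p q m : ℕ} (h : m = p + q) (a : Cochain S (ZMod 2) p)
    (b : Cochain S (ZMod 2) q) (σ : Simplex S m) :
    cupI m a b σ = a (front (h ▸ Nat.le_add_right p q) σ) * b (back h σ) := by
  unfold cupI
  rw [Finset.sum_eq_single ({⟨p, by omega⟩} : Finset (Fin (m + 1)))]
  · rw [leftPart_singleton, rightPart_singleton,
      evalFace_of_strictMono a σ _ (strictMono_frontMap (by omega)),
      evalFace_of_strictMono b σ _ (strictMono_backMap h)]
    · exact fun i => Finset.mem_Ici.mpr (Nat.le_add_right p i.1)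
    · rw [Fin.card_Ici]; simp only; omega
    · exact fun i => Finset.mem_Iic.mpr (Nat.lt_succ_iff.mp i.2)
    · rw [Fin.card_Iic]
  · intro C _ hC
    by_cases hL : (leftPart C).card = p + 1
    · by_cases hR : (rightPart C).card = q + 1
      · exact absurd (eq_singleton_of_card h hL hR) hC
      · rw [show evalFace b σ (rightPart C) = 0 from dif_neg hR, mul_zero]
    · rw [show evalFace a σ (leftPart C) = 0 from dif_neg hL, zero_mul]
  · simp

theorem cupInt_eq_front_mul_back {p q m : ℕ} (h : m = p + q) (a : Cochain S ℤ p)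
    (b : Cochain S ℤ q) (σ : Simplex S m) :
    cupInt m a b σ = a (front (h ▸ Nat.le_add_right p q) σ) * b (back h σ) := by
  unfold cupInt signedProd
  rw [Finset.sum_eq_single ({⟨p, by omega⟩} : Finset (Fin (m + 1)))]
  · rw [leftPart_singleton, rightPart_singleton,
      evalFaceInt_of_strictMono a σ _ (strictMono_frontMap (by omega)),
      evalFaceInt_of_strictMono b σ _ (strictMono_backMap h)]
    · have : shuffleSign (Finset.Iic (⟨p, by omega⟩ : Fin (m + 1))) (Finset.Ici ⟨p, by omega⟩) = 1 := by
        rw [shuffleSign_eq_prod]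
        refine Finset.prod_eq_one fun l hl => Finset.prod_eq_one fun r hr => if_neg ?_
        simp only [Finset.mem_sdiff, Finset.mem_Iic, Finset.mem_Ici] at hl hr
        exact not_lt.mpr (hl.1.trans hr.1)
      rw [this, one_mul]
    · exact fun i => Finset.mem_Ici.mpr (Nat.le_add_right p i.1)
    · rw [Fin.card_Ici]; simp only; omega
    · exact fun i => Finset.mem_Iic.mpr (Nat.lt_succ_iff.mp i.2)
    · rw [Fin.card_Iic]
  · intro C _ hC
    by_cases hL : (leftPart C).card = p + 1
    · by_cases hR : (rightPart C).card = q + 1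
      · exact absurd (eq_singleton_of_card h hL hR) hC
      · rw [evalFaceInt_eq_zero b σ hR, mul_zero, mul_zero]
    · rw [evalFaceInt_eq_zero a σ hL, zero_mul, mul_zero]
  · simp

theorem rightPart_empty {N : ℕ} : rightPart (∅ : Finset (Fin N)) = ∅ := by
  ext v; simp [rightPart, below]

/-- For p + q < m the count of vertices leaves only the empty cut, whose right part is empty and has
no face. So cup-i products with i < 0 vanish. -/
theorem card_rightPart_ne {p q m : ℕ} (h : p + q < m) {C : Finset (Fin (m + 1))}
    (hL : (leftPart C).card = p + 1) : (rightPart C).card ≠ q + 1 := by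
  rcases C.eq_empty_or_nonempty with rfl | hC
  · simp [rightPart_empty]
  · have h1 := card_add_card_parts C
    have h2 := hC.card_pos
    omega

theorem cupI_eq_zero {p q m : ℕ} (h : p + q < m) (a : Cochain S (ZMod 2) p)
    (b : Cochain S (ZMod 2) q) : cupI m a b = 0 := by
  ext σ
  refine Finset.sum_eq_zero fun C _ => ?_
  by_cases hL : (leftPart C).card = p + 1
  · rw [show evalFace b σ (rightPart C) = 0 from dif_neg (card_rightPart_ne h hL), mul_zero]
  · rw [show evalFace a σ (leftPart C) = 0 from dif_neg hL, zero_mul]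

theorem cupInt_eq_zero {p q m : ℕ} (h : p + q < m) (a : Cochain S ℤ p)
    (b : Cochain S ℤ q) : cupInt m a b = 0 := by
  ext σ
  refine Finset.sum_eq_zero fun C _ => ?_
  unfold signedProd
  by_cases hL : (leftPart C).card = p + 1
  · rw [evalFaceInt_eq_zero b σ (card_rightPart_ne h hL), mul_zero, mul_zero]
  · rw [evalFaceInt_eq_zero a σ hL, zero_mul, mul_zero]

theorem coboundary_cup {p q m : ℕ} (h : m = p + q) {a : Cochain S (ZMod 2) p}
    {b : Cochain S (ZMod 2) q} (ha : coboundary S (ZMod 2) p a = 0)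
    (hb : coboundary S (ZMod 2) q b = 0) : coboundary S (ZMod 2) m (cupI m a b) = 0 := by
  rw [coboundary_cupI, ha, hb, cupI_zero_left, cupI_zero_right, cupI_eq_zero (by omega),
    cupI_eq_zero (by omega)]
  simp

/-- A product of two numbers in {0, 1} is again in {0, 1}, and in the case i = 0 the sum has one
term, with sign 1. Because of this the Leibniz rule below is an equality of cochains, not merely of
classes. -/
theorem liftCochain_cup {p q m : ℕ} (h : m = p + q) (a : Cochain S (ZMod 2) p)
    (b : Cochain S (ZMod 2) q) :
    liftCochain (cupI m a b) = cupInt m (liftCochain a) (liftCochain b) := by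
  ext σ
  rw [cupInt_eq_front_mul_back h]
  unfold liftCochain
  rw [cupI_eq_front_mul_back h]
  generalize a _ = x
  generalize b _ = y
  revert x y
  decide

theorem sq1_cup {p q m : ℕ} (h : m = p + q) {a : Cochain S (ZMod 2) p}
    {b : Cochain S (ZMod 2) q} (ha : coboundary S (ZMod 2) p a = 0)
    (hb : coboundary S (ZMod 2) q b = 0) :
    sq1 (cupI m a b) = cupI (m + 1) (sq1 a) b + cupI (m + 1) a (sq1 b) := by
  have key : bocksteinCochain (cupI m a b) =
      cupInt (m + 1) (bocksteinCochain a) (liftCochain b) +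
        (-1 : ℤ) ^ (m + q) • cupInt (m + 1) (liftCochain a) (bocksteinCochain b) := by
    apply two_smul_cancel
    rw [two_smul_bocksteinCochain _ (coboundary_cup h ha hb), liftCochain_cup h,
      coboundary_cupInt, ← two_smul_bocksteinCochain a ha, ← two_smul_bocksteinCochain b hb,
      cupInt_smul_left, cupInt_smul_right,
      cupInt_eq_zero (m := m + 1) (by omega) (liftCochain a) (liftCochain b),
      cupInt_eq_zero (m := m + 1) (by omega) (liftCochain b) (liftCochain a)]
    module
  rw [show sq1 (cupI m a b) = red (bocksteinCochain (cupI m a b)) from rfl, key, red_add,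
    red_neg_one_pow_smul, red_cupInt, red_cupInt, red_liftCochain, red_liftCochain]

theorem coboundary_degree_one {A : Type} [AddCommGroup A] (t : Cochain S A 1) (σ : Simplex S 2) :
    coboundary S A 1 t σ = t (S.δ 0 σ) - t (S.δ 1 σ) + t (S.δ 2 σ) := by
  refine (Fin.sum_univ_three (fun i : Fin 3 => (-1 : ℤ) ^ (i : ℕ) • t (S.δ i σ))).trans ?_
  simp [sub_eq_add_neg]

/-- If the edges of a triangle have values x, y, z with y = x + z mod 2, then x - y + z, computed
with representatives in {0, 1}, is 2 for x = z = 1 and 0 otherwise. Its half is xz, the value of t ∪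
t. -/
theorem sq1_of_degree_one {t : Cochain S (ZMod 2) 1} (ht : coboundary S (ZMod 2) 1 t = 0) :
    sq1 t = cupI 2 t t := by
  ext σ
  have h0 := congrFun ht σ
  rw [coboundary_degree_one] at h0
  rw [cupI_eq_front_mul_back (p := 1) (q := 1) rfl]
  have e1 : front (p := 1) (by omega) σ = S.δ 2 σ := by
    have : SimplexCategory.mkHom (frontMap (p := 1) (m := 2) (by omega)) =
        SimplexCategory.δ (2 : Fin 3) := by
      ext i; fin_cases i <;> rfl
    unfold front
    rw [this]
    rfl
  have e2 : back (p := 1) (q := 1) rfl σ = S.δ 0 σ := by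
    have : SimplexCategory.mkHom (backMap (p := 1) (q := 1) (m := 2) rfl) =
        SimplexCategory.δ (0 : Fin 3) := by
      ext i; fin_cases i <;> rfl
    unfold back
    rw [this]
    rfl
  rw [e1, e2]
  simp only [coeffCochain, bocksteinCochain, coboundary_degree_one, liftCochain,
    Int.coe_castAddHom, Pi.zero_apply] at h0 ⊢
  generalize t (S.δ 0 σ) = x at *
  generalize t (S.δ 1 σ) = y at *
  generalize t (S.δ 2 σ) = z at *
  clear * - h0
  revert x y z
  decide

end CupZero

/-! ### Naturality of cup-i products and Sq¹ on cochains. -/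

section Naturality

variable {S T : SSet.{u}} (f : S ⟶ T)

theorem evalFace_pullCochain {p m : ℕ} (a : Cochain T (ZMod 2) p) (σ : Simplex S m)
    (B : Finset (Fin (m + 1))) :
    evalFace (pullCochain f (ZMod 2) p a) σ B = evalFace a (f.app _ σ) B := by
  unfold evalFace
  split_ifs with h
  · exact congrArg a (ConcreteCategory.congr_hom (f.naturality _) σ)
  · rfl

theorem cupI_pullCochain {p q m : ℕ} (a : Cochain T (ZMod 2) p) (b : Cochain T (ZMod 2) q) :
    cupI m (pullCochain f (ZMod 2) p a) (pullCochain f (ZMod 2) q b) =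
      pullCochain f (ZMod 2) m (cupI m a b) := by
  ext σ
  simp only [cupI, evalFace_pullCochain]
  rfl

theorem bocksteinCochain_pullCochain {n : ℕ} (a : Cochain T (ZMod 2) n) :
    bocksteinCochain (pullCochain f (ZMod 2) n a) =
      pullCochain f ℤ (n + 1) (bocksteinCochain a) := by
  ext σ
  exact congrArg (· / 2) (congrFun (coboundary_pullCochain f (liftCochain a)) σ)

theorem sq1_pullCochain {n : ℕ} (a : Cochain T (ZMod 2) n) :
    sq1 (pullCochain f (ZMod 2) n a) = pullCochain f (ZMod 2) (n + 1) (sq1 a) := by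
  rw [show sq1 (pullCochain f (ZMod 2) n a) =
    red (bocksteinCochain (pullCochain f (ZMod 2) n a)) from rfl, bocksteinCochain_pullCochain]
  rfl

end Naturality

/-! ### The nerve of a group and evaluation on a weighted bar chain. -/

section EdgeNerve

variable (G : Type) [AddCommGroup G]

/-- The nerve of the group `G`: the `n`-simplices are the families of elements of `G`, indexed by
the edges of the simplex `[n]`, which are additive on triangles. -/
def edgeNerve : SSet.{0} where
  obj n := {e : Fin (n.unop.len + 1) → Fin (n.unop.len + 1) → G // ∀ i j k, e i j + e j k = e i k}
  map {n m} f := ↾fun e => ⟨fun i j => e.1 (f.unop.toOrderHom i) (f.unop.toOrderHom j),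
    fun _ _ _ => e.2 _ _ _⟩

variable {G}

/-- The simplex with edges `g j - g i`. -/
def ofVertices {m : ℕ} (g : Fin (m + 1) → G) : Simplex (edgeNerve G) m :=
  ⟨fun i j => g j - g i, fun i j k => by rw [add_comm]; exact sub_add_sub_cancel _ _ _⟩

/-- The 1-cocycle given by a homomorphism `G → ℤ/2`. -/
def stepCochain (φ : G →+ ZMod 2) : Cochain (edgeNerve G) (ZMod 2) 1 :=
  fun e => φ (e.1 (0 : Fin 2) (1 : Fin 2))

theorem coboundary_stepCochain (φ : G →+ ZMod 2) :
    coboundary (edgeNerve G) (ZMod 2) 1 (stepCochain φ) = 0 := by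
  ext e
  rw [coboundary_degree_one]
  change φ (e.1 (1 : Fin 3) (2 : Fin 3)) - φ (e.1 (0 : Fin 3) (2 : Fin 3)) +
    φ (e.1 (0 : Fin 3) (1 : Fin 3)) = 0
  rw [← e.2 (0 : Fin 3) (1 : Fin 3) (2 : Fin 3), map_add]
  abel

theorem partialSum_append_front {p q : ℕ} (a : Fin p → G) (b : Fin q → G) (i : Fin (p + 1)) :
    Fin.partialSum (Fin.append a b) (frontMap (Nat.le_add_right p q) i) = Fin.partialSum a i := by
  induction i using Fin.induction with
  | zero => exact (Fin.partialSum_zero _).trans (Fin.partialSum_zero _).symm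
  | succ i ih =>
    rw [Fin.partialSum_succ, ← ih, ← Fin.append_left a b i]
    exact Fin.partialSum_succ (Fin.append a b) (Fin.castAdd q i)

theorem partialSum_append_back {p q : ℕ} (a : Fin p → G) (b : Fin q → G) (i : Fin (q + 1)) :
    Fin.partialSum (Fin.append a b) (backMap rfl i) =
      Fin.partialSum a (Fin.last p) + Fin.partialSum b i := by
  induction i using Fin.induction with
  | zero =>
    rw [Fin.partialSum_zero, add_zero, ← partialSum_append_front a b]
    rfl
  | succ i ih =>
    rw [Fin.partialSum_succ, ← add_assoc, ← ih, ← Fin.append_right a b i]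
    exact Fin.partialSum_succ (Fin.append a b) (Fin.natAdd p i)

variable [Fintype G] {R : Type} [CommRing R] [Algebra (ZMod 2) R] (χ : G →+ R)

/-- The evaluation of a cochain on the chain `∑ χ(h₁) ⋯ χ(hₘ) [h₁ | ⋯ | hₘ]`. -/
def evalSteps {m : ℕ} (F : Cochain (edgeNerve G) (ZMod 2) m) : R :=
  ∑ h : Fin m → G, algebraMap (ZMod 2) R (F (ofVertices (Fin.partialSum h))) * ∏ i, χ (h i)

theorem evalSteps_add {m : ℕ} (F F' : Cochain (edgeNerve G) (ZMod 2) m) :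
    evalSteps χ (F + F') = evalSteps χ F + evalSteps χ F' := by
  simp [evalSteps, add_mul, Finset.sum_add_distrib]

/-- The front and back faces of [h₁ | ⋯ | hₘ] are the bar simplices on the first p and the last q
steps, and the weight ∏ χ(hᵢ) factors in the same way. The sum over all step sequences is therefore
a product of two sums. -/
theorem evalSteps_cup {p q m : ℕ} (hm : m = p + q) (a : Cochain (edgeNerve G) (ZMod 2) p)
    (b : Cochain (edgeNerve G) (ZMod 2) q) :
    evalSteps χ (cupI m a b) = evalSteps χ a * evalSteps χ b := by
  subst hm
  unfold evalSteps
  rw [Finset.sum_mul_sum, ← Finset.sum_product', Finset.univ_product_univ,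
    ← (Fin.appendEquiv p q).sum_comp]
  refine Finset.sum_congr rfl fun ⟨h1, h2⟩ _ => ?_
  have e0 : Fin.appendEquiv p q (h1, h2) = Fin.append h1 h2 := rfl
  rw [e0, cupI_eq_front_mul_back rfl, map_mul, Fin.prod_univ_add]
  have e1 : front (Nat.le_add_right p q) (ofVertices (Fin.partialSum (Fin.append h1 h2))) =
      ofVertices (Fin.partialSum h1) := by
    refine Subtype.ext (funext fun i => funext fun j => ?_)
    change Fin.partialSum (Fin.append h1 h2) (frontMap (Nat.le_add_right p q) j) -
      Fin.partialSum (Fin.append h1 h2) (frontMap (Nat.le_add_right p q) i) = _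
    rw [partialSum_append_front, partialSum_append_front]
    rfl
  have e2 : back rfl (ofVertices (Fin.partialSum (Fin.append h1 h2))) =
      ofVertices (Fin.partialSum h2) := by
    refine Subtype.ext (funext fun i => funext fun j => ?_)
    change Fin.partialSum (Fin.append h1 h2) (backMap rfl j) -
      Fin.partialSum (Fin.append h1 h2) (backMap rfl i) = _
    rw [partialSum_append_back, partialSum_append_back, add_sub_add_left_eq_sub]
    rfl
  rw [e1, e2]
  simp only [Fin.append_left, Fin.append_right]
  ring

theorem evalSteps_stepCochain (φ : G →+ ZMod 2) :
    evalSteps χ (stepCochain φ) = ∑ g, algebraMap (ZMod 2) R (φ g) * χ g := by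
  unfold evalSteps
  rw [← (Equiv.funUnique (Fin 1) G).symm.sum_comp]
  refine Finset.sum_congr rfl fun g _ => ?_
  have e : stepCochain φ (ofVertices (Fin.partialSum ((Equiv.funUnique (Fin 1) G).symm g))) =
      φ g := by
    change φ (Fin.partialSum ((Equiv.funUnique (Fin 1) G).symm g) (Fin.succ 0) -
      Fin.partialSum ((Equiv.funUnique (Fin 1) G).symm g) 0) = φ g
    rw [Fin.partialSum_succ, Fin.castSucc_zero, Fin.partialSum_zero]
    simp
  rw [e]
  simp

end EdgeNerve

/-! ### Weighted sums over labelled simplices are cycles. -/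

section Cycle

variable {G : Type} [AddCommGroup G] [Fintype G] {R : Type} [CommRing R]

/-- By invariance it is immaterial at which vertex a labelling is normalized to zero. -/
theorem sum_translate_invariant [DecidableEq G] {m : ℕ} (Φ : (Fin m → G) → R)
    (hΦ : ∀ g c, Φ (fun i => g i + c) = Φ g) (j l : Fin m) :
    ∑ g with g j = 0, Φ g = ∑ g with g l = 0, Φ g := by
  refine Finset.sum_bij' (fun g _ i => g i + -g l) (fun g _ i => g i + -g j) ?_ ?_ ?_ ?_ ?_
  · intro g hg; simp
  · intro g hg; simp
  · intro g hg
    have : g j = 0 := by simpa using hg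
    ext i; simp [this]
  · intro g hg
    have : g l = 0 := by simpa using hg
    ext i; simp [this]
  · intro g hg
    rw [hΦ]

theorem sum_partialSum [DecidableEq G] {m : ℕ} (Φ : (Fin (m + 1) → G) → R) :
    ∑ h : Fin m → G, Φ (Fin.partialSum h) = ∑ g with g 0 = 0, Φ g := by
  refine Finset.sum_bij' (fun h _ => Fin.partialSum h) (fun g _ i => -g i.castSucc + g i.succ)
    ?_ ?_ ?_ ?_ ?_
  · intro h _; simp [Fin.partialSum_zero]
  · intro g _; simp
  · intro h _
    ext i
    exact Fin.partialSum_right_neg h i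
  · intro g hg
    have : g 0 = 0 := by simpa using hg
    have h := Fin.partialSum_left_neg g
    rw [this, zero_vadd] at h
    exact h
  · intro h _; rfl

theorem sum_eq_zero_of_sum_update {m : ℕ} (Φ : (Fin m → G) → R) (i : Fin m)
    (h : ∀ g, ∑ x, Φ (Function.update g i x) = 0) : ∑ g, Φ g = 0 := by
  rw [← (Equiv.funSplitAt i G).symm.sum_comp, Fintype.sum_prod_type, Finset.sum_comm]
  refine Finset.sum_eq_zero fun g' _ => ?_
  rw [← h ((Equiv.funSplitAt i G).symm (0, g'))]
  refine Finset.sum_congr rfl fun x _ => congrArg Φ ?_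
  ext l
  by_cases hl : l = i
  · subst hl; simp
  · simp [hl]

theorem exists_affine_prod_succ {m : ℕ} (c : Fin m → R) (i : Fin (m + 1)) :
    ∃ A B : R, ∀ y, (∏ l : Fin m, if l.succ = i then y - c l else 1) = A * y + B := by
  induction i using Fin.cases with
  | zero =>
    exact ⟨0, 1, fun y => by
      rw [zero_mul, zero_add]
      exact Finset.prod_eq_one fun l _ => if_neg (Fin.succ_ne_zero l)⟩
  | succ j => exact ⟨1, -c j, fun y => by simp [Fin.succ_inj, sub_eq_add_neg]⟩

theorem exists_affine_prod_castSucc {m : ℕ} (c : Fin m → R) (i : Fin (m + 1)) :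
    ∃ A B : R, ∀ y, (∏ l : Fin m, if l.castSucc = i then c l - y else 1) = A * y + B := by
  induction i using Fin.lastCases with
  | last =>
    exact ⟨0, 1, fun y => by
      rw [zero_mul, zero_add]
      exact Finset.prod_eq_one fun l _ => if_neg (Fin.castSucc_lt_last l).ne⟩
  | cast j => exact ⟨-1, c j, fun y => by simp [Fin.castSucc_inj]; ring⟩

/-- A vertex lies on at most two of the consecutive edges l → l + 1. As a function of its label, the
product is affine in χ(x) through each of them. -/
theorem exists_quadratic_prod_update {H : Type} [AddCommGroup H] {m : ℕ} (χ : H →+ R)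
    (g : Fin (m + 1) → H) (i : Fin (m + 1)) :
    ∃ A B C : R, ∀ x, ∏ l : Fin m, χ (Function.update g i x l.succ -
      Function.update g i x l.castSucc) = A * (χ x * χ x) + B * χ x + C := by
  obtain ⟨A, B, h1⟩ := exists_affine_prod_succ (fun l : Fin m => χ (g l.castSucc)) i
  obtain ⟨A', B', h2⟩ := exists_affine_prod_castSucc (fun l : Fin m => χ (g l.succ)) i
  set K := ∏ l : Fin m, if l.succ = i ∨ l.castSucc = i then 1 else
    χ (g l.succ) - χ (g l.castSucc) with hK
  refine ⟨K * A * A', K * (A * B' + B * A'), K * B * B', fun x => ?_⟩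
  have h3 : ∏ l : Fin m, χ (Function.update g i x l.succ - Function.update g i x l.castSucc) =
      K * (∏ l : Fin m, if l.succ = i then χ x - χ (g l.castSucc) else 1) *
        (∏ l : Fin m, if l.castSucc = i then χ (g l.succ) - χ x else 1) := by
    rw [hK, ← Finset.prod_mul_distrib, ← Finset.prod_mul_distrib]
    refine Finset.prod_congr rfl fun l _ => ?_
    have hne : l.castSucc ≠ l.succ := (Fin.castSucc_lt_succ (i := l)).ne
    by_cases hs : l.succ = i
    · subst hs
      simp [hne]
    · by_cases hc : l.castSucc = i
      · subst hc
        simp [hne.symm]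
      · simp [hs, hc]
  rw [h3, h1, h2]
  ring

variable [Algebra (ZMod 2) R]

/-- A family of simplices indexed by the labellings of their vertices in `G`, such that each face
depends only on the labels of its vertices, and all of them only up to translation, defines a
cycle with coefficients `∏ χ(gₗ₊₁ - gₗ)`. -/
theorem sum_coboundary_eq_zero {S : SSet.{u}} {M : ℕ} (χ : G →+ R)
    (h0 : (Fintype.card G : R) = 0) (h1 : ∑ x, χ x = 0) (h2 : ∑ x, χ x * χ x = 0)
    (κ : (Fin (M + 2) → G) → Simplex S (M + 1))
    (hκ : ∀ g c, κ (fun i => g i + c) = κ g)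
    (hface : ∀ i g x, S.δ i (κ (Function.update g i x)) = S.δ i (κ g))
    (b : Cochain S (ZMod 2) M) :
    ∑ h : Fin (M + 1) → G, algebraMap (ZMod 2) R (coboundary S (ZMod 2) M b
      (κ (Fin.partialSum h))) * ∏ i, χ (h i) = 0 := by
  classical
  let Ψ : Fin (M + 2) → (Fin (M + 2) → G) → R := fun i g =>
    algebraMap (ZMod 2) R (b (S.δ i (κ g))) * ∏ l : Fin (M + 1), χ (g l.succ - g l.castSucc)
  have hs : ∀ (i : ℕ) (x : ZMod 2), (-1 : ℤ) ^ i • x = x := by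
    intro i x
    rcases neg_one_pow_eq_or ℤ i with e | e <;> rw [e] <;> revert x <;> decide
  have hsum : ∀ h : Fin (M + 1) → G, algebraMap (ZMod 2) R (coboundary S (ZMod 2) M b
      (κ (Fin.partialSum h))) * ∏ i, χ (h i) = ∑ i, Ψ i (Fin.partialSum h) := by
    intro h
    have : ∀ l : Fin (M + 1), Fin.partialSum h l.succ - Fin.partialSum h l.castSucc = h l :=
      fun l => by rw [Fin.partialSum_succ, add_sub_cancel_left]
    simp only [Ψ, this, coboundary_apply, hs, map_sum, Finset.sum_mul]
  rw [Finset.sum_congr rfl fun h _ => hsum h, Finset.sum_comm]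
  refine Finset.sum_eq_zero fun i _ => ?_
  -- The labellings are normalized at a vertex other than `i`, so that the label of `i` ranges over
  -- all of `G`. The `i`-th face does not depend on it.
  obtain ⟨j, hj⟩ := exists_ne i
  rw [sum_partialSum, sum_translate_invariant (Ψ i) (fun g c => by
    simp only [Ψ, hκ, add_sub_add_right_eq_sub]) 0 j, Finset.sum_filter]
  refine sum_eq_zero_of_sum_update _ i fun g => ?_
  simp only [Function.update_of_ne hj, Ψ, hface]
  split_ifs
  -- The sum over the free label is a combination of ∑ χ², ∑ χ and ∑ 1, which vanish by hypothesis.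
  · obtain ⟨A, B, C, h⟩ := exists_quadratic_prod_update χ g i
    simp only [h]
    rw [← Finset.mul_sum, Finset.sum_add_distrib, Finset.sum_add_distrib, ← Finset.mul_sum,
      ← Finset.mul_sum, h1, h2, Finset.sum_const, Finset.card_univ, nsmul_eq_mul, h0]
    ring
  · simp

end Cycle

/-! ### The class t₁ⁿt₂ and its Sq¹ on the nerve of (ℤ/2)². -/

section PowerClass

open Polynomial

/-- The cocycle `t₁ ∪ (t₁ ∪ ⋯ (t₁ ∪ t₂))` of degree `n + 1` on the nerve of `ℤ/2 × ℤ/2`. -/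
def powerCochain : ∀ n : ℕ, Cochain (edgeNerve (ZMod 2 × ZMod 2)) (ZMod 2) (n + 1)
  | 0 => stepCochain (AddMonoidHom.snd _ _)
  | n + 1 => cupI (n + 2) (stepCochain (AddMonoidHom.fst _ _)) (powerCochain n)

theorem coboundary_powerCochain (n : ℕ) :
    coboundary (edgeNerve (ZMod 2 × ZMod 2)) (ZMod 2) (n + 1) (powerCochain n) = 0 := by
  induction n with
  | zero => exact coboundary_stepCochain _
  | succ n ih => exact coboundary_cup (by omega) (coboundary_stepCochain _) ih

/-- The homomorphism `(u, v) ↦ u + v X`. -/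
def linearForm : ZMod 2 × ZMod 2 →+ (ZMod 2)[X] where
  toFun g := C g.1 + C g.2 * X
  map_zero' := by simp
  map_add' g g' := by simp; ring

theorem sum_zmod_two_prod {R : Type} [AddCommMonoid R] (f : ZMod 2 × ZMod 2 → R) :
    ∑ g, f g = f (0, 0) + f (0, 1) + (f (1, 0) + f (1, 1)) := by
  rw [Fintype.sum_prod_type]
  simp only [show (Finset.univ : Finset (ZMod 2)) = {0, 1} from rfl]
  rw [Finset.sum_pair (by decide), Finset.sum_pair (by decide), Finset.sum_pair (by decide)]

theorem two_eq_zero_poly : (2 : (ZMod 2)[X]) = 0 :=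
  CharTwo.two_eq_zero

/-- Rank two is essential: over ℤ/2 alone the sum of a homomorphism is its value at 1. Over (ℤ/2)²
each of ∑ 1, ∑ χ, ∑ χ² is even. -/
theorem sum_linearForm : ∑ x, linearForm x = 0 := by
  rw [sum_zmod_two_prod]
  simp only [linearForm, AddMonoidHom.coe_mk, ZeroHom.coe_mk, C_0, C_1]
  linear_combination (1 + X) * two_eq_zero_poly

theorem sum_linearForm_sq : ∑ x, linearForm x * linearForm x = 0 := by
  rw [sum_zmod_two_prod]
  simp only [linearForm, AddMonoidHom.coe_mk, ZeroHom.coe_mk, C_0, C_1]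
  linear_combination (1 + X + X ^ 2) * two_eq_zero_poly

theorem evalSteps_fst :
    evalSteps linearForm (stepCochain (AddMonoidHom.fst (ZMod 2) (ZMod 2))) = X := by
  rw [evalSteps_stepCochain, sum_zmod_two_prod]
  simp only [linearForm, AddMonoidHom.coe_mk, ZeroHom.coe_mk, AddMonoidHom.coe_fst, map_zero,
    map_one]
  linear_combination two_eq_zero_poly

theorem evalSteps_snd :
    evalSteps linearForm (stepCochain (AddMonoidHom.snd (ZMod 2) (ZMod 2))) = 1 := by
  rw [evalSteps_stepCochain, sum_zmod_two_prod]
  simp only [linearForm, AddMonoidHom.coe_mk, ZeroHom.coe_mk, AddMonoidHom.coe_snd, map_zero,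
    map_one]
  linear_combination X * two_eq_zero_poly

theorem evalSteps_powerCochain (n : ℕ) : evalSteps linearForm (powerCochain n) = X ^ n := by
  induction n with
  | zero => rw [pow_zero]; exact evalSteps_snd
  | succ n ih =>
    rw [powerCochain, evalSteps_cup linearForm (by omega), ih, evalSteps_fst, pow_succ']

/-- By the Leibniz rule and Sq¹t = t², Sq¹(t₁ⁿt₂) is n t₁ⁿ⁺¹t₂ + t₁ⁿt₂². The value follows from t₁ ↦
X, t₂ ↦ 1. -/
theorem evalSteps_sq1_powerCochain (n : ℕ) :
    evalSteps linearForm (sq1 (powerCochain n)) = X ^ n * ((n : (ZMod 2)[X]) * X + 1) := by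
  induction n with
  | zero =>
    rw [powerCochain, sq1_of_degree_one (coboundary_stepCochain _),
      evalSteps_cup linearForm (by omega), evalSteps_snd]
    simp
  | succ n ih =>
    rw [powerCochain, sq1_cup (by omega) (coboundary_stepCochain _) (coboundary_powerCochain n),
      evalSteps_add, evalSteps_cup linearForm (by omega), evalSteps_cup linearForm (by omega), ih,
      sq1_of_degree_one (coboundary_stepCochain _), evalSteps_cup linearForm (by omega),
      evalSteps_powerCochain, evalSteps_fst]
    push_cast
    ring

theorem evalSteps_sq1_powerCochain_ne_zero {n : ℕ} (hn : Odd n) :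
    evalSteps linearForm (sq1 (powerCochain n)) ≠ 0 := by
  rw [evalSteps_sq1_powerCochain]
  have h : (n : (ZMod 2)[X]) = 1 := by
    obtain ⟨m, rfl⟩ := hn
    push_cast
    rw [two_eq_zero_poly, zero_mul, zero_add]
  rw [h, one_mul]
  exact mul_ne_zero (pow_ne_zero _ X_ne_zero) (X_add_C_ne_zero 1)

end PowerClass

/-! ### Suspension of cochains; compatibility with δ, Sq¹ and cup-i products. -/

section Suspension

/-- The product of a simplicial set with the interval. -/
def cyl (S : SSet.{0}) : SSet.{0} where
  obj n := S.obj n × (Fin (n.unop.len + 1) →o Fin 2)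
  map {n m} f := ↾fun x => (S.map f x.1, x.2.comp f.unop.toOrderHom)
  map_id n := by ext x <;> simp
  map_comp f g := by ext x <;> simp

variable {S : SSet.{0}}

/-- The monotone map is `0, …, 0, 1`. -/
def IsTop {p : ℕ} (φ : Fin (p + 2) →o Fin 2) : Prop :=
  φ (Fin.last (p + 1)) = 1 ∧ φ (Fin.last p).castSucc = 0

instance {p : ℕ} (φ : Fin (p + 2) →o Fin 2) : Decidable (IsTop φ) :=
  inferInstanceAs (Decidable (_ ∧ _))

/-- The suspension of a cochain: its product with the fundamental cochain of the interval. -/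
def susp {A : Type} [AddCommGroup A] {p : ℕ} (a : Cochain S A p) : Cochain (cyl S) A (p + 1) :=
  fun x => if IsTop (p := p) x.2 then a (S.δ (Fin.last (p + 1)) x.1) else 0

theorem coboundary_susp {A : Type} [AddCommGroup A] {p : ℕ} (a : Cochain S A p) :
    coboundary (cyl S) A (p + 1) (susp a) = susp (coboundary S A p a) := by
  ext x
  obtain ⟨φ, hφ⟩ : ∃ φ : Fin (p + 3) →o Fin 2, φ = x.2 := ⟨x.2, rfl⟩
  obtain ⟨τ, hτ⟩ : ∃ τ : Simplex S (p + 2), τ = x.1 := ⟨x.1, rfl⟩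
  have hface : ∀ i : Fin (p + 3), susp a ((cyl S).δ i x) =
      if φ (i.succAbove (Fin.last (p + 1))) = 1 ∧ φ (i.succAbove (Fin.last p).castSucc) = 0 then
        a (S.δ (Fin.last (p + 1)) (S.δ i τ)) else 0 := fun i => by rw [hφ, hτ]; rfl
  rw [coboundary_apply]
  simp only [hface]
  have e1 : ∀ i : Fin (p + 2), S.δ (Fin.last (p + 1)) (S.δ i.castSucc τ) =
      S.δ i (S.δ (Fin.last (p + 2)) τ) := fun i => by
    have := S.δ_comp_δ (Fin.le_last i)
    exact (ConcreteCategory.congr_hom this τ).symm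
  have h1 : (Fin.last (p + 2)).succAbove (Fin.last (p + 1)) = (Fin.last (p + 1)).castSucc := by
    simp
  have h2 : (Fin.last (p + 2)).succAbove (Fin.last p).castSucc =
      (Fin.last p).castSucc.castSucc := by simp
  have h3 : (Fin.last (p + 1)).castSucc.succAbove (Fin.last (p + 1)) = Fin.last (p + 2) := by
    simp
  have h4 : (Fin.last (p + 1)).castSucc.succAbove (Fin.last p).castSucc =
      (Fin.last p).castSucc.castSucc := by
    rw [Fin.succAbove_of_castSucc_lt]
    simp [Fin.lt_def]
  have h5 : ∀ i : Fin (p + 1), i.castSucc.castSucc.succAbove (Fin.last (p + 1)) =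
      Fin.last (p + 2) := fun i => by
    rw [Fin.succAbove_of_le_castSucc]
    · rfl
    · simp only [Fin.le_def, Fin.val_castSucc, Fin.val_last]; omega
  have h6 : ∀ i : Fin (p + 1), i.castSucc.castSucc.succAbove (Fin.last p).castSucc =
      (Fin.last (p + 1)).castSucc := fun i => by
    rw [Fin.succAbove_of_le_castSucc]
    · rfl
    · simp only [Fin.le_def, Fin.val_castSucc, Fin.val_last]; omega
  have hR : susp (coboundary S A p a) x =
      if φ (Fin.last (p + 2)) = 1 ∧ φ (Fin.last (p + 1)).castSucc = 0 then
        ∑ i : Fin (p + 2), (-1 : ℤ) ^ (i : ℕ) • a (S.δ (Fin.last (p + 1)) (S.δ i.castSucc τ))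
      else 0 := by
    simp only [e1]; rw [hφ, hτ]; rfl
  rw [hR, Fin.sum_univ_castSucc, Fin.sum_univ_castSucc, Fin.sum_univ_castSucc (n := p + 1)]
  simp only [h1, h2, h3, h4, h5, h6, Fin.val_castSucc, Fin.val_last]
  have hlast : S.δ (Fin.last (p + 1)) (S.δ (Fin.last (p + 1)).castSucc τ) =
      S.δ (Fin.last (p + 1)) (S.δ (Fin.last (p + 2)) τ) := e1 _
  rw [← hlast]
  have m1 : φ (Fin.last p).castSucc.castSucc ≤ φ (Fin.last (p + 1)).castSucc :=
    φ.monotone (by simp [Fin.le_def])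
  have m2 : φ (Fin.last (p + 1)).castSucc ≤ φ (Fin.last (p + 2)) :=
    φ.monotone (by simp [Fin.le_def])
  revert m1 m2
  generalize φ (Fin.last p).castSucc.castSucc = x
  generalize φ (Fin.last (p + 1)).castSucc = y
  generalize φ (Fin.last (p + 2)) = z
  intro m1 m2
  -- Here x, y, z are the heights of the last three vertices. If y = 1, only the faces omitting one
  -- of the last two vertices can contribute, and they cancel. If y = 0, the face omitting the last
  -- vertex contributes nothing and the others give the right-hand side.
  have hc : y = 0 ∧ x = 0 ∨ y = 1 ∧ z = 1 := by revert x y z; decide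
  rcases hc with ⟨rfl, rfl⟩ | ⟨rfl, rfl⟩
  · by_cases hz : z = 1 <;> simp [hz]
  · by_cases hx : x = 0 <;> simp [hx, pow_succ]

theorem liftCochain_susp {p : ℕ} (a : Cochain S (ZMod 2) p) :
    liftCochain (susp a) = susp (liftCochain a) := by
  ext x
  unfold liftCochain susp
  split_ifs <;> rfl

theorem sq1_susp {p : ℕ} (a : Cochain S (ZMod 2) p) : sq1 (susp a) = susp (sq1 a) := by
  ext x
  have h : bocksteinCochain (susp a) x = coboundary (cyl S) ℤ (p + 1) (susp (liftCochain a)) x / 2 := by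
    rw [← liftCochain_susp]; rfl
  have h' : sq1 (susp a) x = ((bocksteinCochain (susp a) x : ℤ) : ZMod 2) := rfl
  rw [h', h, coboundary_susp]
  unfold susp
  split_ifs
  · rfl
  · simp

theorem filter_eq_singleton_of_isTop {N p : ℕ} (φ : Fin N →o Fin 2) {B : Finset (Fin N)}
    (h : B.card = p + 2) (hφ : IsTop (φ.comp (B.orderEmbOfFin h).toOrderHom)) :
    (B.filter fun v => φ v = 1).card = 1 := by
  rw [Finset.card_eq_one]
  refine ⟨B.orderEmbOfFin h (Fin.last (p + 1)), ?_⟩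
  ext w
  simp only [Finset.mem_filter, Finset.mem_singleton]
  constructor
  · rintro ⟨hw, hw1⟩
    rw [← Finset.mem_coe, ← Finset.range_orderEmbOfFin B h] at hw
    obtain ⟨j, rfl⟩ := hw
    induction j using Fin.lastCases with
    | last => rfl
    | cast j =>
      have h1 : φ (B.orderEmbOfFin h j.castSucc) ≤ φ (B.orderEmbOfFin h (Fin.last p).castSucc) :=
        φ.monotone ((B.orderEmbOfFin h).monotone
          (Fin.castSucc_le_castSucc_iff.mpr (Fin.le_last j)))
      have h2 : φ (B.orderEmbOfFin h (Fin.last p).castSucc) = 0 := hφ.2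
      rw [hw1, h2] at h1
      exact absurd h1 (by decide)
  · rintro rfl
    exact ⟨Finset.orderEmbOfFin_mem B h _, hφ.1⟩

theorem card_filter_of_evalFace_susp_ne_zero {p m : ℕ} (a : Cochain S (ZMod 2) p)
    (x : Simplex (cyl S) m) {B : Finset (Fin (m + 1))} (h : evalFace (susp a) x B ≠ 0) :
    (B.filter fun v => x.2 v = 1).card = 1 := by
  unfold evalFace at h
  split_ifs at h with hB
  · refine filter_eq_singleton_of_isTop x.2 hB ?_
    by_contra hT
    exact h (if_neg hT)
  · exact absurd rfl h

theorem orderEmbOfFin_erase_last {N p : ℕ} {B : Finset (Fin (N + 1))} (hB : Fin.last N ∈ B)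
    (h : B.card = p + 2) (h' : (B.erase (Fin.last N)).card = p + 1) (i : Fin (p + 1)) :
    B.orderEmbOfFin h i.castSucc = (B.erase (Fin.last N)).orderEmbOfFin h' i := by
  have hlast : B.orderEmbOfFin h (Fin.last (p + 1)) = Fin.last N := by
    rw [← Finset.mem_coe, ← Finset.range_orderEmbOfFin B h] at hB
    obtain ⟨j, hj⟩ := hB
    refine le_antisymm (Fin.le_last _) ?_
    rw [← hj]
    exact (B.orderEmbOfFin h).monotone (Fin.le_last j)
  refine congrFun (Finset.orderEmbOfFin_unique h' (f := fun i => B.orderEmbOfFin h i.castSucc)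
    (fun i => ?_) ?_) i
  · rw [Finset.mem_erase]
    refine ⟨?_, Finset.orderEmbOfFin_mem B h _⟩
    rw [← hlast]
    exact fun e => (Fin.castSucc_lt_last i).ne ((B.orderEmbOfFin h).injective e)
  · exact (B.orderEmbOfFin h).strictMono.comp Fin.strictMono_castSucc

theorem evalFace_susp {p m : ℕ} (a : Cochain S (ZMod 2) p) (x : Simplex (cyl S) (m + 1))
    (hx : IsTop (p := m) x.2) {B : Finset (Fin (m + 2))} (hB : Fin.last (m + 1) ∈ B) :
    evalFace (susp a) x B = evalFace a x.1 (B.erase (Fin.last (m + 1))) := by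
  have hc : (B.erase (Fin.last (m + 1))).card = B.card - 1 := Finset.card_erase_of_mem hB
  have hpos := Finset.card_pos.mpr ⟨_, hB⟩
  unfold evalFace
  by_cases h : B.card = p + 2
  · have h' : (B.erase (Fin.last (m + 1))).card = p + 1 := by omega
    rw [dif_pos h, dif_pos h']
    have hzero : ∀ v : Fin (m + 2), v ≠ Fin.last (m + 1) → x.2 v = 0 := by
      intro v hv
      have h1 : x.2 v ≤ x.2 (Fin.last m).castSucc := x.2.monotone (by
        have := Fin.val_lt_last hv
        simp only [Fin.le_def, Fin.val_castSucc, Fin.val_last]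
        omega)
      rw [hx.2] at h1
      exact le_antisymm h1 (Fin.zero_le _)
    have hlast : B.orderEmbOfFin h (Fin.last (p + 1)) = Fin.last (m + 1) := by
      have hB' := hB
      rw [← Finset.mem_coe, ← Finset.range_orderEmbOfFin B h] at hB'
      obtain ⟨j, hj⟩ := hB'
      refine le_antisymm (Fin.le_last _) ?_
      rw [← hj]
      exact (B.orderEmbOfFin h).monotone (Fin.le_last j)
    have hT : IsTop (p := p) (x.2.comp (B.orderEmbOfFin h).toOrderHom) := by
      refine ⟨?_, ?_⟩
      · change x.2 (B.orderEmbOfFin h (Fin.last (p + 1))) = 1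
        rw [hlast]; exact hx.1
      · change x.2 (B.orderEmbOfFin h (Fin.last p).castSucc) = 0
        rw [orderEmbOfFin_erase_last hB h h']
        exact hzero _ (Finset.mem_erase.mp (Finset.orderEmbOfFin_mem _ h' _)).1
    refine (if_pos hT).trans (congrArg a ?_)
    have e : SimplexCategory.δ (Fin.last (p + 1)) ≫
        SimplexCategory.mkHom (B.orderEmbOfFin h).toOrderHom =
        SimplexCategory.mkHom ((B.erase (Fin.last (m + 1))).orderEmbOfFin h').toOrderHom := by
      ext1
      apply OrderHom.ext
      funext i
      refine Eq.trans ?_ (orderEmbOfFin_erase_last hB h h' i)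
      change B.orderEmbOfFin h ((Fin.last (p + 1)).succAbove i) = _
      rw [Fin.succAbove_last]
    rw [← e, op_comp, S.map_comp]
    rfl
  · rw [dif_neg h, dif_neg (by omega)]

/-- The last vertex lies below no vertex, so adding it to the cut changes no parity elsewhere. -/
theorem leftPart_insert_last_erase {N : ℕ} {C : Finset (Fin (N + 1))} :
    (leftPart (insert (Fin.last N) C)).erase (Fin.last N) =
      (leftPart C).erase (Fin.last N) := by
  by_cases hC : Fin.last N ∈ C
  · rw [Finset.insert_eq_of_mem hC]
  · ext w
    by_cases h : w = Fin.last N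
    · simp [h]
    · simp [leftPart, below_insert hC, h, (Fin.le_last w).not_gt]

theorem rightPart_insert_last_erase {N : ℕ} {C : Finset (Fin (N + 1))} :
    (rightPart (insert (Fin.last N) C)).erase (Fin.last N) =
      (rightPart C).erase (Fin.last N) := by
  by_cases hC : Fin.last N ∈ C
  · rw [Finset.insert_eq_of_mem hC]
  · ext w
    by_cases h : w = Fin.last N
    · simp [h]
    · simp [rightPart, below_insert hC, h, (Fin.le_last w).not_gt]

/-- Suppose the last two vertices both had height 1. If one of them is in C, it lies in both parts,
and the part containing the other has two vertices of height 1. If neither is in C, both have the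
same parity and lie in the same part. So only the last vertex has height 1, and as each part needs
such a vertex, it belongs to both parts, that is to C. -/
theorem isTop_of_cut {m : ℕ} (φ : Fin (m + 2) →o Fin 2) {C : Finset (Fin (m + 2))}
    (hL : ((leftPart C).filter fun v => φ v = 1).card = 1)
    (hR : ((rightPart C).filter fun v => φ v = 1).card = 1) :
    IsTop φ ∧ Fin.last (m + 1) ∈ C := by
  obtain ⟨l, hl⟩ := Finset.card_eq_one.mp hL
  obtain ⟨r, hr⟩ := Finset.card_eq_one.mp hR
  have hl' : ∀ v, v ∈ leftPart C → φ v = 1 → v = l := fun v h1 h2 => by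
    rw [← Finset.mem_singleton, ← hl]; exact Finset.mem_filter.mpr ⟨h1, h2⟩
  have hr' : ∀ v, v ∈ rightPart C → φ v = 1 → v = r := fun v h1 h2 => by
    rw [← Finset.mem_singleton, ← hr]; exact Finset.mem_filter.mpr ⟨h1, h2⟩
  have hl1 : l ∈ leftPart C ∧ φ l = 1 := Finset.mem_filter.mp (hl ▸ Finset.mem_singleton_self l)
  have hr1 : r ∈ rightPart C ∧ φ r = 1 := Finset.mem_filter.mp (hr ▸ Finset.mem_singleton_self r)
  have hlast : φ (Fin.last (m + 1)) = 1 := by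
    have := φ.monotone (Fin.le_last l)
    rw [hl1.2] at this
    exact le_antisymm (Fin.le_last _) this
  have hor : ∀ v, v ∈ leftPart C ∨ v ∈ rightPart C := fun v => by
    rw [← Finset.mem_union, leftPart_union_rightPart]; exact Finset.mem_univ v
  have hpre : φ (Fin.last m).castSucc = 0 := by
    by_contra hne
    have h1 : φ (Fin.last m).castSucc = 1 := by
      generalize φ (Fin.last m).castSucc = x at hne
      revert x; decide
    have hab : (Fin.last m).castSucc ≠ Fin.last (m + 1) := (Fin.castSucc_lt_last _).ne
    by_cases ha : (Fin.last m).castSucc ∈ C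
    · have e1 := hl' _ (mem_leftPart_of_mem ha) h1
      have e2 := hr' _ (mem_rightPart_of_mem ha) h1
      rcases hor (Fin.last (m + 1)) with h | h
      · exact hab (e1.trans (hl' _ h hlast).symm)
      · exact hab (e2.trans (hr' _ h hlast).symm)
    · have hb : Fin.last (m + 1) ∉ C := fun hb => by
        have e1 := hl' _ (mem_leftPart_of_mem hb) hlast
        have e2 := hr' _ (mem_rightPart_of_mem hb) hlast
        rcases hor (Fin.last m).castSucc with h | h
        · exact hab ((hl' _ h h1).trans e1.symm)
        · exact hab ((hr' _ h h1).trans e2.symm)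
      have hbelow : below C (Fin.last (m + 1)) = below C (Fin.last m).castSucc := by
        unfold below
        congr 1
        ext w
        simp only [Finset.mem_filter]
        refine and_congr_right fun hw => ?_
        have w1 : w ≠ (Fin.last m).castSucc := fun e => ha (e ▸ hw)
        have w2 : w ≠ Fin.last (m + 1) := fun e => hb (e ▸ hw)
        simp only [Fin.lt_def, Fin.val_castSucc, Fin.val_last, ne_eq, Fin.ext_iff] at w1 w2 ⊢
        have := w.2
        omega
      by_cases he : Even (below C (Fin.last m).castSucc)
      · have e1 := hl' (Fin.last m).castSucc (by simp [leftPart, he]) h1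
        have e2 := hl' (Fin.last (m + 1)) (by simp [leftPart, hbelow, he]) hlast
        exact hab (e1.trans e2.symm)
      · have e1 := hr' (Fin.last m).castSucc
          (Finset.mem_filter.mpr ⟨Finset.mem_univ _, Or.inr he⟩) h1
        have e2 := hr' (Fin.last (m + 1))
          (Finset.mem_filter.mpr ⟨Finset.mem_univ _, Or.inr (hbelow ▸ he)⟩) hlast
        exact hab (e1.trans e2.symm)
  have honly : ∀ v, φ v = 1 → v = Fin.last (m + 1) := fun v hv => by
    by_contra hne
    have h1 : φ v ≤ φ (Fin.last m).castSucc := φ.monotone (by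
      have := Fin.val_lt_last hne
      simp only [Fin.le_def, Fin.val_castSucc, Fin.val_last]
      omega)
    rw [hv, hpre] at h1
    exact absurd h1 (by decide)
  refine ⟨⟨hlast, hpre⟩, ?_⟩
  rw [← leftPart_inter_rightPart C, Finset.mem_inter]
  exact ⟨honly l hl1.2 ▸ hl1.1, honly r hr1.2 ▸ hr1.1⟩

/-- All degrees rise by one, so i = p + q - m rises by one as well: this is the stability of the
Steenrod squares, valid on cochains. The extra element of the cut is the last vertex, the only one
at height 1. -/
theorem cupI_susp {p q m : ℕ} (a : Cochain S (ZMod 2) p) (b : Cochain S (ZMod 2) q) :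
    cupI (m + 1) (susp a) (susp b) = susp (cupI m a b) := by
  ext x
  have hzero : ∀ C : Finset (Fin (m + 2)),
      ¬ (IsTop (p := m) x.2 ∧ Fin.last (m + 1) ∈ C) →
      evalFace (susp a) x (leftPart C) * evalFace (susp b) x (rightPart C) = 0 := by
    intro C hC
    by_contra h
    exact hC (isTop_of_cut x.2
      (card_filter_of_evalFace_susp_ne_zero a x (left_ne_zero_of_mul h))
      (card_filter_of_evalFace_susp_ne_zero b x (right_ne_zero_of_mul h)))
  by_cases hx : IsTop (p := m) x.2
  · set H : Finset (Fin (m + 2)) → ZMod 2 := fun C =>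
      evalFace a x.1 ((leftPart C).erase (Fin.last (m + 1))) *
        evalFace b x.1 ((rightPart C).erase (Fin.last (m + 1))) with hH
    have h1 : cupI (m + 1) (susp a) (susp b) x = ∑ C with Fin.last (m + 1) ∈ C, H C := by
      unfold cupI
      rw [Finset.sum_filter]
      refine Finset.sum_congr rfl fun C _ => ?_
      split_ifs with hC
      · rw [evalFace_susp a x hx (mem_leftPart_of_mem hC),
          evalFace_susp b x hx (mem_rightPart_of_mem hC)]
      · exact hzero C fun h => hC h.2
    have h2 : susp (cupI m a b) x = ∑ C with Fin.last (m + 1) ∉ C, H C := by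
      refine (if_pos hx).trans ?_
      unfold cupI
      rw [Finset.sum_filter, ← sum_face]
      refine Finset.sum_congr rfl fun C _ => ?_
      rw [evalFace_face, evalFace_face, leftPart_map, rightPart_map]
    rw [h1, h2]
    -- Cuts containing the last vertex correspond to cuts avoiding it, that is, to cuts of the face
    -- opposite to it.
    refine Finset.sum_bij' (fun C _ => C.erase (Fin.last (m + 1)))
      (fun C _ => insert (Fin.last (m + 1)) C) ?_ ?_ ?_ ?_ ?_
    · intro C hC; simp
    · intro C hC; simp
    · intro C hC; exact Finset.insert_erase (by simpa using hC)
    · intro C hC; exact Finset.erase_insert (by simpa using hC)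
    · intro C hC
      have : Fin.last (m + 1) ∈ C := by simpa using hC
      rw [← Finset.insert_erase this]
      simp only [hH, leftPart_insert_last_erase, rightPart_insert_last_erase]
      simp
  · rw [show susp (cupI m a b) x = 0 from if_neg hx]
    exact Finset.sum_eq_zero fun C _ => hzero C fun h => hx h.1

end Suspension

/-! ### The prism operator: integration over the interval. -/

section Prism

variable {S : SSet.{0}}

/-- The monotone map which is `0` on the first `r` vertices and `1` on the other ones. -/
def threshold (m r : ℕ) : Fin (m + 1) →o Fin 2 where
  toFun i := if i.1 < r then 0 else 1
  monotone' i j hij := by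
    have : i.1 ≤ j.1 := hij
    dsimp only
    split_ifs <;> omega

theorem threshold_comp_of_lt {m r : ℕ} {i : Fin (m + 2)} (h : i.1 < r + 1) :
    (threshold (m + 1) (r + 1)).comp (Fin.succAboveOrderEmb i).toOrderHom = threshold m r := by
  ext l
  change ((if (i.succAbove l).1 < r + 1 then 0 else 1 : Fin 2) : ℕ) =
    ((if l.1 < r then 0 else 1 : Fin 2) : ℕ)
  congr 2
  rw [Fin.succAbove]
  split_ifs with h'
  · have : l.1 < i.1 := h'
    simp only [Fin.val_castSucc, eq_iff_iff]
    omega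
  · simp

theorem threshold_comp_of_le {m r : ℕ} {i : Fin (m + 2)} (h : r ≤ i.1) :
    (threshold (m + 1) r).comp (Fin.succAboveOrderEmb i).toOrderHom = threshold m r := by
  ext l
  change ((if (i.succAbove l).1 < r then 0 else 1 : Fin 2) : ℕ) =
    ((if l.1 < r then 0 else 1 : Fin 2) : ℕ)
  congr 2
  rw [Fin.succAbove]
  split_ifs with h'
  · simp
  · have : i.1 ≤ l.1 := not_lt.mp h'
    simp only [Fin.val_succ, eq_iff_iff]
    omega

/-- The simplices of the prism over a simplex. -/
def prismSimplex {m : ℕ} (σ : Simplex S m) (j : Fin (m + 1)) : Simplex (cyl S) (m + 1) :=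
  (S.σ j σ, threshold (m + 1) (j + 1))

/-- The prism operator, which integrates cochains over the interval. -/
def prism {m : ℕ} (b : Cochain (cyl S) (ZMod 2) (m + 1)) : Cochain S (ZMod 2) m :=
  fun σ => ∑ j : Fin (m + 1), b (prismSimplex σ j)

/-- The simplex of the cylinder at the height `threshold m r`. -/
def levelSimplex {m : ℕ} (σ : Simplex S m) (r : ℕ) : Simplex (cyl S) m := (σ, threshold m r)

/-- Among the prism simplices only the last one has a single vertex at height 1. Its face opposite
to that vertex is the original simplex. -/
theorem prism_susp {m : ℕ} (c : Cochain S (ZMod 2) m) : prism (susp c) = c := by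
  ext σ
  unfold prism
  rw [Finset.sum_eq_single (Fin.last m)]
  · have hT : IsTop (p := m) (threshold (m + 1) ((Fin.last m : ℕ) + 1)) := by
      constructor <;> simp [threshold]
    refine (if_pos hT).trans (congrArg c ?_)
    have := S.δ_comp_σ_succ (i := Fin.last m)
    exact ConcreteCategory.congr_hom this σ
  · intro j _ hj
    refine if_neg fun hT => hj ?_
    have h := hT.2
    have hlt := Fin.val_lt_last hj
    simp [prismSimplex, threshold] at h
    omega
  · simp

theorem prismSimplex_δ_castSucc {m : ℕ} (σ : Simplex S (m + 1)) (j : Fin (m + 2)) :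
    (cyl S).δ j.castSucc (prismSimplex σ j) = levelSimplex σ j := by
  refine Prod.ext ?_ ?_
  · have := S.δ_comp_σ_self (i := j)
    exact ConcreteCategory.congr_hom this σ
  · exact threshold_comp_of_lt (by simp)

theorem prismSimplex_δ_succ {m : ℕ} (σ : Simplex S (m + 1)) (j : Fin (m + 2)) :
    (cyl S).δ j.succ (prismSimplex σ j) = levelSimplex σ (j + 1) := by
  refine Prod.ext ?_ ?_
  · have := S.δ_comp_σ_succ (i := j)
    exact ConcreteCategory.congr_hom this σ
  · exact threshold_comp_of_le (by simp)

theorem prismSimplex_δ_of_le {m : ℕ} (σ : Simplex S (m + 1)) {i : Fin (m + 2)} {j : Fin (m + 1)}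
    (h : i ≤ j.castSucc) :
    (cyl S).δ i.castSucc (prismSimplex σ j.succ) = prismSimplex (S.δ i σ) j := by
  refine Prod.ext ?_ ?_
  · have := S.δ_comp_σ_of_le h
    exact ConcreteCategory.congr_hom this σ
  · have : i.1 ≤ j.1 := h
    exact threshold_comp_of_lt (by simp; omega)

theorem prismSimplex_δ_of_gt {m : ℕ} (σ : Simplex S (m + 1)) {i : Fin (m + 2)} {j : Fin (m + 1)}
    (h : j.castSucc < i) :
    (cyl S).δ i.succ (prismSimplex σ j.castSucc) = prismSimplex (S.δ i σ) j := by
  refine Prod.ext ?_ ?_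
  · have := S.δ_comp_σ_of_gt h
    exact ConcreteCategory.congr_hom this σ
  · have : j.1 < i.1 := h
    exact threshold_comp_of_le (by simp; omega)

/-- The pairs of a vertex and a face of the prism, without the horizontal faces. -/
theorem sum_prism_faces {A : Type} [AddCommMonoid A] {m : ℕ} (F : Fin (m + 2) → Fin (m + 3) → A) :
    ∑ j : Fin (m + 2), ∑ i : Fin (m + 3), F j i =
      ∑ j, (F j j.castSucc + F j j.succ) +
        ∑ i : Fin (m + 2), ∑ j : Fin (m + 1),
          if i ≤ j.castSucc then F j.succ i.castSucc else F j.castSucc i.succ := by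
  have h1 : ∀ j : Fin (m + 2), ∑ i : Fin (m + 3), F j i = F j j.castSucc + F j j.succ +
      ∑ i with i ≠ j.castSucc ∧ i ≠ j.succ, F j i := by
    intro j
    have hne : j.castSucc ≠ j.succ := Fin.castSucc_lt_succ.ne
    rw [← Finset.sum_filter_add_sum_filter_not Finset.univ
      (fun i => i = j.castSucc ∨ i = j.succ)]
    congr 1
    · rw [← Finset.sum_pair hne]
      congr 1
      ext i; simp
    · congr 1
      ext i; simp
  rw [Finset.sum_congr rfl fun j _ => h1 j, Finset.sum_add_distrib]
  congr 1
  rw [Finset.sum_sigma', Finset.sum_sigma']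
  symm
  -- The vertical faces are indexed by the simplicial identities: the j-th prism simplex over the
  -- face dᵢσ is a face of the prism simplex over σ with index j + 1 if i ≤ j, and with index j
  -- otherwise.
  refine Finset.sum_bij (fun x _ => if x.1 ≤ x.2.castSucc then ⟨x.2.succ, x.1.castSucc⟩ else
    ⟨x.2.castSucc, x.1.succ⟩) ?_ ?_ ?_ ?_
  · rintro ⟨i, j⟩ _
    by_cases h : i ≤ j.castSucc
    · have h' : i.1 ≤ j.1 := h
      simp only [h, if_true, Finset.mem_sigma, Finset.mem_univ, Finset.mem_filter, true_and, ne_eq,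
        Fin.ext_iff, Fin.val_succ, Fin.val_castSucc]
      omega
    · have h' : j.1 < i.1 := not_le.mp h
      simp only [h, if_false, Finset.mem_sigma, Finset.mem_univ, Finset.mem_filter, true_and, ne_eq,
        Fin.ext_iff, Fin.val_succ, Fin.val_castSucc]
      omega
  · rintro ⟨i, j⟩ _ ⟨i', j'⟩ _ he
    have key : ∀ {x y : (_ : Fin (m + 2)) × Fin (m + 3)}, x = y → x.1.1 = y.1.1 ∧ x.2.1 = y.2.1 :=
      fun h => by rw [h]; exact ⟨rfl, rfl⟩
    have he' := key he
    have hi : i.1 = i'.1 ∧ j.1 = j'.1 := by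
      by_cases h : i ≤ j.castSucc <;> by_cases h' : i' ≤ j'.castSucc <;>
        simp only [h, h', if_true, if_false, Fin.val_succ, Fin.val_castSucc] at he' <;>
        simp only [Fin.le_def, Fin.val_castSucc] at h h' <;> omega
    obtain rfl := Fin.ext hi.1
    obtain rfl := Fin.ext hi.2
    rfl
  · rintro ⟨j, i⟩ h
    simp only [Finset.mem_sigma, Finset.mem_univ, Finset.mem_filter, true_and, ne_eq,
        Fin.ext_iff, Fin.val_succ, Fin.val_castSucc] at h
    have hi := i.2
    have hj := j.2
    by_cases hlt : i.1 < j.1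
    · refine ⟨⟨⟨i.1, by omega⟩, ⟨j.1 - 1, by omega⟩⟩, by simp, ?_⟩
      have h' : (⟨i.1, by omega⟩ : Fin (m + 2)) ≤ (⟨j.1 - 1, by omega⟩ : Fin (m + 1)).castSucc := by
        simp only [Fin.le_def, Fin.val_castSucc]; omega
      rw [if_pos h']
      refine Sigma.ext (Fin.ext ?_) (heq_of_eq (Fin.ext ?_))
      · simp only [Fin.val_succ]; omega
      · rfl
    · refine ⟨⟨⟨i.1 - 1, by omega⟩, ⟨j.1, by omega⟩⟩, by simp, ?_⟩
      have h' : ¬ (⟨i.1 - 1, by omega⟩ : Fin (m + 2)) ≤ (⟨j.1, by omega⟩ : Fin (m + 1)).castSucc := by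
        simp only [Fin.le_def, Fin.val_castSucc]; omega
      rw [if_neg h']
      refine Sigma.ext (Fin.ext ?_) (heq_of_eq (Fin.ext ?_))
      · rfl
      · simp only [Fin.val_succ]; omega
  · rintro ⟨i, j⟩ _
    dsimp only
    split_ifs <;> rfl

theorem neg_one_pow_smul_zmod (i : ℕ) (x : ZMod 2) : (-1 : ℤ) ^ i • x = x := by
  rcases neg_one_pow_eq_or ℤ i with e | e <;> rw [e] <;> revert x <;> decide

/-- The homotopy formula for the prism operator. -/
theorem prism_coboundary {m : ℕ} (b : Cochain (cyl S) (ZMod 2) (m + 1)) :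
    prism (coboundary (cyl S) (ZMod 2) (m + 1) b) = coboundary S (ZMod 2) m (prism b) +
      fun σ => b (levelSimplex σ 0) - b (levelSimplex σ (m + 2)) := by
  ext σ
  simp only [prism, coboundary_apply, neg_one_pow_smul_zmod, Pi.add_apply]
  rw [sum_prism_faces, add_comm]
  congr 1
  · refine Finset.sum_congr rfl fun i _ => Finset.sum_congr rfl fun j _ => ?_
    split_ifs with h
    · rw [prismSimplex_δ_of_le σ h]
    · rw [prismSimplex_δ_of_gt σ (not_le.mp h)]
  · simp only [prismSimplex_δ_castSucc, prismSimplex_δ_succ]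
    have h : ∀ x y : ZMod 2, x + y = x - y := by decide
    simp only [h]
    -- The j-th prism simplex has the levels `j` and `j + 1` as its inner faces. The sum telescopes
    -- to the two ends of the cylinder.
    rw [Fin.sum_univ_eq_sum_range (fun j => b (levelSimplex σ j) - b (levelSimplex σ (j + 1))),
      Finset.sum_range_sub']

/-- Integration over a loop detects coboundaries. -/
theorem mem_boundaries_of_susp {m : ℕ} {c : Cochain S (ZMod 2) (m + 1)}
    {b : Cochain (cyl S) (ZMod 2) (m + 1)} (h : coboundary (cyl S) (ZMod 2) (m + 1) b = susp c)
    (hb : ∀ σ, b (levelSimplex σ 0) = b (levelSimplex σ (m + 2))) :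
    c ∈ boundaries S (ZMod 2) (m + 1) := by
  refine ⟨prism b, ?_⟩
  have h1 := prism_coboundary b
  rw [h, prism_susp] at h1
  rw [h1]
  ext σ
  simp [hb]

end Prism

/-! ### An open model for ℝP^∞, its double cover and the holonomy. -/

section SignSpace

/-- The sign of a nonzero real number, written additively. -/
def signBit (a : ℝ) : ZMod 2 := if a < 0 then 1 else 0

theorem signBit_mul {a b : ℝ} (ha : a ≠ 0) (hb : b ≠ 0) :
    signBit (a * b) = signBit a + signBit b := by
  unfold signBit
  rcases lt_or_gt_of_ne ha with h | h <;> rcases lt_or_gt_of_ne hb with h' | h'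
  · rw [if_neg (mul_pos_of_neg_of_neg h h').not_gt, if_pos h, if_pos h']; decide
  · rw [if_pos (mul_neg_of_neg_of_pos h h'), if_pos h, if_neg h'.not_gt]; decide
  · rw [if_pos (mul_neg_of_pos_of_neg h h'), if_neg h.not_gt, if_pos h']; decide
  · rw [if_neg (mul_pos h h').not_gt, if_neg h.not_gt, if_neg h'.not_gt]; decide

theorem signBit_of_pos {a : ℝ} (ha : 0 < a) : signBit a = 0 := if_neg ha.not_gt

theorem signBit_eventually_eq {T : Type} [TopologicalSpace T] {f : T → ℝ} (hf : Continuous f)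
    {t : T} (ht : f t ≠ 0) : ∀ᶠ s in nhds t, signBit (f s) = signBit (f t) := by
  rcases lt_or_gt_of_ne ht with h | h
  · filter_upwards [(isOpen_Iio.preimage hf).mem_nhds h] with s hs
    rw [signBit, signBit, if_pos (show f s < 0 from hs), if_pos h]
  · filter_upwards [(isOpen_Ioi.preimage hf).mem_nhds h] with s hs
    rw [signBit_of_pos hs, signBit_of_pos h]

variable (ι : Type)

/-- Weights `D i` and transition numbers `A i j`, whose signs form a cocycle on the cover by
the sets `{D i ≥ 0}`. The sets `{D i > 0}` cover this space. -/
def signSpace : Set ((ι → ℝ) × (ι → ι → ℝ)) :=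
  {x | (∃ i, 0 < x.1 i) ∧
    ∀ i j l, x.1 i < 0 ∨ x.1 j < 0 ∨ x.1 l < 0 ∨ 0 < x.2 i j * x.2 j l * x.2 i l}

/-- The positivity of the products is required already where the weights are ≥ 0, so every
alternative in the definition is a strict inequality. Only finitely many conditions are intersected.
-/
theorem isOpen_signSpace [Finite ι] : IsOpen (signSpace ι) := by
  have h : signSpace ι = (⋃ i, {x | 0 < x.1 i}) ∩ ⋂ i, ⋂ j, ⋂ l,
      ({x | x.1 i < 0} ∪ ({x | x.1 j < 0} ∪ ({x | x.1 l < 0} ∪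
        {x | 0 < x.2 i j * x.2 j l * x.2 i l}))) := by
    ext x; simp [signSpace]
  rw [h]
  refine IsOpen.inter (isOpen_iUnion fun i => isOpen_lt (by fun_prop) (by fun_prop)) ?_
  refine isOpen_iInter_of_finite fun i => isOpen_iInter_of_finite fun j =>
    isOpen_iInter_of_finite fun l => ?_
  refine IsOpen.union ?_ (IsOpen.union ?_ (IsOpen.union ?_ ?_)) <;>
    exact isOpen_lt (by fun_prop) (by fun_prop)

variable {ι}

/-- An index with positive weight. -/
def posIndex (x : signSpace ι) : ι := x.2.1.choose

theorem posIndex_spec (x : signSpace ι) : 0 < x.1.1 (posIndex x) := x.2.1.choose_spec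

/-- In the condition for the triple (i, j, j) the number A i j is a factor. -/
theorem transition_ne_zero (x : signSpace ι) {i j : ι} (hi : 0 < x.1.1 i) (hj : 0 < x.1.1 j) :
    x.1.2 i j ≠ 0 := by
  intro h
  have h1 := x.2.2 i j j
  simp [hi.not_gt, hj.not_gt, h] at h1

theorem transition_cocycle (x : signSpace ι) {i j l : ι} (hi : 0 < x.1.1 i) (hj : 0 < x.1.1 j)
    (hl : 0 < x.1.1 l) :
    signBit (x.1.2 i j) + signBit (x.1.2 j l) = signBit (x.1.2 i l) := by
  have h1 := x.2.2 i j l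
  simp only [hi.not_gt, hj.not_gt, hl.not_gt, false_or] at h1
  have h2 := signBit_of_pos h1
  rw [signBit_mul (mul_ne_zero (transition_ne_zero x hi hj) (transition_ne_zero x hj hl))
    (transition_ne_zero x hi hl), signBit_mul (transition_ne_zero x hi hj)
    (transition_ne_zero x hj hl)] at h2
  rwa [CharTwo.add_eq_zero] at h2

theorem transition_self (x : signSpace ι) {i : ι} (hi : 0 < x.1.1 i) :
    signBit (x.1.2 i i) = 0 := by
  have := transition_cocycle x hi hi hi
  simpa using this

variable {T : Type} [TopologicalSpace T]

/-- A trivialization of the pullback along `σ` of the double cover of `signSpace ι` given by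
the cocycle of signs. -/
structure IsFraming (σ : C(T, signSpace ι)) (L : ι → T → ZMod 2) : Prop where
  eventually_eq : ∀ i t, 0 < (σ t).1.1 i → ∀ᶠ s in nhds t, L i s = L i t
  transition : ∀ i j t, 0 < (σ t).1.1 i → 0 < (σ t).1.1 j →
    L j t = L i t + signBit ((σ t).1.2 i j)

theorem isOpen_weight_pos (σ : C(T, signSpace ι)) (i : ι) : IsOpen {t | 0 < (σ t).1.1 i} := by
  have : Continuous fun t => (σ t).1.1 i := by fun_prop
  exact isOpen_lt continuous_const this

/-- The double cover pulled back along `σ`. -/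
def signCover (σ : C(T, signSpace ι)) : FiberBundleCore ι T (ZMod 2) where
  baseSet i := {t | 0 < (σ t).1.1 i}
  isOpen_baseSet := isOpen_weight_pos σ
  indexAt t := posIndex (σ t)
  mem_baseSet_at t := posIndex_spec (σ t)
  coordChange i j t b := b + signBit ((σ t).1.2 i j)
  coordChange_self i t ht b := by rw [transition_self _ ht, add_zero]
  continuousOn_coordChange i j := by
    rintro ⟨t, b⟩ ⟨⟨hi, hj⟩, -⟩
    apply ContinuousAt.continuousWithinAt
    have h1 : Continuous fun t => (σ t).1.2 i j := by fun_prop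
    have h2 := signBit_eventually_eq h1 (transition_ne_zero (σ t) hi hj)
    have h3 : ContinuousAt (fun p : T × ZMod 2 => p.2 + signBit ((σ t).1.2 i j)) (t, b) := by
      fun_prop
    refine h3.congr ?_
    filter_upwards [(continuous_fst.tendsto (t, b)).eventually h2] with p hp
    rw [hp]
  coordChange_comp i j l t ht b := by
    rw [add_assoc, transition_cocycle _ ht.1.1 ht.1.2 ht.2]

/-- A covering of a simply connected, locally path connected space has a section. Read in the local
trivializations, the section is a framing. -/
theorem exists_isFraming [SimplyConnectedSpace T] [LocallyPathConnectedSpace T]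
    (σ : C(T, signSpace ι)) : ∃ L, IsFraming σ L := by
  have hcov : IsCoveringMap (signCover σ).proj :=
    FiberBundle.isCoveringMap (F := ZMod 2) (E := (signCover σ).Fiber)
  obtain ⟨t₀⟩ : Nonempty T := inferInstance
  -- The section is the lift of the identity map.
  obtain ⟨F, ⟨-, hF⟩, -⟩ := hcov.existsUnique_continuousMap_lifts (ContinuousMap.id T) t₀
    ⟨t₀, (0 : ZMod 2)⟩ rfl
  have hF1 : ∀ t, (F t).1 = t := fun t => congrFun hF t
  refine ⟨fun i t => ((signCover σ).localTriv i (F t)).2, ⟨fun i t ht => ?_, fun i j t hi hj => ?_⟩⟩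
  · have h1 : ContinuousAt ((signCover σ).localTriv i) (F t) := by
      apply ((signCover σ).localTriv i).continuousAt
      rw [FiberBundleCore.mem_localTriv_source, ← FiberBundleCore.baseSet_at, hF1]
      exact ht
    have h2 : ContinuousAt (fun s => ((signCover σ).localTriv i (F s)).2) t :=
      continuousAt_snd.comp (ContinuousAt.comp h1 F.continuous.continuousAt)
    exact h2.eventually (show ∀ᶠ y in nhds _, y = _ from by simp [nhds_discrete])
  · simp only [FiberBundleCore.localTriv_apply]
    have e : (signCover σ).coordChange i j (F t).1
        ((signCover σ).coordChange ((signCover σ).indexAt (F t).1) i (F t).1 (F t).2) =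
        (signCover σ).coordChange ((signCover σ).indexAt (F t).1) j (F t).1 (F t).2 := by
      apply (signCover σ).coordChange_comp
      refine ⟨⟨(signCover σ).mem_baseSet_at _, ?_⟩, ?_⟩ <;> rw [hF1]
      · exact hi
      · exact hj
    rw [← e]
    change _ + signBit ((σ (F t).1).1.2 i j) = _
    rw [hF1]

/-- The difference of two framings does not depend on the index, because both have the same
transitions. It is therefore a locally constant function. Hence the holonomy is independent of the
framing. -/
theorem IsFraming.add_eq_add [PreconnectedSpace T] {σ : C(T, signSpace ι)} {L L' : ι → T → ZMod 2}
    (h : IsFraming σ L) (h' : IsFraming σ L') (p q : T) :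
    L (posIndex (σ p)) p + L' (posIndex (σ p)) p =
      L (posIndex (σ q)) q + L' (posIndex (σ q)) q := by
  have hc : IsLocallyConstant fun t => L (posIndex (σ t)) t + L' (posIndex (σ t)) t := by
    rw [IsLocallyConstant.iff_eventually_eq]
    intro t
    set i := posIndex (σ t)
    have hi : 0 < (σ t).1.1 i := posIndex_spec _
    filter_upwards [h.eventually_eq i t hi, h'.eventually_eq i t hi,
      (isOpen_weight_pos σ i).mem_nhds hi] with s h1 h2 h3
    rw [h.transition i _ s h3 (posIndex_spec _), h'.transition i _ s h3 (posIndex_spec _), h1, h2,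
      add_add_add_comm, CharTwo.add_self_eq_zero, add_zero]
  exact hc.apply_eq_of_preconnectedSpace p q

open Classical in
/-- The holonomy of the double cover along `σ` from `p` to `q`. -/
def holonomy (σ : C(T, signSpace ι)) (p q : T) : ZMod 2 :=
  if h : ∃ L, IsFraming σ L then h.choose (posIndex (σ p)) p + h.choose (posIndex (σ q)) q else 0

theorem IsFraming.holonomy_eq [PreconnectedSpace T] {σ : C(T, signSpace ι)} {L : ι → T → ZMod 2}
    (h : IsFraming σ L) (p q : T) :
    holonomy σ p q = L (posIndex (σ p)) p + L (posIndex (σ q)) q := by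
  have hL : ∃ L, IsFraming σ L := ⟨L, h⟩
  rw [holonomy, dif_pos hL]
  have h1 := hL.choose_spec.add_eq_add h p q
  have h2 : ∀ a b c d : ZMod 2, a + b = c + d → a + c = b + d := by decide
  exact h2 _ _ _ _ h1

theorem IsFraming.comp {T' : Type} [TopologicalSpace T'] {σ : C(T, signSpace ι)}
    {L : ι → T → ZMod 2} (h : IsFraming σ L) (f : C(T', T)) :
    IsFraming (σ.comp f) (fun i t => L i (f t)) where
  eventually_eq i t ht := (f.continuous.tendsto t).eventually (h.eventually_eq i (f t) ht)
  transition i j t := h.transition i j (f t)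

/-- A framing restricts to a framing, and the index used at a point depends only on its image in
`signSpace`. This is what makes the holonomy a map of simplicial sets. -/
theorem holonomy_comp [SimplyConnectedSpace T] [LocallyPathConnectedSpace T] {T' : Type}
    [TopologicalSpace T'] [PreconnectedSpace T'] (σ : C(T, signSpace ι)) (f : C(T', T)) (p q : T') :
    holonomy (σ.comp f) p q = holonomy σ (f p) (f q) := by
  obtain ⟨L, hL⟩ := exists_isFraming σ
  rw [hL.holonomy_eq, (hL.comp f).holonomy_eq]
  rfl

theorem holonomy_add [SimplyConnectedSpace T] [LocallyPathConnectedSpace T]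
    (σ : C(T, signSpace ι)) (p q r : T) :
    holonomy σ p q + holonomy σ q r = holonomy σ p r := by
  obtain ⟨L, hL⟩ := exists_isFraming σ
  simp only [hL.holonomy_eq]
  have : ∀ a b c : ZMod 2, a + b + (b + c) = a + c := by decide
  exact this _ _ _

theorem holonomy_self [SimplyConnectedSpace T] [LocallyPathConnectedSpace T]
    (σ : C(T, signSpace ι)) (p : T) : holonomy σ p p = 0 := by
  have := holonomy_add σ p p p
  simpa using this

/-- The point of `signSpace ι` with weights `D` and rank one transition matrix `a i * a j`. -/
def rankOne (D a : T → ι → ℝ) (hD : Continuous D) (ha : Continuous a)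
    (hne : ∀ t i, 0 ≤ D t i → a t i ≠ 0) (hpos : ∀ t, ∃ i, 0 < D t i) : C(T, signSpace ι) where
  toFun t := ⟨(D t, fun i j => a t i * a t j), hpos t, fun i j l => by
    by_contra! h
    obtain ⟨h1, h2, h3, h4⟩ := h
    have h5 : a t i * a t j * a t l ≠ 0 :=
      mul_ne_zero (mul_ne_zero (hne t i h1) (hne t j h2)) (hne t l h3)
    -- The cocycle condition holds for rank one matrices because the product over a triangle is a
    -- square.
    have h6 : a t i * a t j * (a t j * a t l) * (a t i * a t l) =
      (a t i * a t j * a t l) ^ 2 := by ring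
    exact absurd (h6 ▸ h4) (not_le.mpr (by positivity))⟩
  continuous_toFun := by fun_prop

theorem isFraming_rankOne (D a : T → ι → ℝ) (hD : Continuous D) (ha : Continuous a)
    (hne : ∀ t i, 0 ≤ D t i → a t i ≠ 0) (hpos : ∀ t, ∃ i, 0 < D t i) :
    IsFraming (rankOne D a hD ha hne hpos) (fun i t => signBit (a t i)) where
  eventually_eq i t ht :=
    signBit_eventually_eq (f := fun t => a t i) (by fun_prop) (hne t i (le_of_lt ht))
  transition i j t hi hj := by
    change _ = _ + signBit (a t i * a t j)
    rw [signBit_mul (hne t i (le_of_lt hi)) (hne t j (le_of_lt hj)), ← add_assoc,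
      CharTwo.add_self_eq_zero, zero_add]

end SignSpace

/-! ### The classifying map of the double cover on singular simplices. -/

section EdgeMap

instance (n : ℕ) : ContractibleSpace (stdSimplex ℝ (Fin (n + 1))) :=
  (convex_stdSimplex ℝ (Fin (n + 1))).contractibleSpace ⟨_, single_mem_stdSimplex ℝ 0⟩

instance (n : ℕ) : LocallyPathConnectedSpace (stdSimplex ℝ (Fin (n + 1))) :=
  (convex_stdSimplex ℝ (Fin (n + 1))).locallyPathConnectedSpace

variable {ι : Type} {X : TopCat.{0}}

/-- The map from singular simplices to the nerve of `ℤ/2` given by the double cover of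
`signSpace ι` pulled back along `f`. -/
def edgeMap (f : C(X, signSpace ι)) : TopCat.toSSet.obj X ⟶ edgeNerve (ZMod 2) where
  app n := ↾fun σ => ⟨fun i j => holonomy (f.comp (TopCat.toSSetObjEquiv X n σ))
      (stdSimplex.vertex i) (stdSimplex.vertex j), fun i j k => holonomy_add _ _ _ _⟩
  naturality n m g := by
    ext σ
    apply Subtype.ext
    funext i j
    have h := holonomy_comp (f.comp (TopCat.toSSetObjEquiv X n σ))
      ⟨_, stdSimplex.continuous_map g.unop.toOrderHom⟩ (stdSimplex.vertex i) (stdSimplex.vertex j)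
    refine Eq.trans h ?_
    simp only [ContinuousMap.coe_mk, stdSimplex.map_vertex]
    rfl

end EdgeMap

/-! ### Detecting classes on a product of two copies of the model. -/

section Classes

/-- The map to the nerve of a product with the given components. -/
def edgePair {S : SSet.{0}} {G H : Type} [AddCommGroup G] [AddCommGroup H]
    (f : S ⟶ edgeNerve G) (g : S ⟶ edgeNerve H) : S ⟶ edgeNerve (G × H) where
  app n := ↾fun σ => ⟨fun i j => ((f.app n σ).1 i j, (g.app n σ).1 i j), fun i j k =>
    Prod.ext ((f.app n σ).2 i j k) ((g.app n σ).2 i j k)⟩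
  naturality n m h := by
    ext σ
    apply Subtype.ext
    funext i j
    have h1 := ConcreteCategory.congr_hom (f.naturality h) σ
    have h2 := ConcreteCategory.congr_hom (g.naturality h) σ
    exact Prod.ext (congrFun (congrFun (congrArg Subtype.val h1) i) j)
      (congrFun (congrFun (congrArg Subtype.val h2) i) j)

/-- The sign of an element of `ℤ/2`. -/
def realSign (x : ZMod 2) : ℝ := if x = 0 then 1 else -1

theorem realSign_ne_zero (x : ZMod 2) : realSign x ≠ 0 := by
  unfold realSign
  split_ifs <;> norm_num

theorem realSign_add (x y : ZMod 2) : realSign (x + y) = realSign x * realSign y := by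
  have h : ∀ a : ZMod 2, a = 0 ∨ a = 1 := by decide
  have h11 : (1 : ZMod 2) + 1 = 0 := by decide
  rcases h x with rfl | rfl <;> rcases h y with rfl | rfl <;> simp [realSign, h11]

theorem realSign_mul_self (x : ZMod 2) : realSign x * realSign x = 1 := by
  rw [← realSign_add, CharTwo.add_self_eq_zero]; simp [realSign]

theorem signBit_realSign (x : ZMod 2) : signBit (realSign x) = x := by
  have h : ∀ a : ZMod 2, a = 0 ∨ a = 1 := by decide
  rcases h x with rfl | rfl <;> simp [realSign, signBit]

theorem continuous_coordinate {n : ℕ} (i : Fin n) :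
    Continuous fun t : stdSimplex ℝ (Fin n) => t.1 i :=
  (continuous_apply i).comp continuous_subtype_val

variable {m : ℕ}

/-- The simplex in `signSpace` whose `i`-th vertex has the sign `x i`. -/
def signSimplex (x : Fin (m + 1) → ZMod 2) :
    C(stdSimplex ℝ (Fin (m + 1)), signSpace (Fin (m + 1))) :=
  -- With `m + 1` coordinates of sum 1, some coordinate exceeds `1 / (m + 2)`. Where `t i = 0` the
  -- weight is negative, so the vector may vanish there; this makes a face independent of the sign
  -- of the opposite vertex.
  rankOne (fun t i => t.1 i - 1 / (m + 2)) (fun t i => t.1 i * realSign (x i))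
    (continuous_pi fun i => (continuous_coordinate i).sub continuous_const)
    (continuous_pi fun i => (continuous_coordinate i).mul continuous_const) (fun t i h => mul_ne_zero (by
      have : (0 : ℝ) < 1 / (m + 2) := by positivity
      intro h0
      simp only [h0] at h
      linarith) (realSign_ne_zero _)) (fun t => by
      by_contra! h
      have h1 : ∑ i, t.1 i ≤ ∑ _i : Fin (m + 1), (1 / (m + 2) : ℝ) :=
        Finset.sum_le_sum fun i _ => by linarith [h i]
      have h2 := t.2.2
      rw [h2, Finset.sum_const, Finset.card_univ, Fintype.card_fin, nsmul_eq_mul] at h1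
      push_cast at h1
      rw [mul_one_div, le_div_iff₀ (by positivity)] at h1
      linarith)

theorem signSimplex_apply (x : Fin (m + 1) → ZMod 2) (t) :
    (signSimplex x t).1 = (fun i => t.1 i - 1 / (m + 2),
      fun i j => t.1 i * realSign (x i) * (t.1 j * realSign (x j))) := rfl

/-- Only products of two signs occur, so a common change of sign is invisible. -/
theorem signSimplex_translate (x : Fin (m + 1) → ZMod 2) (c : ZMod 2) :
    signSimplex (fun i => x i + c) = signSimplex x := by
  ext1 t
  apply Subtype.ext
  rw [signSimplex_apply, signSimplex_apply]
  refine Prod.ext rfl ?_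
  funext i j
  simp only [realSign_add]
  linear_combination (t.1 i * realSign (x i) * (t.1 j * realSign (x j))) * realSign_mul_self c

theorem signSimplex_congr {x y : Fin (m + 1) → ZMod 2} {t : stdSimplex ℝ (Fin (m + 1))}
    (h : ∀ i, x i = y i ∨ t.1 i = 0) : signSimplex x t = signSimplex y t := by
  apply Subtype.ext
  rw [signSimplex_apply, signSimplex_apply]
  have h1 : ∀ i, t.1 i * realSign (x i) = t.1 i * realSign (y i) := fun i => by
    rcases h i with h | h <;> rw [h]
    simp
  refine Prod.ext rfl ?_
  funext i j
  simp only [h1]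

theorem posIndex_signSimplex_vertex (x : Fin (m + 1) → ZMod 2) (i : Fin (m + 1)) :
    posIndex (signSimplex x (stdSimplex.vertex i)) = i := by
  by_contra hne
  have h := posIndex_spec (signSimplex x (stdSimplex.vertex i))
  rw [signSimplex_apply] at h
  simp only [Pi.single_eq_of_ne hne] at h
  have : (0 : ℝ) < 1 / (m + 2) := by positivity
  linarith

theorem isFraming_signSimplex (x : Fin (m + 1) → ZMod 2) :
    IsFraming (signSimplex x) (fun i t => signBit (t.1 i * realSign (x i))) :=
  isFraming_rankOne _ _ _ _ _ _

theorem holonomy_signSimplex (x : Fin (m + 1) → ZMod 2) (i j : Fin (m + 1)) :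
    holonomy (signSimplex x) (stdSimplex.vertex i) (stdSimplex.vertex j) = x j - x i := by
  rw [(isFraming_signSimplex x).holonomy_eq, posIndex_signSimplex_vertex, posIndex_signSimplex_vertex]
  simp only [Pi.single_eq_same, one_mul, signBit_realSign]
  rw [add_comm, CharTwo.sub_eq_add]

/-- The simplex with signs `g` in the product of two copies of `signSpace`. -/
def signPairSimplex (g : Fin (m + 1) → ZMod 2 × ZMod 2) :
    Simplex (TopCat.toSSet.obj (TopCat.of
      (signSpace (Fin (m + 1)) × signSpace (Fin (m + 1))))) m :=
  (TopCat.toSSetObjEquiv _ (op (SimplexCategory.mk m))).symm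
    ((signSimplex fun i => (g i).1).prodMk (signSimplex fun i => (g i).2))

theorem signPairSimplex_translate (g : Fin (m + 1) → ZMod 2 × ZMod 2) (c : ZMod 2 × ZMod 2) :
    signPairSimplex (fun i => g i + c) = signPairSimplex g := by
  have h1 := signSimplex_translate (fun i => (g i).1) c.1
  have h2 := signSimplex_translate (fun i => (g i).2) c.2
  unfold signPairSimplex
  simp only [Prod.fst_add, Prod.snd_add]
  rw [h1, h2]

theorem map_succAbove_apply_self (i : Fin (m + 2)) (p : stdSimplex ℝ (Fin (m + 1))) :
    (stdSimplex.map i.succAbove p).1 i = 0 := by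
  change FunOnFinite.linearMap ℝ ℝ i.succAbove p.1 i = 0
  rw [FunOnFinite.linearMap_apply_apply]
  exact Finset.sum_eq_zero fun j hj => absurd (Finset.mem_filter.mp hj).2 (Fin.succAbove_ne i j)

theorem signPairSimplex_δ (i : Fin (m + 2)) (g : Fin (m + 2) → ZMod 2 × ZMod 2)
    (x : ZMod 2 × ZMod 2) :
    (TopCat.toSSet.obj _).δ i (signPairSimplex (Function.update g i x)) =
      (TopCat.toSSet.obj _).δ i (signPairSimplex g) := by
  have h1 := TopCat.toSSetObjEquiv_symm_naturality
    (X := TopCat.of (signSpace (Fin (m + 2)) × signSpace (Fin (m + 2)))) (SimplexCategory.δ i)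
  refine (h1 _).trans (Eq.trans (congrArg _ ?_) (h1 _).symm)
  ext1 p
  have h : ∀ j, (Function.update g i x j = g j) ∨ (stdSimplex.map i.succAbove p).1 j = 0 :=
    fun j => by
      by_cases hj : j = i
      · subst hj; exact Or.inr (map_succAbove_apply_self _ p)
      · exact Or.inl (Function.update_of_ne hj _ _)
  exact Prod.ext (signSimplex_congr (t := stdSimplex.map i.succAbove p)
      fun j => (h j).imp_left (congrArg Prod.fst))
    (signSimplex_congr (t := stdSimplex.map i.succAbove p)
      fun j => (h j).imp_left (congrArg Prod.snd))

variable (m) in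
/-- The map given by the two double covers of a product of two copies of `signSpace`. -/
def signPairMap : TopCat.toSSet.obj (TopCat.of
    (signSpace (Fin (m + 1)) × signSpace (Fin (m + 1)))) ⟶ edgeNerve (ZMod 2 × ZMod 2) :=
  edgePair (edgeMap ⟨Prod.fst, continuous_fst⟩) (edgeMap ⟨Prod.snd, continuous_snd⟩)

theorem signPairMap_signPairSimplex (g : Fin (m + 1) → ZMod 2 × ZMod 2) :
    (signPairMap m).app _ (signPairSimplex g) = ofVertices g := by
  apply Subtype.ext
  funext i j
  exact Prod.ext (holonomy_signSimplex (fun i => (g i).1) i j)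
    (holonomy_signSimplex (fun i => (g i).2) i j)

/-- The simplices `signPairSimplex` satisfy the hypotheses of `sum_coboundary_eq_zero` and map to
the bar simplices of the nerve. The evaluation `evalSteps` is thus evaluation on the image of a
cycle, and it kills the pullback's coboundaries. -/
theorem pullCochain_signPairMap_notMem_boundaries
    {F : Cochain (edgeNerve (ZMod 2 × ZMod 2)) (ZMod 2) (m + 1)}
    (hF : evalSteps linearForm F ≠ 0) :
    pullCochain (signPairMap (m + 1)) (ZMod 2) (m + 1) F ∉ boundaries _ (ZMod 2) (m + 1) := by
  rintro ⟨b, hb⟩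
  apply hF
  have h0 : ((Fintype.card (ZMod 2 × ZMod 2) : ℕ) : Polynomial (ZMod 2)) = 0 := by
    rw [Fintype.card_prod, ZMod.card, Nat.cast_mul, Nat.cast_ofNat, two_eq_zero_poly, zero_mul]
  rw [← sum_coboundary_eq_zero linearForm h0 sum_linearForm sum_linearForm_sq signPairSimplex
    signPairSimplex_translate (fun i g x => signPairSimplex_δ i g x) b]
  unfold evalSteps
  refine Finset.sum_congr rfl fun h _ => ?_
  rw [hb, pullCochain, signPairMap_signPairSimplex]

theorem cup_sq1_powerCochain_notMem_boundaries {j M : ℕ} (hj : Odd j) (hM : M + 1 = 2 * (j + 2)) :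
    cupI (M + 1) (sq1 (pullCochain (signPairMap (M + 1)) (ZMod 2) (j + 1) (powerCochain j)))
      (sq1 (pullCochain (signPairMap (M + 1)) (ZMod 2) (j + 1) (powerCochain j))) ∉
      boundaries _ (ZMod 2) (M + 1) := by
  rw [sq1_pullCochain, cupI_pullCochain]
  apply pullCochain_signPairMap_notMem_boundaries
  rw [evalSteps_cup linearForm (by omega)]
  exact mul_self_ne_zero.mpr (evalSteps_sq1_powerCochain_ne_zero hj)

end Classes

/-! ### A nontrivial loop, and raising the degree by a product with it. -/

section Loop

variable {m : ℕ}

/-- The weights of `signLoop`. -/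
def loopWeight (m : ℕ) (t : stdSimplex ℝ (Fin 2)) : Fin (m + 2) → ℝ :=
  Fin.cons ((t.1 0 - t.1 1) ^ 2 - 1 / 8) (Fin.cons (4 * (t.1 0 * t.1 1) - 1 / 8) fun _ => -1)

/-- The vector whose square is the transition matrix of `signLoop`. -/
def loopVector (m : ℕ) (t : stdSimplex ℝ (Fin 2)) : Fin (m + 2) → ℝ :=
  Fin.cons (t.1 0 - t.1 1) (Fin.cons (t.1 0 * t.1 1) fun _ => 0)

theorem continuous_loopWeight : Continuous (loopWeight m) := by
  have h0 := continuous_coordinate (0 : Fin 2)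
  have h1 := continuous_coordinate (1 : Fin 2)
  refine continuous_pi fun i => ?_
  refine Fin.cases ?_ (fun i => Fin.cases ?_ (fun i => ?_) i) i
  · exact ((h0.sub h1).pow 2).sub continuous_const
  · exact (continuous_const.mul (h0.mul h1)).sub continuous_const
  · exact continuous_const

theorem continuous_loopVector : Continuous (loopVector m) := by
  have h0 := continuous_coordinate (0 : Fin 2)
  have h1 := continuous_coordinate (1 : Fin 2)
  refine continuous_pi fun i => ?_
  refine Fin.cases ?_ (fun i => Fin.cases ?_ (fun i => ?_) i) i
  · exact h0.sub h1
  · exact h0.mul h1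
  · exact continuous_const

/-- With a₀ = t₀ - t₁ and a₁ = t₀t₁ the weights are a₀² - 1/8, 4a₁ - 1/8, and -1 for the remaining
indices. Each is negative where its entry of the vector vanishes. -/
theorem loopVector_ne_zero (t : stdSimplex ℝ (Fin 2)) (i : Fin (m + 2))
    (h : 0 ≤ loopWeight m t i) : loopVector m t i ≠ 0 := by
  revert h
  unfold loopWeight loopVector
  refine Fin.cases ?_ (fun i => Fin.cases ?_ (fun i => ?_) i) i <;>
    simp only [Fin.cons_zero, Fin.cons_succ]
  · intro h h0
    rw [h0] at h
    norm_num at h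
  · intro h h0
    rw [h0] at h
    norm_num at h
  · intro h
    norm_num at h

theorem exists_loopWeight_pos (t : stdSimplex ℝ (Fin 2)) : ∃ i, 0 < loopWeight m t i := by
  have h : t.1 0 + t.1 1 = 1 := by simpa using t.2.2
  by_cases h0 : 0 < (t.1 0 - t.1 1) ^ 2 - 1 / 8
  · exact ⟨0, h0⟩
  · refine ⟨1, ?_⟩
    change 0 < 4 * (t.1 0 * t.1 1) - 1 / 8
    -- Since (t₀ - t₁)² + 4t₀t₁ = (t₀ + t₁)² = 1, the first two weights add up to 3/4, and one of
    -- them is positive.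
    have : (t.1 0 + t.1 1) ^ 2 = 1 := by rw [h]; norm_num
    nlinarith

variable (m) in
/-- A loop in `signSpace` over which the double cover is nontrivial. -/
def signLoop : C(stdSimplex ℝ (Fin 2), signSpace (Fin (m + 2))) :=
  rankOne (loopWeight m) (loopVector m) continuous_loopWeight continuous_loopVector
    loopVector_ne_zero exists_loopWeight_pos

theorem isFraming_signLoop :
    IsFraming (signLoop m) (fun i t => signBit (loopVector m t i)) :=
  isFraming_rankOne _ _ _ _ _ _

/-- At the ends the vector is (±1, 0, …, 0), and the sign is lost in the rank one matrix. The same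
change of sign gives the holonomy 1 below. -/
theorem signLoop_apply_zero_eq :
    signLoop m (stdSimplex.vertex 0) = signLoop m (stdSimplex.vertex 1) := by
  apply Subtype.ext
  refine Prod.ext ?_ ?_
  · funext i
    refine Fin.cases ?_ (fun i => Fin.cases ?_ (fun i => ?_) i) i <;> simp [signLoop, rankOne, loopWeight, loopVector]
  · funext i j
    refine Fin.cases ?_ (fun i => Fin.cases ?_ (fun i => ?_) i) i <;>
      refine Fin.cases ?_ (fun j => Fin.cases ?_ (fun j => ?_) j) j <;> simp [signLoop, rankOne, loopWeight, loopVector]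

theorem posIndex_signLoop (i : Fin 2) : posIndex (signLoop m (stdSimplex.vertex i)) = 0 := by
  have h := posIndex_spec (signLoop m (stdSimplex.vertex i))
  revert h
  generalize posIndex (signLoop m (stdSimplex.vertex i)) = l
  refine Fin.cases (fun _ => rfl) (fun l => Fin.cases ?_ (fun l => ?_) l) l
  · intro h
    fin_cases i <;> norm_num [signLoop, rankOne, loopWeight, loopVector] at h
  · intro h
    norm_num [signLoop, rankOne, loopWeight, loopVector] at h

theorem holonomy_signLoop :
    holonomy (signLoop m) (stdSimplex.vertex 0) (stdSimplex.vertex 1) = 1 := by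
  rw [isFraming_signLoop.holonomy_eq, posIndex_signLoop, posIndex_signLoop]
  norm_num [signBit, loopVector]

variable (X : TopCat.{0})

/-- The simplex of `X × signSpace` given by a simplex of `X` and a simplex of the loop. -/
def loopSimplex {X : TopCat.{0}} (m : ℕ) {n : ℕ} (τ : C(stdSimplex ℝ (Fin (n + 1)), X))
    (φ : Fin (n + 1) →o Fin 2) :
    C(stdSimplex ℝ (Fin (n + 1)), X × signSpace (Fin (m + 2))) :=
  τ.prodMk ((signLoop m).comp ⟨stdSimplex.map φ, stdSimplex.continuous_map φ⟩)

/-- The map which sends a simplex of `X` and a simplex of the interval to the simplex of the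
product of `X` and the loop. -/
def loopMap (m : ℕ) : cyl (TopCat.toSSet.obj X) ⟶
    TopCat.toSSet.obj (TopCat.of (X × signSpace (Fin (m + 2)))) where
  app n := ↾fun x => (TopCat.toSSetObjEquiv (TopCat.of (X × signSpace (Fin (m + 2)))) n).symm
    (loopSimplex m (TopCat.toSSetObjEquiv X n x.1) x.2)
  naturality n n' f := by
    ext x
    refine Eq.trans ?_ (TopCat.toSSetObjEquiv_symm_naturality
      (X := TopCat.of (X × signSpace (Fin (m + 2)))) f.unop _).symm
    refine congrArg (TopCat.toSSetObjEquiv (TopCat.of (X × signSpace (Fin (m + 2)))) n').symm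
      (ContinuousMap.ext fun p => Prod.ext rfl ?_)
    change signLoop m (stdSimplex.map (x.2 ∘ f.unop.toOrderHom) p) =
      signLoop m (stdSimplex.map x.2 (stdSimplex.map f.unop.toOrderHom p))
    rw [stdSimplex.map_comp_apply]

/-- The projection from the product with `signSpace`. -/
def fstSing (m : ℕ) : TopCat.toSSet.obj (TopCat.of (X × signSpace (Fin (m + 2)))) ⟶
    TopCat.toSSet.obj X :=
  TopCat.toSSet.map (TopCat.ofHom ⟨Prod.fst, continuous_fst⟩)

variable {X}

/-- The product of a cochain with the class of the double cover of `signSpace`. -/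
def crossSign (m : ℕ) {n : ℕ} (y : Cochain (TopCat.toSSet.obj X) (ZMod 2) n) :
    Cochain (TopCat.toSSet.obj (TopCat.of (X × signSpace (Fin (m + 2))))) (ZMod 2) (n + 1) :=
  cupI (n + 1) (pullCochain (fstSing X m) (ZMod 2) n y)
    (pullCochain (edgeMap (X := TopCat.of (X × signSpace (Fin (m + 2))))
      ⟨Prod.snd, continuous_snd⟩) (ZMod 2) 1 (stepCochain (AddMonoidHom.id _)))

theorem coboundary_crossSign {n : ℕ} {y : Cochain (TopCat.toSSet.obj X) (ZMod 2) n}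
    (hy : coboundary _ (ZMod 2) n y = 0) : coboundary _ (ZMod 2) (n + 1) (crossSign m y) = 0 := by
  refine coboundary_cup rfl ?_ ?_
  · rw [coboundary_pullCochain, hy]; rfl
  · rw [coboundary_pullCochain, coboundary_stepCochain]; rfl

theorem holonomy_loop_edge (φ : Fin 2 →o Fin 2) :
    holonomy ((signLoop m).comp ⟨stdSimplex.map φ, stdSimplex.continuous_map φ⟩)
      (stdSimplex.vertex 0) (stdSimplex.vertex 1) = if φ 1 = 1 ∧ φ 0 = 0 then 1 else 0 := by
  rw [holonomy_comp]
  simp only [ContinuousMap.coe_mk, stdSimplex.map_vertex]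
  have h : φ 0 ≤ φ 1 := φ.monotone (by decide)
  generalize φ 0 = a at *
  generalize φ 1 = b at *
  fin_cases a <;> fin_cases b
  · simpa using holonomy_self (signLoop m) _
  · simpa using holonomy_signLoop
  · exact absurd h (by decide)
  · simpa using holonomy_self (signLoop m) _

/-- The holonomy along the last edge of a simplex is 1 exactly when this edge runs from 0 to 1 in
the interval. So the class of the double cover pulls back to the fundamental cochain of the
interval. -/
theorem pullCochain_loopMap_crossSign {n : ℕ} (y : Cochain (TopCat.toSSet.obj X) (ZMod 2) n) :
    pullCochain (loopMap X m) (ZMod 2) (n + 1) (crossSign m y) = susp y := by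
  rw [crossSign, ← cupI_pullCochain]
  ext x
  rw [cupI_eq_front_mul_back rfl]
  have h1 : pullCochain (loopMap X m) (ZMod 2) 1 (pullCochain
      (edgeMap (X := TopCat.of (X × signSpace (Fin (m + 2)))) ⟨Prod.snd, continuous_snd⟩)
      (ZMod 2) 1 (stepCochain (AddMonoidHom.id _))) (back rfl x) =
      if IsTop (p := n) x.2 then 1 else 0 :=
    holonomy_loop_edge (x.2.comp (backMap rfl))
  rw [h1, mul_ite, mul_one, mul_zero]
  unfold susp
  have h2 : SimplexCategory.mkHom (frontMap (Nat.le_add_right n 1)) =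
      SimplexCategory.δ (Fin.last (n + 1)) := by
    ext i
    simp only [SimplexCategory.δ, SimplexCategory.mkHom]
    change i.1 = ((Fin.last (n + 1)).succAbove i).1
    rw [Fin.succAbove_last]
    rfl
  have h3 : (front (Nat.le_add_right n 1) x).1 =
      (TopCat.toSSet.obj X).δ (Fin.last (n + 1)) x.1 := by
    change (TopCat.toSSet.obj X).map (SimplexCategory.mkHom _).op x.1 = _
    rw [h2]
    rfl
  rw [← h3]
  rfl

theorem map_of_forall_eq {n : ℕ} (φ : Fin (n + 1) → Fin 2) (c : Fin 2) (hc : ∀ i, φ i = c)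
    (p : stdSimplex ℝ (Fin (n + 1))) : stdSimplex.map φ p = stdSimplex.vertex (S := ℝ) c := by
  ext j
  rw [stdSimplex.map_coe, FunOnFinite.linearMap_apply_apply]
  simp only [hc, stdSimplex.vertex_coe, Pi.single_apply]
  split_ifs with hj
  · simp [hj]
  · simp [Ne.symm hj]

theorem loopSimplex_threshold {n : ℕ} (τ : C(stdSimplex ℝ (Fin (n + 1)), X)) :
    loopSimplex m τ (threshold n 0) = loopSimplex m τ (threshold n (n + 1)) := by
  have h0 : (⟨stdSimplex.map (threshold n 0), stdSimplex.continuous_map (threshold n 0)⟩ :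
      C(stdSimplex ℝ (Fin (n + 1)), stdSimplex ℝ (Fin 2))) = ContinuousMap.const _ (stdSimplex.vertex 1) :=
    ContinuousMap.ext (map_of_forall_eq (threshold n 0) 1 fun i => by simp [threshold])
  have h1 : (⟨stdSimplex.map (threshold n (n + 1)), stdSimplex.continuous_map _⟩ :
      C(stdSimplex ℝ (Fin (n + 1)), stdSimplex ℝ (Fin 2))) = ContinuousMap.const _ (stdSimplex.vertex 0) :=
    ContinuousMap.ext (map_of_forall_eq (threshold n (n + 1)) 0 fun i => if_pos i.2)
  have h2 : (signLoop m).comp (ContinuousMap.const (stdSimplex ℝ (Fin (n + 1)))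
      (stdSimplex.vertex 1)) = (signLoop m).comp (ContinuousMap.const _ (stdSimplex.vertex 0)) := by
    rw [ContinuousMap.comp_const, ContinuousMap.comp_const, signLoop_apply_zero_eq]
  rw [loopSimplex, loopSimplex, h0, h1, h2]

theorem loopMap_app {n : ℕ} (σ : Simplex (TopCat.toSSet.obj X) n) (φ : Fin (n + 1) →o Fin 2) :
    (loopMap X m).app (op (SimplexCategory.mk n)) (σ, φ) =
      (TopCat.toSSetObjEquiv (TopCat.of (X × signSpace (Fin (m + 2)))) _).symm
        (loopSimplex m (TopCat.toSSetObjEquiv X (op (SimplexCategory.mk n)) σ) φ) := rfl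

theorem loopMap_levelSimplex {n : ℕ} (σ : Simplex (TopCat.toSSet.obj X) n) :
    (loopMap X m).app _ (levelSimplex σ 0) = (loopMap X m).app _ (levelSimplex σ (n + 1)) := by
  rw [levelSimplex, levelSimplex, loopMap_app, loopMap_app, loopSimplex_threshold]

/-- A primitive of the square for y × t pulls back to a primitive of the suspended square for y. It
takes equal values on the two ends of the cylinder, because these have the same image under the
loop, so it can be integrated to a primitive downstairs. -/
theorem cup_sq1_crossSign_notMem_boundaries {n l : ℕ}
    {y : Cochain (TopCat.toSSet.obj X) (ZMod 2) n}
    (h : cupI (l + 1) (sq1 y) (sq1 y) ∉ boundaries _ (ZMod 2) (l + 1)) :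
    cupI (l + 2) (sq1 (crossSign m y)) (sq1 (crossSign m y)) ∉ boundaries _ (ZMod 2) (l + 2) := by
  rintro ⟨b, hb⟩
  apply h
  refine mem_boundaries_of_susp (b := pullCochain (loopMap X m) (ZMod 2) (l + 1) b) ?_ ?_
  · rw [coboundary_pullCochain, hb, ← cupI_pullCochain, ← sq1_pullCochain,
      pullCochain_loopMap_crossSign, sq1_susp, cupI_susp]
  · intro σ
    exact congrArg b (loopMap_levelSimplex σ)

end Loop

/-! ### Manifolds with a nonzero square of a Bockstein, for all n ≥ 2k. -/

section Nonvanishing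

theorem signSpace_nonempty (m : ℕ) : Nonempty (signSpace (Fin (m + 2))) :=
  ⟨signLoop m (stdSimplex.vertex 0)⟩

/-- An open subset of a finite-dimensional space carries a mod 2 cocycle of degree `n` whose
Bockstein has a nonzero square with respect to the cup product of degree `n + 1 + (2 k + 1)`. -/
def HasBocksteinSquare (k n : ℕ) : Prop :=
  ∃ (V : Type) (_ : NormedAddCommGroup V) (_ : NormedSpace ℝ V) (_ : FiniteDimensional ℝ V)
    (X : TopCat.{0}) (e : X → V), Nonempty X ∧ Topology.IsOpenEmbedding e ∧
    ∃ y : Cochain (TopCat.toSSet.obj X) (ZMod 2) n, coboundary _ (ZMod 2) n y = 0 ∧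
      ∀ l, l = n + 1 + 2 * k →
        cupI (l + 1) (sq1 y) (sq1 y) ∉ boundaries (TopCat.toSSet.obj X) (ZMod 2) (l + 1)

theorem hasBocksteinSquare_two_mul {k : ℕ} (hk : 1 ≤ k) : HasBocksteinSquare k (2 * k) := by
  obtain ⟨j, rfl⟩ := Nat.exists_eq_add_of_le' hk
  -- With k = j + 1 the class y has degree 2k and the square of Sq¹y has degree 4k + 2 = M + 1. The
  -- model needs one index for each vertex of a simplex of this dimension, hence `M + 2` of them.
  let M := 4 * j + 5
  have hne := signSpace_nonempty M
  refine ⟨_, inferInstance, inferInstance, inferInstance,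
    TopCat.of (signSpace (Fin (M + 2)) × signSpace (Fin (M + 2))),
    Prod.map Subtype.val Subtype.val, inferInstanceAs (Nonempty (_ × _)),
    (isOpen_signSpace _).isOpenEmbedding_subtypeVal.prodMap
      (isOpen_signSpace _).isOpenEmbedding_subtypeVal,
    pullCochain (signPairMap (M + 1)) (ZMod 2) (2 * j + 1 + 1) (powerCochain (2 * j + 1)), ?_, ?_⟩
  · exact (coboundary_pullCochain _ _).trans
      (congrArg (pullCochain _ _ _) (coboundary_powerCochain (2 * j + 1)))
  · intro l hl
    obtain rfl : l = M := by omega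
    exact cup_sq1_powerCochain_notMem_boundaries ⟨j, rfl⟩ (by omega)

theorem HasBocksteinSquare.succ {k n : ℕ} (h : HasBocksteinSquare k n) :
    HasBocksteinSquare k (n + 1) := by
  obtain ⟨V, _, _, _, X, e, hX, he, y, hy, h⟩ := h
  have hne := signSpace_nonempty 0
  refine ⟨V × ((Fin 2 → ℝ) × (Fin 2 → Fin 2 → ℝ)), inferInstance, inferInstance, inferInstance,
    TopCat.of (X × signSpace (Fin (0 + 2))), Prod.map e Subtype.val,
    inferInstanceAs (Nonempty (_ × _)),
    he.prodMap (isOpen_signSpace _).isOpenEmbedding_subtypeVal, crossSign 0 y,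
    coboundary_crossSign hy, ?_⟩
  intro l hl
  obtain ⟨l, rfl⟩ : ∃ l', l = l' + 1 := ⟨l - 1, by omega⟩
  exact cup_sq1_crossSign_notMem_boundaries (h l (by omega))

theorem hasBocksteinSquare {k n : ℕ} (hk : 1 ≤ k) (hn : 2 * k ≤ n) : HasBocksteinSquare k n := by
  induction n, hn using Nat.le_induction with
  | base => exact hasBocksteinSquare_two_mul hk
  | succ n _ ih => exact ih.succ

theorem exists_manifold_cocycle {k n : ℕ} (hk : 1 ≤ k) (hn : 2 * k ≤ n) :
    ∃ (X : SmoothManifold) (y : Cochain (Sing X) (ZMod 2) n),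
      coboundary (Sing X) (ZMod 2) n y = 0 ∧ cupI (n + 1 + (2 * k + 1)) (sq1 y) (sq1 y) ∉
        boundaries (Sing X) (ZMod 2) (n + 1 + (2 * k + 1)) := by
  obtain ⟨V, _, _, _, X, e, hX, he, y, hy, h⟩ := hasBocksteinSquare hk hn
  have he' : Topology.IsOpenEmbedding (toEuclidean (E := V) ∘ e) :=
    toEuclidean.toHomeomorph.isOpenEmbedding.comp he
  -- The open embedding into Euclidean space serves as the only chart.
  let _ : ChartedSpace (E (Module.finrank ℝ V)) X := he'.singletonChartedSpace
  have : IsManifold (𝓡 (Module.finrank ℝ V)) ∞ X := he'.isManifold_singleton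
  have : T2Space X := he'.isEmbedding.t2Space
  have : SecondCountableTopology X := he'.isEmbedding.secondCountableTopology
  exact ⟨⟨Module.finrank ℝ V, X⟩, y, hy, h _ rfl⟩

end Nonvanishing

/-! ### Consequences for the integral Bockstein. -/

section Bockstein

variable {S : SSet.{u}}

theorem Cohomology.mk_eq_zero {A : Type} [AddCommGroup A] {n : ℕ} {a : Cochain S A n}
    {ha : coboundary S A n a = 0} : Cohomology.mk a ha = 0 ↔ a ∈ boundaries S A n := by
  have h := Cohomology.mk_eq_mk (a := 0) (b := a) (ha := map_zero _) (hb := ha)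
  rw [sub_zero] at h
  exact eq_comm.trans h

theorem rho_zero {n : ℕ} : rho (0 : Cohomology S ℤ n) = 0 := by
  refine Cohomology.mk_eq_zero.mpr ?_
  convert! AddSubgroup.zero_mem _

theorem bockstein_rho {n : ℕ} (z : Cohomology S ℤ n) : bockstein (rho z) = 0 := by
  obtain ⟨⟨a, ha⟩, rfl⟩ := QuotientAddGroup.mk_surjective z
  have ha : coboundary S ℤ n a = 0 := ha
  refine Cohomology.mk_eq_zero.mpr ?_
  -- The cocycle `a` is itself an integral lift of its reduction and has zero coboundary. The chosen
  -- lift differs from it by 2e, so the Bockstein is δe.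
  obtain ⟨e, he⟩ := exists_two_mul (liftCochain (red a) - a) (by
    ext σ
    have := congrFun (coeff_liftCochain (red a)) σ
    simp only [coeffCochain, Int.coe_castAddHom, Pi.sub_apply, Int.cast_sub, Pi.zero_apply] at this ⊢
    rw [this, sub_self])
  refine ⟨e, two_smul_cancel ?_⟩
  have hr : coboundary S (ZMod 2) n (red a) = 0 := by
    rw [coboundary_coeffCochain, ha]; ext; simp [coeffCochain]
  rw [two_smul_bocksteinCochain _ hr, ← map_zsmul, ← he, map_sub, ha, sub_zero]

theorem Sq_rho_bockstein_ne_zero {k n : ℕ} {y : Cochain S (ZMod 2) n}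
    (hy : coboundary S (ZMod 2) n y = 0)
    (h : cupI (n + 1 + (2 * k + 1)) (sq1 y) (sq1 y) ∉
      boundaries S (ZMod 2) (n + 1 + (2 * k + 1))) :
    Sq (2 * k + 1) rfl (rho (bockstein (Cohomology.mk y hy))) ≠ 0 :=
  fun h0 => h (Cohomology.mk_eq_zero.mp h0)

theorem bockstein_Sq_ne_zero {k p m : ℕ} (hm : p + 2 * k = m) {x : Cohomology S (ZMod 2) p}
    (h : Sq (2 * k + 1) rfl x ≠ 0) : bockstein (Sq (2 * k) hm x) ≠ 0 := by
  subst hm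
  intro h0
  rw [← rho_bockstein_Sq, h0, rho_zero] at h
  exact h rfl

end Bockstein

/-! ### Bockstein classes as flat differential classes. -/

section Differential

variable {X : SmoothManifold}

/-- The zero form. -/
def zeroForm (X : SmoothManifold) (n : ℕ) : ClosedForm X n where
  toFun _ := 0
  smooth _ _ _ _ _ := contDiffOn_const (c := 0)
  closed e U φ _ _ u _ := by
    have h : pullForm (X := X) (n := n) (fun _ => 0) φ = fun _ => 0 := rfl
    rw [h, extDeriv, fderiv_const_apply]
    exact map_zero (ContinuousAlternatingMap.alternatizeUncurryFinCLM ℝ (E e) ℝ)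

theorem integralCochain_zeroForm (n : ℕ) : integralCochain (zeroForm X n) = 0 := by
  ext σ
  have h : ∀ t, pullForm (zeroForm X n).toFun (inCoords (simplexMap σ.1)) t = 0 := fun _ => rfl
  simp only [integralCochain, integrate, h]
  simp

/-- The flat differential cocycle given by a cocycle with coefficients in `ℤ/2`. -/
def flatCocycle {n : ℕ} (y : Cochain (Sing X) (ZMod 2) n)
    (hy : coboundary (Sing X) (ZMod 2) n y = 0) : DiffCocycle X n where
  c := bocksteinCochain y
  -- With zero curvature the requirement is δh = -c, and c is half the coboundary of the lift of y.
  -- This fixes both the factor and the sign.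
  h := fun σ => -(1 / 2) * toSmoothReal (liftCochain y) σ
  curv := zeroForm X (n + 1)
  coboundary_c := coboundary_bocksteinCochain hy
  coboundary_h := by
    rw [integralCochain_zeroForm, zero_sub]
    have h1 : coboundary (SmSing X) ℝ n (toSmoothReal (liftCochain y)) =
        toSmoothReal ((2 : ℤ) • bocksteinCochain y) := by
      rw [two_smul_bocksteinCochain y hy]
      unfold toSmoothReal
      rw [coboundary_coeffCochain, coboundary_pullCochain]
    ext σ
    have h2 := congrFun h1 σ
    simp only [coboundary_apply, toSmoothReal, coeffCochain, pullCochain, Pi.smul_apply,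
      smul_eq_mul, Int.coe_castAddHom, Int.cast_mul, Int.cast_ofNat, Pi.neg_apply, zsmul_eq_mul]
      at h2 ⊢
    simp only [mul_left_comm _ (-(1 / 2) : ℝ), ← Finset.mul_sum]
    rw [h2]
    ring

/-- The class of `flatCocycle`. -/
def flatClass {n : ℕ} (y : Cochain (Sing X) (ZMod 2) n)
    (hy : coboundary (Sing X) (ZMod 2) n y = 0) : DiffCohomology X n :=
  Quotient.mk (diffCocycleSetoid X n) (flatCocycle y hy)

theorem I_flatClass {n : ℕ} (y : Cochain (Sing X) (ZMod 2) n)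
    (hy : coboundary (Sing X) (ZMod 2) n y = 0) :
    (flatClass y hy).I = bockstein (Cohomology.mk y hy) := rfl

end Differential

end DiffSteenrod

end

/-! ### The theorem. -/

theorem mainTheorem3 (k n : ℕ) (hk : 1 ≤ k) (hn : 2 * k + 1 ≤ n + 1) :
    -- `ρ₂ β Sq²ᵏ = Sq²ᵏ⁺¹`
    (∀ (X : TopCat.{0}) (p : ℕ)
      (x : DiffSteenrod.Cohomology (TopCat.toSSet.obj X) (ZMod 2) p),
      DiffSteenrod.rho (DiffSteenrod.bockstein (DiffSteenrod.Sq (2 * k) rfl x)) =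
        DiffSteenrod.Sq (2 * k + 1) rfl x) ∧
    -- `β Sq²ᵏ` and `Sq²ᵏ⁺¹` are nonzero on (reductions of) integral classes of degree `n + 1`
    (∃ (X : DiffSteenrod.SmoothManifold)
      (x : DiffSteenrod.Cohomology (DiffSteenrod.Sing X) ℤ (n + 1)),
      DiffSteenrod.bockstein (DiffSteenrod.Sq (2 * k) rfl (DiffSteenrod.rho x)) ≠ 0 ∧
      DiffSteenrod.Sq (2 * k + 1) rfl (DiffSteenrod.rho x) ≠ 0) ∧
    -- there is no integral lift
    (¬ ∃ θ : DiffSteenrod.IntegralOperation (n + 1) (n + 1 + 2 * k), θ.Lifts (2 * k) rfl) ∧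
    -- there is no differential refinement
    (¬ ∃ θ : DiffSteenrod.DifferentialOperation n (n + 2 * k),
      θ.Refines (2 * k) (Nat.add_right_comm n 1 (2 * k))) := by
  -- The same class β[y] on `X` serves for the nonvanishing and for both obstructions.
  obtain ⟨X, y, hy, h⟩ := DiffSteenrod.exists_manifold_cocycle hk (Nat.le_of_succ_le_succ hn)
  have hSq := DiffSteenrod.Sq_rho_bockstein_ne_zero hy h
  refine ⟨fun X p x => DiffSteenrod.rho_bockstein_Sq k p x,
    ⟨X, _, DiffSteenrod.bockstein_Sq_ne_zero rfl hSq, hSq⟩, ?_, ?_⟩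
  · rintro ⟨θ, hθ⟩
    apply DiffSteenrod.bockstein_Sq_ne_zero rfl hSq
    rw [← hθ, DiffSteenrod.bockstein_rho]
  · rintro ⟨θ, hθ⟩
    -- The target degree is `n + 2 * k + 1` here, as differential cohomology is indexed by the
    -- degree minus one; it equals `n + 1 + 2 * k` only up to rearrangement. The flat class of `y`
    -- then gives the contradiction βρ₂ = 0.
    apply DiffSteenrod.bockstein_Sq_ne_zero (Nat.add_right_comm n 1 (2 * k)) hSq
    rw [← DiffSteenrod.I_flatClass, ← hθ, DiffSteenrod.bockstein_rho]
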